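/- **Theorem.** Let $n>2$, let $(N,h)$ be a smooth $n$-dimensional Riemannian manifold (without boundary, Hausdorff, second countable), let $\rho\in C^\infty(N)$, and let $\widetilde h=e^{2\rho}h$. Then the identity map $\mathbf 1:(N,h)\to(N,\widetilde h)$ is biharmonic if and only if $$\operatorname{trace}_h\nabla^2\operatorname{grad}\rho+\bigl(2\Delta\rho+(2-n)|\operatorname{grad}\rho|_h^2\bigr)\operatorname{grad}\rho+\frac{6-n}{2}\operatorname{grad}\bigl(|\operatorname{grad}\rho|_h^2\bigr)+\operatorname{Ricci}(\operatorname{grad}\rho)=0\quad\text{on } N.$$ Here $\nabla$, $\operatorname{grad}$, $|\cdot|_h$, $\Delta$ and $\operatorname{Ricci}$ are taken with respect to $h$: $\nabla$ is the Levi-Civita connection; $\nabla^2_{X,Y}Z=\nabla_X\nabla_YZ-\nabla_{\nabla_XY}Z$; $\Delta\rho=-\operatorname{div}\operatorname{grad}\rho=-\operatorname{trace}_h\nabla d\rho$ is the nonnegative Laplacian; and $\operatorname{Ricci}$ is the Ricci operator, $h(\operatorname{Ricci}(X),Y)=\operatorname{trace}\bigl(Z\mapsto R(Z,X)Y\bigr)$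 with $R(X,Y)=[\nabla_X,\nabla_Y]-\nabla_{[X,Y]}$. A smooth map $\phi:(M,g)\to(N',h')$ between Riemannian manifolds, with tension field $\tau(\phi)=\operatorname{trace}_g\nabla d\phi$, is called *biharmonic* if it is a critical point of the bienergy, that is, if for every compact $K\subseteq M$ and every smooth variation $(\phi_t)_{|t|<\varepsilon}$ of $\phi=\phi_0$ with $\phi_t=\phi$ outside $K$, $$\frac{d}{dt}\Big|_{t=0}E_2(\phi_t)=0,\qquad E_2(\phi_t)=\frac12\int_K|\tau(\phi_t)|_{h'}^2\,v_g .$$ -/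

import Mathlib

open Set MeasureTheory Bundle
open scoped Manifold ContDiff Topology

noncomputable section

namespace BiharmonicConformal

/-- The model space `ℝⁿ`. -/
abbrev Eu (n : ℕ) : Type := EuclideanSpace ℝ (Fin n)

/-- Smooth Riemannian metrics on an `n`-dimensional manifold `M`. -/
abbrev RMetric (n : ℕ) (M : Type*) [TopologicalSpace M] [ChartedSpace (Eu n) M]
    [IsManifold (𝓡 n) ∞ M] : Type _ :=
  ContMDiffRiemannianMetric (𝓡 n) ∞ (Eu n) (fun x : M ↦ TangentSpace (𝓡 n) x)

/-- The partial derivative `∂f/∂uⁱ` of a function on `ℝⁿ`. -/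
def pd {n : ℕ} (i : Fin n) (f : Eu n → ℝ) (u : Eu n) : ℝ :=
  fderiv ℝ f u (EuclideanSpace.single i 1)

section Charts

variable {n : ℕ} {M : Type*} [TopologicalSpace M] [ChartedSpace (Eu n) M]
  [IsManifold (𝓡 n) ∞ M]

/-- The coordinate vector field `∂ᵢ` of the chart around `p`, at a point `y` of the chart domain
(the trivialization of the tangent bundle around `p` is the differential of that chart). -/
def coordField (p : M) (i : Fin n) (y : M) : TangentSpace (𝓡 n) y :=
  (trivializationAt (Eu n) (TangentSpace (𝓡 n) : M → Type _) p).symmL ℝ y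
    (EuclideanSpace.single i 1)

/-- The components `Xᵏ` of a vector field `X = ∑ Xᵏ ∂ₖ` in the chart around `p`, as functions of
the coordinate `u`. -/
def comp (p : M) (X : ∀ y : M, TangentSpace (𝓡 n) y) (k : Fin n) (u : Eu n) : ℝ :=
  (trivializationAt (Eu n) (TangentSpace (𝓡 n) : M → Type _) p).continuousLinearMapAt ℝ
    ((extChartAt (𝓡 n) p).symm u) (X ((extChartAt (𝓡 n) p).symm u)) k

/-- The matrix `gᵢⱼ = g(∂ᵢ, ∂ⱼ)` of the metric in the chart around `p`, as a function of the
coordinate `u`. -/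
def gram (g : RMetric n M) (p : M) (u : Eu n) : Matrix (Fin n) (Fin n) ℝ :=
  Matrix.of fun i j ↦
    g.inner ((extChartAt (𝓡 n) p).symm u)
      (coordField p i ((extChartAt (𝓡 n) p).symm u))
      (coordField p j ((extChartAt (𝓡 n) p).symm u))

/-- The Christoffel symbols `Γᵏᵢⱼ` of the Levi-Civita connection in the chart around `p`. -/
def christoffel (g : RMetric n M) (p : M) (k i j : Fin n) (u : Eu n) : ℝ :=
  1 / 2 * ∑ l, (gram g p u)⁻¹ k l *
    (pd i (fun w ↦ gram g p w j l) u + pd j (fun w ↦ gram g p w i l) u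
      - pd l (fun w ↦ gram g p w i j) u)

/-- The components `(∇_{∂ᵢ} X)ᵏ` of the covariant derivative of a vector field. -/
def covD (g : RMetric n M) (p : M) (X : ∀ y : M, TangentSpace (𝓡 n) y) (k i : Fin n)
    (u : Eu n) : ℝ :=
  pd i (comp p X k) u + ∑ l, christoffel g p k i l u * comp p X l u

/-- The components `(∇²_{∂ᵢ,∂ⱼ} X)ᵏ` of the second covariant derivative
`∇²_{V,W} X = ∇_V ∇_W X - ∇_{∇_V W} X` of a vector field. -/
def covD2 (g : RMetric n M) (p : M) (X : ∀ y : M, TangentSpace (𝓡 n) y) (k i j : Fin n)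
    (u : Eu n) : ℝ :=
  pd i (covD g p X k j) u + ∑ l, christoffel g p k i l u * covD g p X l j u
    - ∑ l, christoffel g p l i j u * covD g p X k l u

/-- The components of the curvature tensor `R(V,W) = [∇_V, ∇_W] - ∇_{[V,W]}`:
`R(∂ᵢ, ∂ⱼ) ∂ₖ = ∑ₗ (curv l i j k) ∂ₗ`. -/
def curv (g : RMetric n M) (p : M) (l i j k : Fin n) (u : Eu n) : ℝ :=
  pd i (christoffel g p l j k) u - pd j (christoffel g p l i k) u
    + ∑ r, (christoffel g p r j k u * christoffel g p l i r u
      - christoffel g p r i k u * christoffel g p l j r u)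

/-- The components `Ricⱼₖ` of the Ricci tensor `Ric(V,W) = trace (Z ↦ R(Z,V)W)`. -/
def ricciTensor (g : RMetric n M) (p : M) (j k : Fin n) (u : Eu n) : ℝ :=
  ∑ i, curv g p i i j k u

/-! ### Invariant objects; their value at `x` is computed in the chart around `x`. -/

/-- The gradient of a function. -/
def grad (g : RMetric n M) (f : M → ℝ) (x : M) : TangentSpace (𝓡 n) x :=
  ∑ i, ∑ j, ((gram g x (extChartAt (𝓡 n) x x))⁻¹ i j *
    mvfderiv (𝓡 n) f x (coordField x j x)) • coordField x i x

/-- The squared length `|X|²` of a vector field. -/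
def normSq (g : RMetric n M) (X : ∀ y : M, TangentSpace (𝓡 n) y) (x : M) : ℝ :=
  g.inner x (X x) (X x)

/-- The nonnegative Laplacian on functions, `Δf = -div grad f = -trace ∇ grad f`. -/
def laplacian (g : RMetric n M) (f : M → ℝ) (x : M) : ℝ :=
  -∑ k, covD g x (grad g f) k k (extChartAt (𝓡 n) x x)

/-- `trace_g ∇² X` for a vector field `X`. -/
def traceHess (g : RMetric n M) (X : ∀ y : M, TangentSpace (𝓡 n) y) (x : M) :
    TangentSpace (𝓡 n) x :=
  ∑ k, (∑ i, ∑ j, (gram g x (extChartAt (𝓡 n) x x))⁻¹ i j *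
    covD2 g x X k i j (extChartAt (𝓡 n) x x)) • coordField x k x

/-- The Ricci operator `Ricci(X)`, defined by `g(Ricci(X), Y) = Ric(X, Y)`. -/
def ricciOp (g : RMetric n M) (X : ∀ y : M, TangentSpace (𝓡 n) y) (x : M) :
    TangentSpace (𝓡 n) x :=
  ∑ l, (∑ j, ∑ k, (gram g x (extChartAt (𝓡 n) x x))⁻¹ l j *
    ricciTensor g x j k (extChartAt (𝓡 n) x x) * comp x X k (extChartAt (𝓡 n) x x)) •
      coordField x l x

/-- The Riemannian volume measure: the least measure that dominates, for every chart,
the measure `√(det gᵢⱼ) du¹⋯duⁿ` on the chart domain. (These measures agree on overlaps, so on each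
chart domain it is this measure.) -/
def riemannianVolume [MeasurableSpace M] (g : RMetric n M) : Measure M :=
  ⨆ p : M, Measure.map (extChartAt (𝓡 n) p).symm
    ((volume.restrict (extChartAt (𝓡 n) p).target).withDensity
      fun u ↦ ENNReal.ofReal (Real.sqrt (gram g p u).det))

end Charts

section Maps

variable {m n : ℕ} {M : Type*} [TopologicalSpace M] [ChartedSpace (Eu m) M]
  [IsManifold (𝓡 m) ∞ M] {N : Type*} [TopologicalSpace N] [ChartedSpace (Eu n) N]
  [IsManifold (𝓡 n) ∞ N]

/-- The components `(∇dφ)ᵏᵢⱼ` at `x` of the second fundamental form `∇dφ` of a map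
`φ : (M, g) → (N, h)`, in the charts around `x` and `φ x`:
`∂ᵢ∂ⱼφᵏ - ∑ₗ Γ(g)ˡᵢⱼ ∂ₗφᵏ + ∑ₐ ∑ᵦ (Γ(h)ᵏₐᵦ ∘ φ) ∂ᵢφᵃ ∂ⱼφᵝ`. -/
def secondFundamentalForm (g : RMetric m M) (h : RMetric n N) (φ : M → N) (x : M)
    (k : Fin n) (i j : Fin m) : ℝ :=
  let F : Fin n → Eu m → ℝ := fun a u ↦ writtenInExtChartAt (𝓡 m) (𝓡 n) x φ u a
  let u₀ : Eu m := extChartAt (𝓡 m) x x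
  pd i (pd j (F k)) u₀
    - ∑ l, christoffel g x l i j u₀ * pd l (F k) u₀
    + ∑ a, ∑ b, christoffel h (φ x) k a b (extChartAt (𝓡 n) (φ x) (φ x)) *
        pd i (F a) u₀ * pd j (F b) u₀

/-- The tension field `τ(φ) = trace_g ∇dφ`, a vector field along `φ`. -/
def tension (g : RMetric m M) (h : RMetric n N) (φ : M → N) (x : M) :
    TangentSpace (𝓡 n) (φ x) :=
  ∑ k, (∑ i, ∑ j, (gram g x (extChartAt (𝓡 m) x x))⁻¹ i j *
    secondFundamentalForm g h φ x k i j) • coordField (φ x) k (φ x)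

/-- The bienergy `E₂(φ) = ½ ∫_K |τ(φ)|² v_g` over `K ⊆ M`. -/
def bienergy [MeasurableSpace M] (g : RMetric m M) (h : RMetric n N) (K : Set M)
    (φ : M → N) : ℝ :=
  1 / 2 * ∫ x in K, h.inner (φ x) (tension g h φ x) (tension g h φ x) ∂(riemannianVolume g)

/-- A smooth map is biharmonic if it is a critical point of the bienergy: for every compact `K` and
every smooth variation `(φₜ)`, `|t| < ε`, of `φ` supported in `K`, the derivative of
`t ↦ E₂(φₜ)` at `t = 0` exists and vanishes. -/
def IsBiharmonic [MeasurableSpace M] (g : RMetric m M) (h : RMetric n N) (φ : M → N) : Prop :=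
  ContMDiff (𝓡 m) (𝓡 n) ∞ φ ∧
  ∀ K : Set M, IsCompact K → ∀ ε : ℝ, 0 < ε → ∀ Φ : ℝ → M → N,
    ContMDiffOn (𝓘(ℝ, ℝ).prod (𝓡 m)) (𝓡 n) ∞ (fun q : ℝ × M ↦ Φ q.1 q.2)
      (Ioo (-ε) ε ×ˢ univ) →
    Φ 0 = φ →
    (∀ t ∈ Ioo (-ε) ε, ∀ x ∉ K, Φ t x = φ x) →
    HasDerivAt (fun t ↦ bienergy g h K (Φ t)) 0 0

end Maps

end BiharmonicConformal

end

noncomputable section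

namespace BiharmonicConformal

/-! ### Partial derivatives -/

section PartialDerivatives

variable {n : ℕ} {u : Eu n} {f g : Eu n → ℝ}

/-! In a chart the identity map has constant Jacobian and no second derivatives, so its tension
field is `τᵏ = gⁱʲ(Γ'ᵏᵢⱼ - Γᵏᵢⱼ)`, a contraction of the difference of the two connections. For `h' =
e^{2ρ} h` this is `(2 - n) grad ρ`, and the covector `η = h'(τ, ·)` is `(2 - n) e^{2ρ} dρ`.

Along a variation with velocity `V`, the derivative of `½|τ|²` at `t = 0` is a linear second-order
operator in `V` (`hasDerivAt_tensionSq`). The product rule rewrites it pointwise as `E_c Vᶜ` plus a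
divergence (`IsLeviCivita.firstVariation_eq`), and the divergence integrates to zero when `V` has
compact support (`IsMetric.setIntegral_divergence_eq_zero`). Hence `E` is the Euler–Lagrange
covector.

The algebraic core is `IsLeviCivita.eulerLagrange_conformal`. Split `Γ'` into `Γ` and its conformal
correction. The `Γ` part of `E` is the traced second covariant derivative of `η` plus a curvature
contraction, which the symmetries of the curvature turn into the Ricci tensor; the correction
supplies the terms of first order. The outcome is `(2 - n) e^{2ρ}` times the left-hand side of the
equation with its index lowered. The factor does not vanish because `n ≠ 2`, so `E = 0` is the
stated equation.

On the manifold every object is evaluated in the chart around the point itself, so one must know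
that `|τ|²`, the gradient and the volume can be computed in any chart (`tensionSq_transform`,
`grad_eq_sum`, `riemannianVolume_restrict_source`). If the identity is biharmonic, the variations `u
+ t χ(u) e` inside a chart and the fundamental lemma of the calculus of variations give `E = 0`.
Conversely, the support of a variation `Φ` need not lie in one chart. For cutoffs `χ_b` with sum `1`
on the support, the variations `Φ(t χ_b(x), x)` have velocities `χ_b V`, which add up to `V`; since
the first variation is linear in the velocity, it is a sum of terms supported in chart domains.
Finally `E` transforms as a covector (`idEulerLagrange_transform`), so its vanishing at the centre
of each chart is its vanishing everywhere. -/

@[fun_prop] theorem contDiffAt_pd (hf : ContDiffAt ℝ ∞ f u) (i : Fin n) : ContDiffAt ℝ ∞ (pd i f) u :=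
  (hf.fderiv_right (m := ∞) le_rfl).clm_apply contDiffAt_const

theorem differentiableAt_of_smooth (hf : ContDiffAt ℝ ∞ f u) : DifferentiableAt ℝ f u :=
  hf.differentiableAt (by simp)

theorem pd_congr (h : f =ᶠ[𝓝 u] g) (i : Fin n) : pd i f u = pd i g u := by
  simp only [pd, h.fderiv_eq]

theorem pd_congr_nhds (h : f =ᶠ[𝓝 u] g) (i : Fin n) : pd i f =ᶠ[𝓝 u] pd i g :=
  h.eventuallyEq_nhds.mono fun _ hw ↦ pd_congr hw i

@[simp] theorem pd_const (c : ℝ) (i : Fin n) : pd i (fun _ ↦ c) u = 0 := by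
  simp [pd]

theorem pd_add (hf : ContDiffAt ℝ ∞ f u) (hg : ContDiffAt ℝ ∞ g u) (i : Fin n) :
    pd i (fun w ↦ f w + g w) u = pd i f u + pd i g u := by
  simp only [pd]
  rw [fderiv_fun_add (differentiableAt_of_smooth hf) (differentiableAt_of_smooth hg)]
  rfl

theorem pd_sub (hf : ContDiffAt ℝ ∞ f u) (hg : ContDiffAt ℝ ∞ g u) (i : Fin n) :
    pd i (fun w ↦ f w - g w) u = pd i f u - pd i g u := by
  simp only [pd]
  rw [fderiv_fun_sub (differentiableAt_of_smooth hf) (differentiableAt_of_smooth hg)]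
  rfl

theorem pd_mul (hf : ContDiffAt ℝ ∞ f u) (hg : ContDiffAt ℝ ∞ g u) (i : Fin n) :
    pd i (fun w ↦ f w * g w) u = pd i f u * g u + f u * pd i g u := by
  simp only [pd]
  rw [fderiv_fun_mul (differentiableAt_of_smooth hf) (differentiableAt_of_smooth hg)]
  simp
  ring

theorem pd_const_mul (hf : ContDiffAt ℝ ∞ f u) (c : ℝ) (i : Fin n) :
    pd i (fun w ↦ c * f w) u = c * pd i f u := by
  rw [pd_mul contDiffAt_const hf, pd_const]; ring

theorem pd_sum {ι : Type*} {s : Finset ι} {F : ι → Eu n → ℝ}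
    (hF : ∀ a ∈ s, ContDiffAt ℝ ∞ (F a) u) (i : Fin n) :
    pd i (fun w ↦ ∑ a ∈ s, F a w) u = ∑ a ∈ s, pd i (F a) u := by
  simp only [pd]
  rw [fderiv_fun_sum fun a ha ↦ differentiableAt_of_smooth (hF a ha)]
  simp

theorem pd_exp (hf : ContDiffAt ℝ ∞ f u) (i : Fin n) :
    pd i (fun w ↦ Real.exp (2 * f w)) u = 2 * Real.exp (2 * f u) * pd i f u := by
  have h2 := (differentiableAt_of_smooth hf).const_mul (2 : ℝ)
  simp only [pd]
  rw [fderiv_exp h2, fderiv_const_mul (differentiableAt_of_smooth hf)]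
  simp
  ring

theorem pd_comm (hf : ContDiffAt ℝ ∞ f u) (i j : Fin n) :
    pd i (pd j f) u = pd j (pd i f) u := by
  have hd : DifferentiableAt ℝ (fderiv ℝ f) u :=
    (hf.fderiv_right (m := ∞) le_rfl).differentiableAt (by simp)
  have key (a b : Fin n) : pd a (pd b f) u =
      fderiv ℝ (fderiv ℝ f) u (EuclideanSpace.single a 1) (EuclideanSpace.single b 1) := by
    change fderiv ℝ (fun w ↦ fderiv ℝ f w (EuclideanSpace.single b 1)) u _ = _
    rw [fderiv_clm_apply hd (differentiableAt_const _)]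
    simp
  rw [key, key]
  have := hf.isSymmSndFDerivAt (by simp; norm_cast)
  exact this.eq _ _

theorem fderiv_eq_sum_pd (f : Eu n → ℝ) (u v : Eu n) :
    fderiv ℝ f u v = ∑ i, v i * pd i f u := by
  have hv : v = ∑ i, v i • EuclideanSpace.single i (1 : ℝ) := by
    ext j
    simp [Finset.sum_apply, Pi.single_apply]
  conv_lhs => rw [hv]
  simp [pd]

theorem contDiffAt_apply {E : Type*} [NormedAddCommGroup E] [NormedSpace ℝ E]
    {F : E → Eu n} {q : E} (hF : ContDiffAt ℝ ∞ F q) (k : Fin n) :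
    ContDiffAt ℝ ∞ (fun w ↦ F w k) q :=
  (EuclideanSpace.proj (𝕜 := ℝ) k).contDiff.contDiffAt.comp q hF

end PartialDerivatives

/-! ### Index calculus for a metric and its Levi-Civita connection on an open subset of `ℝⁿ` -/

section IndexCalculus

variable {n : ℕ}

/-- `g` is a smooth nondegenerate symmetric bilinear form on the open set `U`, with inverse `gi` and
with a torsion-free metric connection whose Christoffel symbols are `Γ`. -/
structure IsLeviCivita (g gi : Fin n → Fin n → Eu n → ℝ) (Γ : Fin n → Fin n → Fin n → Eu n → ℝ)
    (U : Set (Eu n)) : Prop where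
  isOpen : IsOpen U
  smooth : ∀ u ∈ U, ∀ i j, ContDiffAt ℝ ∞ (g i j) u
  smooth_inv : ∀ u ∈ U, ∀ i j, ContDiffAt ℝ ∞ (gi i j) u
  smooth_chr : ∀ u ∈ U, ∀ k i j, ContDiffAt ℝ ∞ (Γ k i j) u
  symm : ∀ u ∈ U, ∀ i j, g i j u = g j i u
  symm_inv : ∀ u ∈ U, ∀ i j, gi i j u = gi j i u
  symm_chr : ∀ u ∈ U, ∀ k i j, Γ k i j u = Γ k j i u
  mul_inv : ∀ u ∈ U, ∀ i j, ∑ k, g i k u * gi k j u = if i = j then 1 else 0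
  compat : ∀ u ∈ U, ∀ c i j, pd c (g i j) u = ∑ l, (Γ l c i u * g l j u + Γ l c j u * g i l u)

/-- The divergence `∂ᵢXⁱ + Γᵏₖᵢ Xⁱ` of a vector field. -/
def divergence (Γ : Fin n → Fin n → Fin n → Eu n → ℝ) (X : Fin n → Eu n → ℝ) (u : Eu n) : ℝ :=
  ∑ i, (pd i (X i) u + (∑ k, Γ k k i u) * X i u)

/-- The contraction `gⁱʲ ∇ᵢ S_{jc}` of the covariant derivative of a `(0,2)`-tensor. -/
def divTensor (gi : Fin n → Fin n → Eu n → ℝ) (Γ : Fin n → Fin n → Fin n → Eu n → ℝ)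
    (S : Fin n → Fin n → Eu n → ℝ) (c : Fin n) (u : Eu n) : ℝ :=
  ∑ i, ∑ j, gi i j u * (pd i (S j c) u - ∑ l, Γ l i j u * S l c u - ∑ k, Γ k i c u * S j k u)

/-- The covariant derivative `(∇ⱼη)_c` of a covector field. -/
def covDForm (Γ : Fin n → Fin n → Fin n → Eu n → ℝ) (η : Fin n → Eu n → ℝ) (j c : Fin n)
    (u : Eu n) : ℝ :=
  pd j (η c) u - ∑ k, Γ k j c u * η k u

/-- The covariant derivative `(∇ᵢX)ᵏ` of a vector field. -/
def covDVec (Γ : Fin n → Fin n → Fin n → Eu n → ℝ) (X : Fin n → Eu n → ℝ) (k i : Fin n)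
    (u : Eu n) : ℝ :=
  pd i (X k) u + ∑ l, Γ k i l u * X l u

/-- The second covariant derivative `(∇²ᵢⱼX)ᵏ` of a vector field. -/
def covDVec2 (Γ : Fin n → Fin n → Fin n → Eu n → ℝ) (X : Fin n → Eu n → ℝ) (k i j : Fin n)
    (u : Eu n) : ℝ :=
  pd i (covDVec Γ X k j) u + ∑ l, Γ k i l u * covDVec Γ X l j u
    - ∑ l, Γ l i j u * covDVec Γ X k l u

/-- The curvature components, `R(∂ᵢ, ∂ⱼ) ∂ₖ = ∑ₗ (curvature l i j k) ∂ₗ`. -/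
def curvature (Γ : Fin n → Fin n → Fin n → Eu n → ℝ) (l i j k : Fin n) (u : Eu n) : ℝ :=
  pd i (Γ l j k) u - pd j (Γ l i k) u + ∑ r, (Γ r j k u * Γ l i r u - Γ r i k u * Γ l j r u)

theorem divergence_congr {Γ : Fin n → Fin n → Fin n → Eu n → ℝ} {X Y : Fin n → Eu n → ℝ}
    {u : Eu n} (h : ∀ i, X i =ᶠ[𝓝 u] Y i) : divergence Γ X u = divergence Γ Y u := by
  simp only [divergence]
  exact Finset.sum_congr rfl fun i _ ↦ by rw [pd_congr (h i), (h i).eq_of_nhds]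

namespace IsLeviCivita

variable {g gi : Fin n → Fin n → Eu n → ℝ} {Γ : Fin n → Fin n → Fin n → Eu n → ℝ}
  {U : Set (Eu n)} {u : Eu n}

theorem eventually_mem (h : IsLeviCivita g gi Γ U) (hu : u ∈ U) : ∀ᶠ w in 𝓝 u, w ∈ U :=
  h.isOpen.mem_nhds hu

theorem inv_mul (h : IsLeviCivita g gi Γ U) (hu : u ∈ U) (i j : Fin n) :
    ∑ k, gi i k u * g k j u = if i = j then 1 else 0 := by
  have := h.mul_inv u hu j i
  simp only [eq_comm (a := j)] at this
  rw [← this]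
  exact Finset.sum_congr rfl fun k _ ↦ by rw [h.symm u hu k j, h.symm_inv u hu i k, mul_comm]

theorem raise_lower (h : IsLeviCivita g gi Γ U) (hu : u ∈ U) (X : Fin n → ℝ) (i : Fin n) :
    ∑ k, gi i k u * ∑ j, g k j u * X j = X i := by
  simp only [Finset.mul_sum, ← mul_assoc]
  rw [Finset.sum_comm]
  simp [← Finset.sum_mul, h.inv_mul hu]

theorem lower_raise (h : IsLeviCivita g gi Γ U) (hu : u ∈ U) (X : Fin n → ℝ) (i : Fin n) :
    ∑ k, g i k u * ∑ j, gi k j u * X j = X i := by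
  simp only [Finset.mul_sum, ← mul_assoc]
  rw [Finset.sum_comm]
  simp [← Finset.sum_mul, h.mul_inv u hu]

theorem contract_swap (h : IsLeviCivita g gi Γ U) (hu : u ∈ U) (F : Fin n → Fin n → ℝ) :
    ∑ i, ∑ j, gi i j u * F i j = ∑ i, ∑ j, gi i j u * F j i := by
  rw [Finset.sum_comm]
  exact Finset.sum_congr rfl fun i _ ↦ Finset.sum_congr rfl fun j _ ↦ by
    rw [h.symm_inv u hu]

/-- Differentiating `g g⁻¹ = 1` gives `∂(g⁻¹) = -g⁻¹ (∂g) g⁻¹`. Compatibility reads `∂g = Cᵀg + gC`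
with `C` the matrix of Christoffel symbols, and the outer inverses cancel. -/
theorem pd_inv (h : IsLeviCivita g gi Γ U) (hu : u ∈ U) (c i j : Fin n) :
    pd c (gi i j) u = -∑ l, (Γ i c l u * gi l j u + Γ j c l u * gi i l u) := by
  have hg := h.smooth u hu
  have hgi := h.smooth_inv u hu
  have h0 (a b : Fin n) : ∑ k, (pd c (g a k) u * gi k b u + g a k u * pd c (gi k b) u) = 0 := by
    have : (fun w ↦ ∑ k, g a k w * gi k b w) =ᶠ[𝓝 u] fun _ ↦ if a = b then (1 : ℝ) else 0 :=
      (h.eventually_mem hu).mono fun w hw ↦ h.mul_inv w hw a b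
    have h1 := pd_congr this c
    rw [pd_const, pd_sum (fun k _ ↦ by fun_prop)] at h1
    rw [← h1]
    exact Finset.sum_congr rfl fun k _ ↦ by rw [pd_mul (hg _ _) (hgi _ _)]
  let A : Matrix (Fin n) (Fin n) ℝ := Matrix.of fun i j ↦ g i j u
  let B : Matrix (Fin n) (Fin n) ℝ := Matrix.of fun i j ↦ gi i j u
  let dA : Matrix (Fin n) (Fin n) ℝ := Matrix.of fun i j ↦ pd c (g i j) u
  let dB : Matrix (Fin n) (Fin n) ℝ := Matrix.of fun i j ↦ pd c (gi i j) u
  let C : Matrix (Fin n) (Fin n) ℝ := Matrix.of fun l i ↦ Γ l c i u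
  have hBA : B * A = 1 := by
    ext a b; simp [Matrix.mul_apply, A, B, h.inv_mul hu, Matrix.one_apply]
  have hAB : A * B = 1 := by
    ext a b; simp [Matrix.mul_apply, A, B, h.mul_inv u hu, Matrix.one_apply]
  have hdA : dA = C.transpose * A + A * C := by
    ext a b
    simp only [Matrix.add_apply, Matrix.mul_apply, Matrix.transpose_apply, A, C, dA, Matrix.of_apply,
      h.compat u hu, Finset.sum_add_distrib]
    congr 1
    exact Finset.sum_congr rfl fun l _ ↦ mul_comm _ _
  have hd : dA * B + A * dB = 0 := by
    ext a b
    simpa [Matrix.mul_apply, A, B, dA, dB, Finset.sum_add_distrib] using h0 a b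
  have hdB : dB = -(B * C.transpose) - C * B := by
    have : dB = B * (A * dB) := by rw [← Matrix.mul_assoc, hBA, Matrix.one_mul]
    rw [this, show A * dB = -(dA * B) from eq_neg_of_add_eq_zero_right hd, hdA, Matrix.add_mul,
      Matrix.mul_neg, Matrix.mul_add, Matrix.mul_assoc C.transpose, hAB, Matrix.mul_one,
      Matrix.mul_assoc A, ← Matrix.mul_assoc B, hBA, Matrix.one_mul]
    abel
  have := congrFun (congrFun hdB i) j
  simp only [Matrix.sub_apply, Matrix.neg_apply, Matrix.mul_apply, Matrix.transpose_apply, B, C, dB,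
    Matrix.of_apply] at this
  rw [this, Finset.sum_add_distrib]
  simp only [mul_comm (gi i _ u)]
  ring

/-- The first sum in `pd_inv`, with `i` contracted, is exactly the trace term with the opposite
sign. -/
theorem divergence_inv (h : IsLeviCivita g gi Γ U) (hu : u ∈ U) (j : Fin n) :
    ∑ i, (pd i (gi i j) u + (∑ k, Γ k k i u) * gi i j u) = -∑ k, ∑ l, gi k l u * Γ j k l u := by
  simp only [h.pd_inv hu, Finset.sum_add_distrib, neg_add, Finset.sum_neg_distrib]
  have h1 : ∑ i, ∑ l, Γ i i l u * gi l j u = ∑ i, (∑ k, Γ k k i u) * gi i j u := by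
    rw [Finset.sum_comm]
    simp only [Finset.sum_mul]
  have h2 : ∑ i, ∑ l, Γ j i l u * gi i l u = ∑ k, ∑ l, gi k l u * Γ j k l u := by
    simp only [mul_comm]
  rw [h1, h2]
  ring

/-- Derivatives falling on the inverse metric contribute only the Christoffel term, by
`divergence_inv`. Every divergence thereby becomes a contraction with `gⁱʲ`, and later identities
can be checked for each pair `i`, `j` under the sum. -/
theorem divergence_raise (h : IsLeviCivita g gi Γ U) (hu : u ∈ U) {S : Fin n → Eu n → ℝ}
    (hS : ∀ j, ContDiffAt ℝ ∞ (S j) u) :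
    divergence Γ (fun i w ↦ ∑ j, gi i j w * S j w) u =
      ∑ i, ∑ j, gi i j u * (pd i (S j) u - ∑ l, Γ l i j u * S l u) := by
  have hgi := h.smooth_inv u hu
  have h1 (i : Fin n) : pd i (fun w ↦ ∑ j, gi i j w * S j w) u =
      ∑ j, (pd i (gi i j) u * S j u + gi i j u * pd i (S j) u) := by
    rw [pd_sum (fun k _ ↦ by fun_prop)]
    exact Finset.sum_congr rfl fun k _ ↦ by rw [pd_mul (hgi _ _) (hS _)]
  have h2 : ∑ i, ∑ j, gi i j u * ∑ l, Γ l i j u * S l u =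
      ∑ l, (∑ i, ∑ j, gi i j u * Γ l i j u) * S l u := by
    simp only [Finset.sum_mul, Finset.mul_sum, mul_assoc]
    conv_rhs => rw [Finset.sum_comm]
    exact Finset.sum_congr rfl fun i _ ↦ Finset.sum_comm
  have h3 (j : Fin n) := h.divergence_inv hu j
  simp only [mul_sub, Finset.sum_sub_distrib, h2]
  simp only [divergence, h1, Finset.sum_add_distrib]
  have h4 : ∑ i, (∑ k, Γ k k i u) * ∑ j, gi i j u * S j u =
      ∑ j, (∑ i, (∑ k, Γ k k i u) * gi i j u) * S j u := by
    simp only [Finset.mul_sum, Finset.sum_mul (Finset.univ) (fun i ↦ _ * gi i _ u)]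
    rw [Finset.sum_comm]
    simp only [mul_assoc]
  have h5 : ∑ i, ∑ j, pd i (gi i j) u * S j u = ∑ j, (∑ i, pd i (gi i j) u) * S j u := by
    rw [Finset.sum_comm]
    simp only [Finset.sum_mul]
  have h6 : ∑ j, (∑ i, pd i (gi i j) u) * S j u + ∑ j, (∑ i, (∑ k, Γ k k i u) * gi i j u) * S j u
      = -∑ l, (∑ i, ∑ j, gi i j u * Γ l i j u) * S l u := by
    rw [← Finset.sum_add_distrib, ← Finset.sum_neg_distrib]
    refine Finset.sum_congr rfl fun j _ ↦ ?_
    rw [← add_mul, ← Finset.sum_add_distrib, h3, neg_mul]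
  rw [h4, h5]
  linarith

/-- Metric compatibility: lowering an index commutes with covariant differentiation. -/
theorem lower_covDVec (h : IsLeviCivita g gi Γ U) (hu : u ∈ U) {X : Fin n → Eu n → ℝ}
    (hX : ∀ j, ContDiffAt ℝ ∞ (X j) u) (j c : Fin n) :
    pd j (fun w ↦ ∑ k, g c k w * X k w) u - ∑ k, Γ k j c u * ∑ m, g k m u * X m u =
      ∑ k, g c k u * (pd j (X k) u + ∑ l, Γ k j l u * X l u) := by
  have hg := h.smooth u hu
  rw [pd_sum (fun k _ ↦ by fun_prop)]
  have h1 (k : Fin n) : pd j (fun w ↦ g c k w * X k w) u =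
      (∑ l, Γ l j c u * g l k u) * X k u + (∑ l, Γ l j k u * g c l u) * X k u
        + g c k u * pd j (X k) u := by
    rw [pd_mul (hg _ _) (hX _), h.compat u hu, Finset.sum_add_distrib]
    ring
  simp only [h1, Finset.sum_add_distrib, mul_add]
  have h2 : ∑ k, (∑ l, Γ l j c u * g l k u) * X k u = ∑ k, Γ k j c u * ∑ m, g k m u * X m u := by
    simp only [Finset.sum_mul, Finset.mul_sum, mul_assoc]
    rw [Finset.sum_comm]
  have h3 : ∑ k, (∑ l, Γ l j k u * g c l u) * X k u = ∑ k, g c k u * ∑ l, Γ k j l u * X l u := by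
    simp only [Finset.sum_mul, Finset.mul_sum]
    rw [Finset.sum_comm]
    exact Finset.sum_congr rfl fun i _ ↦ Finset.sum_congr rfl fun k _ ↦ by ring
  rw [h2, h3]
  ring

end IsLeviCivita

end IndexCalculus

/-! ### Curvature, its symmetries and the Ricci contraction. -/

section Curvature

variable {n : ℕ} {g gi : Fin n → Fin n → Eu n → ℝ} {Γ : Fin n → Fin n → Fin n → Eu n → ℝ}
  {U : Set (Eu n)} {u : Eu n}

theorem smooth_covDVec (hΓ : ∀ k i j, ContDiffAt ℝ ∞ (Γ k i j) u) {X : Fin n → Eu n → ℝ}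
    (hX : ∀ k, ContDiffAt ℝ ∞ (X k) u) (k i : Fin n) : ContDiffAt ℝ ∞ (covDVec Γ X k i) u := by
  unfold covDVec
  fun_prop

theorem smooth_covDForm (hΓ : ∀ k i j, ContDiffAt ℝ ∞ (Γ k i j) u) {X : Fin n → Eu n → ℝ}
    (hX : ∀ k, ContDiffAt ℝ ∞ (X k) u) (k i : Fin n) : ContDiffAt ℝ ∞ (covDForm Γ X k i) u := by
  unfold covDForm
  fun_prop

namespace IsLeviCivita

/-- The principal part of the Euler–Lagrange operator, in terms of covariant derivatives and
curvature. -/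
theorem divergence_sub_eq_divTensor_add_curvature (h : IsLeviCivita g gi Γ U) (hu : u ∈ U)
    {η : Fin n → Eu n → ℝ} (hη : ∀ j, ContDiffAt ℝ ∞ (η j) u) (c : Fin n) :
    divergence Γ (fun i w ↦ ∑ j, gi i j w * pd j (η c) w) u
      + ∑ i, ∑ j, gi i j u * ∑ k, pd c (Γ k i j) u * η k u
      - 2 * divergence Γ (fun i w ↦ ∑ j, gi i j w * ∑ k, Γ k c j w * η k w) u =
    divTensor gi Γ (covDForm Γ η) c u
      + ∑ i, ∑ j, gi i j u * ∑ k, curvature Γ k c i j u * η k u := by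
  have hΓ := h.smooth_chr u hu
  have hs := h.symm_chr u hu
  rw [h.divergence_raise hu (fun j ↦ by fun_prop), h.divergence_raise hu (fun j ↦ by fun_prop)]
  -- The two sides agree summand by summand only after `i` and `j` are exchanged in the last
  -- Christoffel term, which the symmetry of `gⁱʲ` permits.
  have hswap : divTensor gi Γ (covDForm Γ η) c u = ∑ i, ∑ j, gi i j u *
      (pd i (covDForm Γ η j c) u - ∑ l, Γ l i j u * covDForm Γ η l c u
        - ∑ k, Γ k j c u * covDForm Γ η i k u) := by
    simp only [divTensor, mul_sub, Finset.sum_sub_distrib]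
    congr 1
    exact h.contract_swap hu fun i j ↦ ∑ k, Γ k i c u * covDForm Γ η j k u
  rw [hswap, Finset.mul_sum, ← Finset.sum_add_distrib, ← Finset.sum_sub_distrib,
    ← Finset.sum_add_distrib]
  refine Finset.sum_congr rfl fun i _ ↦ ?_
  rw [Finset.mul_sum, ← Finset.sum_add_distrib, ← Finset.sum_sub_distrib,
    ← Finset.sum_add_distrib]
  refine Finset.sum_congr rfl fun j _ ↦ ?_
  have e1 : pd i (fun w ↦ ∑ k, Γ k c j w * η k w) u =
      ∑ k, pd i (Γ k c j) u * η k u + ∑ k, Γ k c j u * pd i (η k) u := by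
    rw [pd_sum (fun k _ ↦ by fun_prop), ← Finset.sum_add_distrib]
    exact Finset.sum_congr rfl fun k _ ↦ by rw [pd_mul (hΓ _ _ _) (hη _)]
  have e2 : pd i (covDForm Γ η j c) u = pd i (pd j (η c)) u -
      (∑ k, pd i (Γ k c j) u * η k u + ∑ k, Γ k c j u * pd i (η k) u) := by
    rw [← e1]
    have : covDForm Γ η j c =ᶠ[𝓝 u] fun w ↦ pd j (η c) w - ∑ k, Γ k c j w * η k w :=
      (h.eventually_mem hu).mono fun w hw ↦ by
        simp only [covDForm, h.symm_chr w hw _ j c]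
    rw [pd_congr this, pd_sub (by fun_prop) (by fun_prop)]
  have e3 : ∑ k, curvature Γ k c i j u * η k u = ∑ k, pd c (Γ k i j) u * η k u
      - ∑ k, pd i (Γ k c j) u * η k u + ∑ r, Γ r i j u * ∑ k, Γ k c r u * η k u
      - ∑ r, Γ r c j u * ∑ k, Γ k i r u * η k u := by
    simp only [curvature, add_mul, sub_mul, Finset.sum_add_distrib, Finset.sum_sub_distrib,
      Finset.sum_mul, Finset.mul_sum, mul_assoc]
    rw [Finset.sum_comm (f := fun r k ↦ Γ r i j u * (Γ k c r u * η k u)),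
      Finset.sum_comm (f := fun r k ↦ Γ r c j u * (Γ k i r u * η k u))]
    ring
  have e4 : ∑ l, Γ l i j u * covDForm Γ η l c u =
      ∑ l, Γ l i j u * pd l (η c) u - ∑ r, Γ r i j u * ∑ k, Γ k c r u * η k u := by
    simp only [covDForm, mul_sub, Finset.sum_sub_distrib, hs _ _ c]
  have e5 : ∑ k, Γ k j c u * covDForm Γ η i k u =
      ∑ k, Γ k c j u * pd i (η k) u - ∑ r, Γ r c j u * ∑ k, Γ k i r u * η k u := by
    simp only [covDForm, mul_sub, Finset.sum_sub_distrib, hs _ j c]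
  rw [e1, e2, e3, e4, e5]
  ring

/-- `lower_covDVec` is used twice: for `X`, and for `k ↦ (∇ⱼX)ᵏ` with `j` frozen. The remaining term
`Γˡᵢⱼ ∇ₗX` is common to both sides. -/
theorem divTensor_lower (h : IsLeviCivita g gi Γ U) (hu : u ∈ U) {X : Fin n → Eu n → ℝ}
    (hX : ∀ w ∈ U, ∀ j, ContDiffAt ℝ ∞ (X j) w) (c : Fin n) :
    divTensor gi Γ (covDForm Γ fun c w ↦ ∑ k, g c k w * X k w) c u =
      ∑ k, g c k u * ∑ i, ∑ j, gi i j u * covDVec2 Γ X k i j u := by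
  have hΓ := h.smooth_chr u hu
  have h1 (w : Eu n) (hw : w ∈ U) (j c : Fin n) :
      covDForm Γ (fun c w ↦ ∑ k, g c k w * X k w) j c w = ∑ k, g c k w * covDVec Γ X k j w :=
    h.lower_covDVec hw (hX w hw) j c
  have h2 (i j : Fin n) : pd i (covDForm Γ (fun c w ↦ ∑ k, g c k w * X k w) j c) u
      - ∑ l, Γ l i j u * covDForm Γ (fun c w ↦ ∑ k, g c k w * X k w) l c u
      - ∑ k, Γ k i c u * covDForm Γ (fun c w ↦ ∑ k, g c k w * X k w) j k u =
      ∑ k, g c k u * covDVec2 Γ X k i j u := by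
    have e := pd_congr ((h.eventually_mem hu).mono fun w hw ↦ h1 w hw j c) i
    have e2 := h.lower_covDVec hu (X := fun k ↦ covDVec Γ X k j)
      (fun k ↦ smooth_covDVec hΓ (hX u hu) k j) i c
    simp only [h1 u hu]
    rw [show covDForm Γ (fun c w ↦ ∑ k, g c k w * X k w) j c =
      fun w ↦ covDForm Γ (fun c w ↦ ∑ k, g c k w * X k w) j c w from rfl, e, sub_right_comm, e2]
    simp only [covDVec2, mul_sub, Finset.sum_sub_distrib]
    congr 1
    simp only [Finset.mul_sum]
    rw [Finset.sum_comm]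
    exact Finset.sum_congr rfl fun i _ ↦ Finset.sum_congr rfl fun k _ ↦ by ring
  simp only [divTensor, h2, Finset.mul_sum]
  conv_rhs => rw [Finset.sum_comm]
  refine Finset.sum_congr rfl fun i _ ↦ ?_
  conv_rhs => rw [Finset.sum_comm]
  exact Finset.sum_congr rfl fun j _ ↦ Finset.sum_congr rfl fun k _ ↦ by ring

/-- `lower_covDVec` is an identity between components, so it applies to `k ↦ Γᵏᵢⱼ` with `i` and `j`
frozen, although this is not a vector field in the invariant sense. -/
theorem pd_lower_chr (h : IsLeviCivita g gi Γ U) (hu : u ∈ U) (c i j m : Fin n) :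
    ∑ k, g m k u * (pd c (Γ k i j) u + ∑ l, Γ k c l u * Γ l i j u) =
      pd c (fun w ↦ ∑ k, g m k w * Γ k i j w) u
        - ∑ k, Γ k c m u * ∑ l, g k l u * Γ l i j u :=
  (h.lower_covDVec hu (fun k ↦ h.smooth_chr u hu k i j) c m).symm

/-- The curvature is the difference of two expressions `∂Γ + ΓΓ` with `c` and `i` exchanged, and
`pd_lower_chr` lowers each of them. -/
theorem lower_curvature (h : IsLeviCivita g gi Γ U) (hu : u ∈ U) (c i j m : Fin n) :
    ∑ k, g m k u * curvature Γ k c i j u =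
      pd c (fun w ↦ ∑ k, g m k w * Γ k i j w) u - pd i (fun w ↦ ∑ k, g m k w * Γ k c j w) u
        - ∑ k, Γ k c m u * ∑ l, g k l u * Γ l i j u + ∑ k, Γ k i m u * ∑ l, g k l u * Γ l c j u := by
  have h1 := h.pd_lower_chr hu c i j m
  have h2 := h.pd_lower_chr hu i c j m
  have h3 : ∑ k, g m k u * curvature Γ k c i j u =
      ∑ k, g m k u * (pd c (Γ k i j) u + ∑ l, Γ k c l u * Γ l i j u)
        - ∑ k, g m k u * (pd i (Γ k c j) u + ∑ l, Γ k i l u * Γ l c j u) := by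
    rw [← Finset.sum_sub_distrib]
    refine Finset.sum_congr rfl fun k _ ↦ ?_
    simp only [curvature, Finset.sum_sub_distrib]
    simp only [mul_comm (Γ k _ _ u)]
    ring
  rw [h3, h1, h2]
  ring

/-- By compatibility `g_{mk} Γᵏᵢⱼ + g_{jk} Γᵏᵢₘ = ∂ᵢ g_{jm}`, so in the part symmetric in `j` and
`m` the derivative terms form a commutator of second partials of `g_{jm}` and vanish. The quadratic
terms cancel by the symmetry `hq`. -/
theorem lower_curvature_antisymm (h : IsLeviCivita g gi Γ U) (hu : u ∈ U) (c i j m : Fin n) :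
    ∑ k, g m k u * curvature Γ k c i j u = -∑ k, g j k u * curvature Γ k c i m u := by
  have hg := h.smooth u hu
  have hΓ := h.smooth_chr u hu
  have hq (a b c d : Fin n) : ∑ k, Γ k a b u * ∑ l, g k l u * Γ l c d u =
      ∑ k, Γ k c d u * ∑ l, g k l u * Γ l a b u := by
    simp only [Finset.mul_sum]
    rw [Finset.sum_comm]
    exact Finset.sum_congr rfl fun k _ ↦ Finset.sum_congr rfl fun l _ ↦ by
      rw [h.symm u hu l k]; ring
  have hc (a i : Fin n) : pd a (fun w ↦ ∑ k, g m k w * Γ k i j w) u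
      + pd a (fun w ↦ ∑ k, g j k w * Γ k i m w) u = pd a (pd i (g j m)) u := by
    rw [← pd_add (by fun_prop) (by fun_prop)]
    refine pd_congr ((h.eventually_mem hu).mono fun w hw ↦ ?_) a
    simp only [h.compat w hw, Finset.sum_add_distrib]
    congr 1
    · exact Finset.sum_congr rfl fun k _ ↦ by rw [h.symm w hw m k, mul_comm]
    · exact Finset.sum_congr rfl fun k _ ↦ by rw [mul_comm]
  have h1 := hc c i
  have h2 := hc i c
  have h3 := pd_comm (hg j m) c i
  rw [h.lower_curvature hu, h.lower_curvature hu, hq c m i j, hq i m c j]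
  linarith

/-- The curvature contraction produced by the first variation is not literally the Ricci trace.
Antisymmetry in the last pair of lowered indices and in the two differentiation directions brings it
to the form `Rⁱᵢ꜀ₘ Xᵐ`. -/
theorem contract_curvature (h : IsLeviCivita g gi Γ U) (hu : u ∈ U) (X : Fin n → ℝ) (c : Fin n) :
    ∑ i, ∑ j, gi i j u * ∑ k, curvature Γ k c i j u * ∑ m, g k m u * X m =
      ∑ m, (∑ i, curvature Γ i i c m u) * X m := by
  have h1 (i j : Fin n) : ∑ k, curvature Γ k c i j u * ∑ m, g k m u * X m =
      ∑ m, X m * ∑ k, g j k u * curvature Γ k i c m u := by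
    have (m : Fin n) : ∑ k, g j k u * curvature Γ k i c m u =
        ∑ k, g m k u * curvature Γ k c i j u := by
      rw [h.lower_curvature_antisymm hu, ← Finset.sum_neg_distrib]
      refine Finset.sum_congr rfl fun k _ ↦ ?_
      simp only [curvature, Finset.sum_sub_distrib]
      ring
    simp only [this, Finset.mul_sum]
    rw [Finset.sum_comm]
    exact Finset.sum_congr rfl fun k _ ↦ Finset.sum_congr rfl fun l _ ↦ by
      rw [h.symm u hu l k]; ring
  simp only [h1]
  have h2 (i : Fin n) : ∑ j, gi i j u * ∑ m, X m * ∑ k, g j k u * curvature Γ k i c m u =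
      ∑ m, X m * curvature Γ i i c m u := by
    have (m : Fin n) := h.raise_lower hu (fun k ↦ curvature Γ k i c m u) i
    simp only [← this, Finset.mul_sum]
    rw [Finset.sum_comm]
    exact Finset.sum_congr rfl fun k _ ↦ Finset.sum_congr rfl fun l _ ↦
      Finset.sum_congr rfl fun l _ ↦ by ring
  simp only [h2, Finset.sum_mul]
  rw [Finset.sum_comm]
  simp only [mul_comm]

end IsLeviCivita

end Curvature

/-! ### The first variation of the bienergy density and its formal adjoint -/

section Variation

variable {n : ℕ}

/-- The first variation, in the direction `V`, of the bienergy density `½ g'ₖₗ τᵏ τˡ` of the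
identity map, where `τ` is the tension field of the identity and `η = g'(τ, ·)`. -/
def firstVariation (gi : Fin n → Fin n → Eu n → ℝ) (Γ : Fin n → Fin n → Fin n → Eu n → ℝ)
    (g' : Fin n → Fin n → Eu n → ℝ) (Γ' : Fin n → Fin n → Fin n → Eu n → ℝ)
    (τ η V : Fin n → Eu n → ℝ) (u : Eu n) : ℝ :=
  ∑ c, V c u * (1 / 2 * ∑ k, ∑ l, pd c (g' k l) u * (τ k u * τ l u))
    + ∑ k, η k u * ∑ i, ∑ j, gi i j u * (pd i (pd j (V k)) u - ∑ l, Γ l i j u * pd l (V k) u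
        + ∑ c, pd c (Γ' k i j) u * V c u + 2 * ∑ a, Γ' k a j u * pd i (V a) u)

/-- The Euler–Lagrange expression of the bienergy at the identity map. -/
def eulerLagrange (gi : Fin n → Fin n → Eu n → ℝ) (Γ : Fin n → Fin n → Fin n → Eu n → ℝ)
    (g' : Fin n → Fin n → Eu n → ℝ) (Γ' : Fin n → Fin n → Fin n → Eu n → ℝ)
    (τ η : Fin n → Eu n → ℝ) (c : Fin n) (u : Eu n) : ℝ :=
  1 / 2 * ∑ k, ∑ l, pd c (g' k l) u * (τ k u * τ l u)
    + divergence Γ (fun i w ↦ ∑ j, gi i j w * pd j (η c) w) u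
    + ∑ i, ∑ j, gi i j u * ∑ k, pd c (Γ' k i j) u * η k u
    - 2 * divergence Γ (fun i w ↦ ∑ j, gi i j w * ∑ k, Γ' k c j w * η k w) u

/-- The covector field whose metric dual has the difference between the first variation and its
adjoint form as divergence. -/
def boundaryForm (Γ' : Fin n → Fin n → Fin n → Eu n → ℝ) (η V : Fin n → Eu n → ℝ) (j : Fin n)
    (u : Eu n) : ℝ :=
  ∑ c, (pd j (V c) u * η c u - V c u * pd j (η c) u + 2 * (V c u * ∑ k, Γ' k c j u * η k u))

/-- Integration by parts done pointwise: two derivatives move from `V` to `η` in the second-order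
term and one in the term with `Γ'`. What is left over is the divergence of the raised
`boundaryForm`. -/
theorem IsLeviCivita.firstVariation_eq {g gi g' : Fin n → Fin n → Eu n → ℝ}
    {Γ Γ' : Fin n → Fin n → Fin n → Eu n → ℝ} {U : Set (Eu n)} {u : Eu n}
    (h : IsLeviCivita g gi Γ U) (hu : u ∈ U) {τ η V : Fin n → Eu n → ℝ}
    (hΓ' : ∀ k i j, ContDiffAt ℝ ∞ (Γ' k i j) u)
    (hη : ∀ k, ContDiffAt ℝ ∞ (η k) u) (hV : ∀ k, ContDiffAt ℝ ∞ (V k) u) :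
    firstVariation gi Γ g' Γ' τ η V u = ∑ c, eulerLagrange gi Γ g' Γ' τ η c u * V c u
      + divergence Γ (fun i w ↦ ∑ j, gi i j w * boundaryForm Γ' η V j w) u := by
  have hB (j : Fin n) : ContDiffAt ℝ ∞ (boundaryForm Γ' η V j) u := by
    unfold boundaryForm; fun_prop
  -- The products of first derivatives of `V` and `η` cancel only after contraction with the
  -- symmetric `gⁱʲ`.
  have hanti : ∑ i, ∑ j, gi i j u * ∑ c, (pd j (V c) u * pd i (η c) u) =
      ∑ i, ∑ j, gi i j u * ∑ c, (pd i (V c) u * pd j (η c) u) :=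
    h.contract_swap hu fun i j ↦ ∑ c, (pd j (V c) u * pd i (η c) u)
  let Q : Fin n → Fin n → Eu n → ℝ := fun c j w ↦ ∑ k, Γ' k c j w * η k w
  have hQ (c j : Fin n) : ContDiffAt ℝ ∞ (Q c j) u := by simp only [Q]; fun_prop
  have hpB (i j : Fin n) : pd i (boundaryForm Γ' η V j) u =
      ∑ c, η c u * pd i (pd j (V c)) u + ∑ c, pd j (V c) u * pd i (η c) u
      - ∑ c, pd i (V c) u * pd j (η c) u - ∑ c, V c u * pd i (pd j (η c)) u
      + 2 * ∑ c, pd i (V c) u * Q c j u + 2 * ∑ c, V c u * pd i (Q c j) u := by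
    have : boundaryForm Γ' η V j = fun w ↦ ∑ c, (pd j (V c) w * η c w - V c w * pd j (η c) w
      + 2 * (V c w * Q c j w)) := rfl
    rw [this, pd_sum (fun c _ ↦ by fun_prop)]
    simp only [Finset.mul_sum]
    simp only [← Finset.sum_add_distrib, ← Finset.sum_sub_distrib]
    refine Finset.sum_congr rfl fun c _ ↦ ?_
    rw [pd_add (by fun_prop) (by fun_prop), pd_sub (by fun_prop) (by fun_prop),
      pd_const_mul (by fun_prop), pd_mul (by fun_prop) (by fun_prop),
      pd_mul (by fun_prop) (by fun_prop), pd_mul (by fun_prop) (by fun_prop)]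
    ring
  have hl (i j : Fin n) : ∑ l, Γ l i j u * boundaryForm Γ' η V l u =
      ∑ c, η c u * ∑ l, Γ l i j u * pd l (V c) u - ∑ c, V c u * ∑ l, Γ l i j u * pd l (η c) u
        + 2 * ∑ c, V c u * ∑ l, Γ l i j u * Q c l u := by
    simp only [boundaryForm, Finset.mul_sum (Finset.univ) (fun c ↦ (_ : ℝ) + _)]
    rw [Finset.sum_comm]
    simp only [Finset.mul_sum]
    simp only [← Finset.sum_add_distrib, ← Finset.sum_sub_distrib]
    refine Finset.sum_congr rfl fun c _ ↦ Finset.sum_congr rfl fun l _ ↦ ?_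
    simp only [Q, Finset.mul_sum, mul_add, mul_sub]
    congr 1
    · ring
    · exact Finset.sum_congr rfl fun _ _ ↦ by ring
  have hQ' (i j : Fin n) : ∑ k, η k u * ∑ a, Γ' k a j u * pd i (V a) u =
      ∑ c, pd i (V c) u * Q c j u := by
    simp only [Q, Finset.mul_sum]
    rw [Finset.sum_comm]
    exact Finset.sum_congr rfl fun c _ ↦ Finset.sum_congr rfl fun l _ ↦ by ring
  have hG (i j : Fin n) : ∑ k, η k u * ∑ c, pd c (Γ' k i j) u * V c u =
      ∑ c, V c u * ∑ k, pd c (Γ' k i j) u * η k u := by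
    simp only [Finset.mul_sum]
    rw [Finset.sum_comm]
    exact Finset.sum_congr rfl fun c _ ↦ Finset.sum_congr rfl fun l _ ↦ by ring
  have pull (F : Fin n → Fin n → Fin n → ℝ) (a : Fin n → ℝ) :
      ∑ k, a k * ∑ i, ∑ j, gi i j u * F k i j = ∑ i, ∑ j, gi i j u * ∑ k, a k * F k i j := by
    simp only [Finset.mul_sum]
    rw [Finset.sum_comm]
    refine Finset.sum_congr rfl fun i _ ↦ ?_
    rw [Finset.sum_comm]
    exact Finset.sum_congr rfl fun c _ ↦ Finset.sum_congr rfl fun l _ ↦ by ring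
  have hE : ∑ c, eulerLagrange gi Γ g' Γ' τ η c u * V c u =
      ∑ c, V c u * (1 / 2 * ∑ k, ∑ l, pd c (g' k l) u * (τ k u * τ l u))
      + ∑ i, ∑ j, gi i j u * ∑ c, V c u * (pd i (pd j (η c)) u - ∑ l, Γ l i j u * pd l (η c) u)
      + ∑ i, ∑ j, gi i j u * ∑ c, V c u * ∑ k, pd c (Γ' k i j) u * η k u
      - 2 * ∑ i, ∑ j, gi i j u * ∑ c, V c u * (pd i (Q c j) u - ∑ l, Γ l i j u * Q c l u) := by
    rw [← pull, ← pull, ← pull, Finset.mul_sum, ← Finset.sum_add_distrib, ← Finset.sum_add_distrib,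
      ← Finset.sum_sub_distrib]
    refine Finset.sum_congr rfl fun c _ ↦ ?_
    rw [eulerLagrange, h.divergence_raise hu (fun j ↦ by fun_prop)]
    rw [h.divergence_raise (S := Q c) hu (hQ c)]
    ring
  rw [hE, firstVariation, pull, h.divergence_raise hu hB, add_assoc, add_sub_assoc, add_assoc]
  congr 1
  -- The difference of the two sides is, up to sign, the quantity shown to vanish in `hanti`; once
  -- this is subtracted, the claim holds for each pair `i`, `j` separately.
  rw [← sub_eq_zero] at hanti
  rw [← sub_eq_zero, ← neg_eq_zero, ← hanti]
  simp only [Finset.mul_sum (Finset.univ) (fun i ↦ ∑ j, gi i j u * _)]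
  simp only [← Finset.sum_add_distrib, ← Finset.sum_sub_distrib, ← Finset.sum_neg_distrib]
  refine Finset.sum_congr rfl fun i _ ↦ ?_
  simp only [Finset.mul_sum (Finset.univ) (fun j ↦ gi i j u * _)]
  simp only [← Finset.sum_add_distrib, ← Finset.sum_sub_distrib, ← Finset.sum_neg_distrib]
  refine Finset.sum_congr rfl fun j _ ↦ ?_
  rw [hpB, hl]
  have hF : ∑ k, η k u * (pd i (pd j (V k)) u - ∑ l, Γ l i j u * pd l (V k) u
        + ∑ c, pd c (Γ' k i j) u * V c u + 2 * ∑ a, Γ' k a j u * pd i (V a) u) =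
      ∑ k, η k u * pd i (pd j (V k)) u - ∑ k, η k u * ∑ l, Γ l i j u * pd l (V k) u
      + ∑ c, V c u * ∑ k, pd c (Γ' k i j) u * η k u + 2 * ∑ c, pd i (V c) u * Q c j u := by
    rw [← hQ', ← hG, Finset.mul_sum]
    simp only [← Finset.sum_add_distrib, ← Finset.sum_sub_distrib]
    exact Finset.sum_congr rfl fun k _ ↦ by ring
  rw [hF]
  simp only [mul_sub, Finset.sum_sub_distrib]
  ring

end Variation

/-! ### The Euler–Lagrange expression for a conformal change of metric -/

section Conformal

variable {n : ℕ}

/-- The components `gᵏˡ ∂ₗρ` of the gradient of `ρ`. -/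
def gradVec (gi : Fin n → Fin n → Eu n → ℝ) (ρ : Eu n → ℝ) (k : Fin n) (u : Eu n) : ℝ :=
  ∑ l, gi k l u * pd l ρ u

/-- The squared length `|grad ρ|²`. -/
def gradSq (gi : Fin n → Fin n → Eu n → ℝ) (ρ : Eu n → ℝ) (u : Eu n) : ℝ :=
  ∑ k, pd k ρ u * gradVec gi ρ k u

/-- The Christoffel symbols of the conformal metric `e^{2ρ} g`. -/
def conformalChr (g gi : Fin n → Fin n → Eu n → ℝ) (Γ : Fin n → Fin n → Fin n → Eu n → ℝ)
    (ρ : Eu n → ℝ) (k i j : Fin n) (u : Eu n) : ℝ :=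
  Γ k i j u + ((if k = i then pd j ρ u else 0) + (if k = j then pd i ρ u else 0)
    - g i j u * gradVec gi ρ k u)

/-- The tension field `(2 - n) grad ρ` of the identity map between conformal metrics. -/
def conformalTension (gi : Fin n → Fin n → Eu n → ℝ) (ρ : Eu n → ℝ) (k : Fin n) (u : Eu n) : ℝ :=
  (2 - (n : ℝ)) * gradVec gi ρ k u

/-- The covector field dual to `conformalTension` with respect to `e^{2ρ} g`. -/
def conformalTensionForm (ρ : Eu n → ℝ) (k : Fin n) (u : Eu n) : ℝ :=
  (2 - (n : ℝ)) * (Real.exp (2 * ρ u) * pd k ρ u)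

variable {g gi : Fin n → Fin n → Eu n → ℝ} {Γ : Fin n → Fin n → Fin n → Eu n → ℝ}
  {U : Set (Eu n)} {u : Eu n} {ρ : Eu n → ℝ}

theorem smooth_gradVec (hgi : ∀ i j, ContDiffAt ℝ ∞ (gi i j) u) (hρ : ContDiffAt ℝ ∞ ρ u)
    (k : Fin n) : ContDiffAt ℝ ∞ (gradVec gi ρ k) u := by
  unfold gradVec; fun_prop

theorem smooth_gradSq (hgi : ∀ i j, ContDiffAt ℝ ∞ (gi i j) u) (hρ : ContDiffAt ℝ ∞ ρ u) :
    ContDiffAt ℝ ∞ (gradSq gi ρ) u := by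
  have := smooth_gradVec hgi hρ
  unfold gradSq; fun_prop

theorem smooth_conformalChr (hg : ∀ i j, ContDiffAt ℝ ∞ (g i j) u)
    (hgi : ∀ i j, ContDiffAt ℝ ∞ (gi i j) u) (hΓ : ∀ k i j, ContDiffAt ℝ ∞ (Γ k i j) u)
    (hρ : ContDiffAt ℝ ∞ ρ u) (k i j : Fin n) :
    ContDiffAt ℝ ∞ (conformalChr g gi Γ ρ k i j) u := by
  have := smooth_gradVec hgi hρ
  unfold conformalChr
  split_ifs <;> fun_prop

theorem smooth_conformalTensionForm (hρ : ContDiffAt ℝ ∞ ρ u) (k : Fin n) :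
    ContDiffAt ℝ ∞ (conformalTensionForm ρ k) u := by
  unfold conformalTensionForm; fun_prop

namespace IsLeviCivita

theorem lower_gradVec (h : IsLeviCivita g gi Γ U) (hu : u ∈ U) (k : Fin n) :
    ∑ m, g k m u * gradVec gi ρ m u = pd k ρ u :=
  h.lower_raise hu (fun l ↦ pd l ρ u) k

theorem contract_pd_gradVec (h : IsLeviCivita g gi Γ U) (hu : u ∈ U) (F : Fin n → ℝ) :
    ∑ i, ∑ j, gi i j u * (pd i ρ u * F j) = ∑ j, gradVec gi ρ j u * F j := by
  rw [h.contract_swap hu fun i j ↦ pd i ρ u * F j]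
  refine Finset.sum_congr rfl fun i _ ↦ ?_
  rw [gradVec, Finset.sum_mul]
  exact Finset.sum_congr rfl fun k _ ↦ by ring

/-- Each of the two terms of `compat` contracts to the same trace. The identity serves both the
conformal computation and the derivative of `√det g`. -/
theorem contract_pd (h : IsLeviCivita g gi Γ U) (hu : u ∈ U) (c : Fin n) :
    ∑ i, ∑ j, gi i j u * pd c (g i j) u = 2 * ∑ k, Γ k k c u := by
  have h1 : ∑ i, ∑ j, gi i j u * ∑ l, Γ l c i u * g l j u = ∑ k, Γ k k c u := by
    refine Finset.sum_congr rfl fun i _ ↦ ?_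
    rw [h.symm_chr u hu, ← h.raise_lower hu (fun l ↦ Γ l c i u) i]
    refine Finset.sum_congr rfl fun j _ ↦ ?_
    congr 1
    exact Finset.sum_congr rfl fun l _ ↦ by rw [h.symm u hu, mul_comm]
  have h2 : ∑ i, ∑ j, gi i j u * ∑ l, Γ l c j u * g i l u = ∑ k, Γ k k c u := by
    rw [← h1, h.contract_swap hu]
    refine Finset.sum_congr rfl fun i _ ↦ Finset.sum_congr rfl fun j _ ↦ ?_
    congr 1
    exact Finset.sum_congr rfl fun l _ ↦ by rw [h.symm u hu]
  simp only [h.compat u hu, Finset.sum_add_distrib, mul_add, h1, h2]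
  ring

/-- The derivative of the inverse metric supplies, through `pd_inv`, precisely the Christoffel terms
that complete the second partials of `ρ` to its Hessian. -/
theorem pd_gradSq (h : IsLeviCivita g gi Γ U) (hu : u ∈ U) (hρ : ContDiffAt ℝ ∞ ρ u) (c : Fin n) :
    pd c (gradSq gi ρ) u = 2 * ∑ k, gradVec gi ρ k u * covDForm Γ (fun k ↦ pd k ρ) c k u := by
  have hgi := h.smooth_inv u hu
  have h1 : pd c (gradSq gi ρ) u = ∑ i, ∑ j, (pd c (gi i j) u * (pd i ρ u * pd j ρ u)
      + gi i j u * (pd i ρ u * pd c (pd j ρ) u) + gi i j u * (pd j ρ u * pd c (pd i ρ) u)) := by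
    have : gradSq gi ρ = fun w ↦ ∑ i, ∑ j, gi i j w * (pd i ρ w * pd j ρ w) := by
      funext w
      simp only [gradSq, gradVec, Finset.mul_sum]
      exact Finset.sum_congr rfl fun k _ ↦ Finset.sum_congr rfl fun j _ ↦ by ring
    rw [this, pd_sum (fun k _ ↦ by fun_prop)]
    refine Finset.sum_congr rfl fun i _ ↦ ?_
    rw [pd_sum (fun k _ ↦ by fun_prop)]
    refine Finset.sum_congr rfl fun j _ ↦ ?_
    rw [pd_mul (by fun_prop) (by fun_prop), pd_mul (by fun_prop) (by fun_prop)]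
    ring
  have h2 : ∑ i, ∑ j, pd c (gi i j) u * (pd i ρ u * pd j ρ u) =
      -(2 * ∑ k, gradVec gi ρ k u * ∑ l, Γ l c k u * pd l ρ u) := by
    have e1 : ∑ i, ∑ j, (∑ l, Γ i c l u * gi l j u) * (pd i ρ u * pd j ρ u) =
        ∑ k, gradVec gi ρ k u * ∑ l, Γ l c k u * pd l ρ u := by
      simp only [gradVec, Finset.mul_sum, Finset.sum_mul]
      have (i : Fin n) : ∑ j, ∑ l, Γ i c l u * gi l j u * (pd i ρ u * pd j ρ u) =
        ∑ l, ∑ j, Γ i c l u * gi l j u * (pd i ρ u * pd j ρ u) := Finset.sum_comm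
      simp only [this]
      rw [Finset.sum_comm]
      exact Finset.sum_congr rfl fun _ _ ↦ Finset.sum_congr rfl fun _ _ ↦
        Finset.sum_congr rfl fun _ _ ↦ by ring
    have e2 : ∑ i, ∑ j, (∑ l, Γ j c l u * gi i l u) * (pd i ρ u * pd j ρ u) =
        ∑ k, gradVec gi ρ k u * ∑ l, Γ l c k u * pd l ρ u := by
      rw [← e1, Finset.sum_comm]
      refine Finset.sum_congr rfl fun i _ ↦ Finset.sum_congr rfl fun j _ ↦ ?_
      simp only [h.symm_inv u hu j]
      ring
    simp only [h.pd_inv hu, Finset.sum_add_distrib, neg_mul, add_mul, Finset.sum_neg_distrib, e1, e2]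
    ring
  have h3 := h.contract_pd_gradVec (ρ := ρ) hu fun j ↦ pd c (pd j ρ) u
  have h4 : ∑ i, ∑ j, gi i j u * (pd j ρ u * pd c (pd i ρ) u) =
      ∑ j, gradVec gi ρ j u * pd c (pd j ρ) u := by
    rw [← h3, h.contract_swap hu fun i j ↦ pd j ρ u * pd c (pd i ρ) u]
  rw [h1]
  simp only [Finset.sum_add_distrib, h2, h3, h4, covDForm, mul_sub, Finset.sum_sub_distrib]
  ring

theorem covDForm_pd_symm (h : IsLeviCivita g gi Γ U) (hu : u ∈ U) (hρ : ContDiffAt ℝ ∞ ρ u)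
    (i j : Fin n) : covDForm Γ (fun k ↦ pd k ρ) i j u = covDForm Γ (fun k ↦ pd k ρ) j i u := by
  simp only [covDForm, pd_comm hρ i j, h.symm_chr u hu _ i j]

/-- The Leibniz rule for `η = (2 - n) e^{2ρ} dρ`, with `H` the Hessian of `ρ`. Two of the resulting
terms contract `H` with `grad ρ`, and each such contraction is half the derivative of `|grad ρ|²`.
-/
theorem divTensor_covDForm_conformal (h : IsLeviCivita g gi Γ U) (hu : u ∈ U)
    (hρ : ∀ w ∈ U, ContDiffAt ℝ ∞ ρ w) (c : Fin n) :
    divTensor gi Γ (covDForm Γ (conformalTensionForm ρ)) c u =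
      (2 - (n : ℝ)) * Real.exp (2 * ρ u) *
        (divTensor gi Γ (covDForm Γ fun k ↦ pd k ρ) c u + 2 * pd c (gradSq gi ρ) u
          + 4 * gradSq gi ρ u * pd c ρ u + 2 * divergence Γ (gradVec gi ρ) u * pd c ρ u) := by
  have hρu := hρ u hu
  have hΓ := h.smooth_chr u hu
  let H : Fin n → Fin n → Eu n → ℝ := covDForm Γ fun k ↦ pd k ρ
  have hH (i j : Fin n) : ContDiffAt ℝ ∞ (H i j) u := by
    simp only [H]; exact smooth_covDForm hΓ (fun k ↦ by fun_prop) i j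
  set a : ℝ := 2 - (n : ℝ) with ha
  have e1 (w : Eu n) (hw : w ∈ U) (j c : Fin n) : covDForm Γ (conformalTensionForm ρ) j c w =
      a * (Real.exp (2 * ρ w) * (H j c w + 2 * (pd j ρ w * pd c ρ w))) := by
    have hρw := hρ w hw
    have : pd j (conformalTensionForm ρ c) w =
        a * (2 * Real.exp (2 * ρ w) * pd j ρ w * pd c ρ w
          + Real.exp (2 * ρ w) * pd j (pd c ρ) w) := by
      change pd j (fun w ↦ a * (Real.exp (2 * ρ w) * pd c ρ w)) w = _
      rw [pd_const_mul (by fun_prop), pd_mul (by fun_prop) (by fun_prop), pd_exp hρw]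
    simp only [covDForm, this, H]
    have h2 : ∑ k, Γ k j c w * conformalTensionForm ρ k w =
        a * (Real.exp (2 * ρ w) * ∑ k, Γ k j c w * pd k ρ w) := by
      simp only [conformalTensionForm, Finset.mul_sum, ← ha]
      exact Finset.sum_congr rfl fun k _ ↦ by ring
    rw [h2]
    ring
  have e2 (i j : Fin n) : pd i (covDForm Γ (conformalTensionForm ρ) j c) u =
      a * Real.exp (2 * ρ u) * (2 * pd i ρ u * (H j c u + 2 * (pd j ρ u * pd c ρ u))
        + pd i (H j c) u + 2 * (pd i (pd j ρ) u * pd c ρ u + pd j ρ u * pd i (pd c ρ) u)) := by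
    rw [pd_congr ((h.eventually_mem hu).mono fun w hw ↦ e1 w hw j c),
      pd_const_mul (by fun_prop), pd_mul (by fun_prop) (by fun_prop), pd_exp hρu,
      pd_add (by fun_prop) (by fun_prop), pd_const_mul (by fun_prop),
      pd_mul (by fun_prop) (by fun_prop)]
    ring
  have e3 (i j : Fin n) : pd i (covDForm Γ (conformalTensionForm ρ) j c) u
      - ∑ l, Γ l i j u * covDForm Γ (conformalTensionForm ρ) l c u
      - ∑ k, Γ k i c u * covDForm Γ (conformalTensionForm ρ) j k u =
      a * Real.exp (2 * ρ u) * ((pd i (H j c) u - ∑ l, Γ l i j u * H l c u - ∑ k, Γ k i c u * H j k u)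
        + 2 * (pd i ρ u * H j c u) + 4 * pd c ρ u * (pd i ρ u * pd j ρ u) + 2 * pd c ρ u * H i j u
        + 2 * (pd j ρ u * H i c u)) := by
    simp only [e1 u hu, e2]
    have s1 : ∑ l, Γ l i j u * (a * (Real.exp (2 * ρ u) * (H l c u + 2 * (pd l ρ u * pd c ρ u)))) =
        a * Real.exp (2 * ρ u) *
          (∑ l, Γ l i j u * H l c u + 2 * pd c ρ u * ∑ l, Γ l i j u * pd l ρ u) := by
      simp only [Finset.mul_sum, ← Finset.sum_add_distrib]
      exact Finset.sum_congr rfl fun l _ ↦ by ring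
    have s2 : ∑ k, Γ k i c u * (a * (Real.exp (2 * ρ u) * (H j k u + 2 * (pd j ρ u * pd k ρ u)))) =
        a * Real.exp (2 * ρ u) *
          (∑ k, Γ k i c u * H j k u + 2 * pd j ρ u * ∑ k, Γ k i c u * pd k ρ u) := by
      simp only [Finset.mul_sum, ← Finset.sum_add_distrib]
      exact Finset.sum_congr rfl fun l _ ↦ by ring
    have s3 : H i j u = pd i (pd j ρ) u - ∑ l, Γ l i j u * pd l ρ u := rfl
    have s4 : H i c u = pd i (pd c ρ) u - ∑ k, Γ k i c u * pd k ρ u := rfl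
    rw [s1, s2, s3, s4]
    ring
  have t1 := h.contract_pd_gradVec (ρ := ρ) hu fun j ↦ H j c u
  have t2 : ∑ i, ∑ j, gi i j u * (pd j ρ u * H i c u) = ∑ j, gradVec gi ρ j u * H j c u := by
    rw [← t1, h.contract_swap hu fun i j ↦ pd j ρ u * H i c u]
  have t3 : ∑ i, ∑ j, gi i j u * (pd i ρ u * pd j ρ u) = gradSq gi ρ u := by
    rw [h.contract_pd_gradVec hu, gradSq]
    simp only [mul_comm]
  have t4 : ∑ i, ∑ j, gi i j u * H i j u = divergence Γ (gradVec gi ρ) u :=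
    (h.divergence_raise (S := fun k ↦ pd k ρ) hu (fun k ↦ by fun_prop)).symm
  have t5 : pd c (gradSq gi ρ) u = 2 * ∑ j, gradVec gi ρ j u * H j c u := by
    rw [h.pd_gradSq hu hρu]
    simp only [h.covDForm_pd_symm hu hρu c, H]
  have key : divTensor gi Γ (covDForm Γ (conformalTensionForm ρ)) c u =
      a * Real.exp (2 * ρ u) * (divTensor gi Γ H c u
        + 2 * ∑ i, ∑ j, gi i j u * (pd i ρ u * H j c u)
        + 4 * pd c ρ u * ∑ i, ∑ j, gi i j u * (pd i ρ u * pd j ρ u)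
        + 2 * pd c ρ u * ∑ i, ∑ j, gi i j u * H i j u
        + 2 * ∑ i, ∑ j, gi i j u * (pd j ρ u * H i c u)) := by
    simp only [divTensor, e3, Finset.mul_sum (Finset.univ) (fun i ↦ ∑ j, gi i j u * _),
      Finset.mul_sum (Finset.univ) (fun j ↦ gi _ j u * _), ← Finset.sum_add_distrib]
    simp only [Finset.mul_sum (Finset.univ) (fun i ↦ ∑ j, (_ + _ : ℝ)),
      Finset.mul_sum (Finset.univ) (fun i ↦ (_ + _ : ℝ))]
    exact Finset.sum_congr rfl fun i _ ↦ Finset.sum_congr rfl fun j _ ↦ by ring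
  rw [key, t1, t2, t3, t4, t5]
  ring

/-- Paired with `η`, the conformal correction becomes the vector field `X` with components `(2 - n)
e^{2ρ} (2 ∂_cρ gradⁱρ - δⁱ_c |grad ρ|²)`, whose divergence is computed directly. The result contains
the noncovariant trace `Γᵏₖ꜀`, which is cancelled by the same term in
`contract_pd_conformal_difference`. -/
theorem divergence_conformal_difference (h : IsLeviCivita g gi Γ U) (hu : u ∈ U)
    (hρ : ∀ w ∈ U, ContDiffAt ℝ ∞ ρ w) (c : Fin n) :
    divergence Γ (fun i w ↦ ∑ j, gi i j w * ∑ k, (conformalChr g gi Γ ρ k c j w - Γ k c j w) *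
        conformalTensionForm ρ k w) u =
      (2 - (n : ℝ)) * Real.exp (2 * ρ u) * (2 * gradSq gi ρ u * pd c ρ u
        + 2 * ∑ i, gradVec gi ρ i u * pd i (pd c ρ) u + 2 * divergence Γ (gradVec gi ρ) u * pd c ρ u
        - pd c (gradSq gi ρ) u - gradSq gi ρ u * ∑ k, Γ k k c u) := by
  have hρu := hρ u hu
  have hgi := h.smooth_inv u hu
  have hT := smooth_gradVec hgi hρu
  have hs := smooth_gradSq hgi hρu
  set a : ℝ := 2 - (n : ℝ) with ha
  let X : Fin n → Eu n → ℝ := fun i w ↦ a * (Real.exp (2 * ρ w) *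
    (2 * (pd c ρ w * gradVec gi ρ i w) - (if i = c then 1 else 0) * gradSq gi ρ w))
  have e1 (i : Fin n) : (fun w ↦ ∑ j, gi i j w * ∑ k, (conformalChr g gi Γ ρ k c j w - Γ k c j w) *
      conformalTensionForm ρ k w) =ᶠ[𝓝 u] X i := by
    refine (h.eventually_mem hu).mono fun w hw ↦ ?_
    have (j : Fin n) : ∑ k, (conformalChr g gi Γ ρ k c j w - Γ k c j w) *
        conformalTensionForm ρ k w =
        a * (Real.exp (2 * ρ w) * (2 * (pd c ρ w * pd j ρ w) - g j c w * gradSq gi ρ w)) := by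
      simp only [conformalChr, add_sub_cancel_left, sub_mul, add_mul, ite_mul, zero_mul,
        Finset.sum_add_distrib, Finset.sum_sub_distrib, Finset.sum_ite_eq', Finset.mem_univ, if_true,
        conformalTensionForm, ← ha]
      have : ∑ k, g c j w * gradVec gi ρ k w * (a * (Real.exp (2 * ρ w) * pd k ρ w)) =
          a * (Real.exp (2 * ρ w) * (g j c w * gradSq gi ρ w)) := by
        simp only [gradSq, Finset.mul_sum, h.symm w hw c j]
        exact Finset.sum_congr rfl fun k _ ↦ by ring
      rw [this]
      ring
    simp only [this, X]
    have h2 : ∑ j, gi i j w * (a * (Real.exp (2 * ρ w) *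
        (2 * (pd c ρ w * pd j ρ w) - g j c w * gradSq gi ρ w))) =
        a * (Real.exp (2 * ρ w) * (2 * (pd c ρ w * ∑ j, gi i j w * pd j ρ w)
          - (∑ j, gi i j w * g j c w) * gradSq gi ρ w)) := by
      simp only [Finset.mul_sum, Finset.sum_mul, ← Finset.sum_sub_distrib]
      exact Finset.sum_congr rfl fun k _ ↦ by ring
    rw [h2, h.inv_mul hw]
    rfl
  rw [divergence_congr e1]
  have e2 (i : Fin n) : pd i (X i) u = a * Real.exp (2 * ρ u) *
      (4 * (pd i ρ u * gradVec gi ρ i u) * pd c ρ u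
        - (if i = c then 2 * pd i ρ u * gradSq gi ρ u + pd i (gradSq gi ρ) u else 0)
        + 2 * (gradVec gi ρ i u * pd i (pd c ρ) u) + 2 * pd c ρ u * pd i (gradVec gi ρ i) u) := by
    simp only [X]
    rw [pd_const_mul (by fun_prop), pd_mul (by fun_prop) (by fun_prop), pd_exp hρu,
      pd_sub (by fun_prop) (by fun_prop), pd_const_mul (by fun_prop), pd_const_mul (by fun_prop),
      pd_mul (by fun_prop) (by fun_prop)]
    split_ifs <;> ring
  have e3 (i : Fin n) : pd i (X i) u + (∑ k, Γ k k i u) * X i u = a * Real.exp (2 * ρ u) *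
      (4 * pd c ρ u * (pd i ρ u * gradVec gi ρ i u)
        + 2 * (gradVec gi ρ i u * pd i (pd c ρ) u)
        + 2 * pd c ρ u * (pd i (gradVec gi ρ i) u + (∑ k, Γ k k i u) * gradVec gi ρ i u)
        - (if i = c then 2 * pd i ρ u * gradSq gi ρ u + pd i (gradSq gi ρ) u
            + gradSq gi ρ u * ∑ k, Γ k k i u else 0)) := by
    rw [e2]
    simp only [X]
    split_ifs <;> ring
  simp only [divergence, e3]
  rw [← Finset.mul_sum]
  congr 1
  simp only [Finset.sum_add_distrib, Finset.sum_sub_distrib, Finset.sum_ite_eq', Finset.mem_univ,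
    if_true, ← Finset.mul_sum]
  rw [← gradSq]
  ring

/-- The Kronecker terms of the correction give second partials of `ρ` along the gradient. The term
`-gᵢⱼ gradᵏρ` gives the trace `gⁱʲ ∂_c gᵢⱼ` and, through `gⁱʲ gᵢⱼ = n`, the dimension. -/
theorem contract_pd_conformal_difference (h : IsLeviCivita g gi Γ U) (hu : u ∈ U)
    (hρ : ∀ w ∈ U, ContDiffAt ℝ ∞ ρ w) (c : Fin n) :
    ∑ i, ∑ j, gi i j u * ∑ k, pd c (conformalChr g gi Γ ρ k i j) u * conformalTensionForm ρ k u =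
      ∑ i, ∑ j, gi i j u * ∑ k, pd c (Γ k i j) u * conformalTensionForm ρ k u
      + (2 - (n : ℝ)) * Real.exp (2 * ρ u) * (2 * ∑ j, gradVec gi ρ j u * pd c (pd j ρ) u
        - 2 * gradSq gi ρ u * ∑ k, Γ k k c u
        - n * (pd c (gradSq gi ρ) u - ∑ j, gradVec gi ρ j u * pd c (pd j ρ) u)) := by
  have hρu := hρ u hu
  have hgi := h.smooth_inv u hu
  have hg := h.smooth u hu
  have hΓ := h.smooth_chr u hu
  have hT := smooth_gradVec hgi hρu
  set a : ℝ := 2 - (n : ℝ) with ha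
  have e1 (k i j : Fin n) : pd c (conformalChr g gi Γ ρ k i j) u = pd c (Γ k i j) u
      + ((if k = i then pd c (pd j ρ) u else 0) + (if k = j then pd c (pd i ρ) u else 0)
        - (pd c (g i j) u * gradVec gi ρ k u + g i j u * pd c (gradVec gi ρ k) u)) := by
    have : conformalChr g gi Γ ρ k i j = fun w ↦ Γ k i j w
      + ((if k = i then 1 else 0) * pd j ρ w + (if k = j then 1 else 0) * pd i ρ w
        - g i j w * gradVec gi ρ k w) := by
      funext w; simp [conformalChr]
    rw [this, pd_add (by fun_prop) (by fun_prop), pd_sub (by fun_prop) (by fun_prop),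
      pd_add (by fun_prop) (by fun_prop), pd_const_mul (by fun_prop), pd_const_mul (by fun_prop),
      pd_mul (by fun_prop) (by fun_prop)]
    simp
  have e2 : ∑ k, pd k ρ u * pd c (gradVec gi ρ k) u =
      pd c (gradSq gi ρ) u - ∑ j, gradVec gi ρ j u * pd c (pd j ρ) u := by
    have : pd c (gradSq gi ρ) u = ∑ k, pd c (fun w ↦ pd k ρ w * gradVec gi ρ k w) u :=
      pd_sum (fun k _ ↦ by fun_prop) c
    rw [this, ← Finset.sum_sub_distrib]
    exact Finset.sum_congr rfl fun k _ ↦ by rw [pd_mul (by fun_prop) (by fun_prop)]; ring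
  have e3 (i j : Fin n) : ∑ k, pd c (conformalChr g gi Γ ρ k i j) u * conformalTensionForm ρ k u =
      ∑ k, pd c (Γ k i j) u * conformalTensionForm ρ k u
      + a * Real.exp (2 * ρ u) * (pd i ρ u * pd c (pd j ρ) u + pd j ρ u * pd c (pd i ρ) u
        - pd c (g i j) u * gradSq gi ρ u - g i j u * ∑ k, pd k ρ u * pd c (gradVec gi ρ k) u) := by
    simp only [e1, sub_mul, add_mul, ite_mul, zero_mul, Finset.sum_add_distrib,
      Finset.sum_sub_distrib, Finset.sum_ite_eq', Finset.mem_univ, if_true]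
    have s1 : ∑ k, pd c (g i j) u * gradVec gi ρ k u * conformalTensionForm ρ k u =
        a * Real.exp (2 * ρ u) * (pd c (g i j) u * gradSq gi ρ u) := by
      simp only [gradSq, conformalTensionForm, Finset.mul_sum, ← ha]
      exact Finset.sum_congr rfl fun k _ ↦ by ring
    have s2 : ∑ k, g i j u * pd c (gradVec gi ρ k) u * conformalTensionForm ρ k u =
        a * Real.exp (2 * ρ u) * (g i j u * ∑ k, pd k ρ u * pd c (gradVec gi ρ k) u) := by
      simp only [conformalTensionForm, Finset.mul_sum, ← ha]
      exact Finset.sum_congr rfl fun k _ ↦ by ring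
    rw [s1, s2]
    simp only [conformalTensionForm, ← ha]
    ring
  have t1 := h.contract_pd_gradVec (ρ := ρ) hu fun j ↦ pd c (pd j ρ) u
  have t2 : ∑ i, ∑ j, gi i j u * (pd j ρ u * pd c (pd i ρ) u) =
      ∑ j, gradVec gi ρ j u * pd c (pd j ρ) u := by
    rw [← t1, h.contract_swap hu fun i j ↦ pd j ρ u * pd c (pd i ρ) u]
  have t3 : ∑ i, ∑ j, gi i j u * g i j u = n := by
    have (i : Fin n) : ∑ j, gi i j u * g i j u = 1 := by
      have := h.inv_mul hu i i
      simp only [if_true] at this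
      rw [← this]
      exact Finset.sum_congr rfl fun j _ ↦ by rw [h.symm u hu]
    simp [this]
  have key : ∑ i, ∑ j, gi i j u * (∑ k, pd c (Γ k i j) u * conformalTensionForm ρ k u
      + a * Real.exp (2 * ρ u) * (pd i ρ u * pd c (pd j ρ) u + pd j ρ u * pd c (pd i ρ) u
        - pd c (g i j) u * gradSq gi ρ u - g i j u * ∑ k, pd k ρ u * pd c (gradVec gi ρ k) u)) =
      ∑ i, ∑ j, gi i j u * ∑ k, pd c (Γ k i j) u * conformalTensionForm ρ k u
      + a * Real.exp (2 * ρ u) * (∑ i, ∑ j, gi i j u * (pd i ρ u * pd c (pd j ρ) u)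
        + ∑ i, ∑ j, gi i j u * (pd j ρ u * pd c (pd i ρ) u)
        - gradSq gi ρ u * ∑ i, ∑ j, gi i j u * pd c (g i j) u
        - (∑ k, pd k ρ u * pd c (gradVec gi ρ k) u) * ∑ i, ∑ j, gi i j u * g i j u) := by
    generalize ∑ k, pd k ρ u * pd c (gradVec gi ρ k) u = z
    simp only [Finset.mul_sum (Finset.univ) (fun i ↦ ∑ j, gi i j u * _),
      Finset.mul_sum (Finset.univ) (fun j ↦ gi _ j u * _), ← Finset.sum_add_distrib,
      ← Finset.sum_sub_distrib]
    simp only [Finset.mul_sum (Finset.univ) (fun i ↦ ∑ j, (_ - _ : ℝ)),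
      Finset.mul_sum (Finset.univ) (fun i ↦ (_ - _ : ℝ)), ← Finset.sum_add_distrib]
    exact Finset.sum_congr rfl fun i _ ↦ Finset.sum_congr rfl fun j _ ↦ by ring
  simp only [e3]
  rw [key, t1, t2, t3, h.contract_pd hu, e2]
  ring

theorem pd_conformal_contract (h : IsLeviCivita g gi Γ U) (hu : u ∈ U)
    (hρ : ContDiffAt ℝ ∞ ρ u) (c : Fin n) :
    ∑ k, ∑ l, pd c (fun w ↦ Real.exp (2 * ρ w) * g k l w) u *
        (conformalTension gi ρ k u * conformalTension gi ρ l u) =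
      (2 - (n : ℝ)) * ((2 - (n : ℝ)) * Real.exp (2 * ρ u)) * (2 * pd c ρ u * gradSq gi ρ u
        + 2 * ∑ j, gradVec gi ρ j u * pd c (pd j ρ) u - pd c (gradSq gi ρ) u) := by
  have hg := h.smooth u hu
  set a : ℝ := 2 - (n : ℝ) with ha
  have e1 : ∑ k, ∑ l, g k l u * (gradVec gi ρ k u * gradVec gi ρ l u) = gradSq gi ρ u := by
    rw [gradSq]
    refine Finset.sum_congr rfl fun k _ ↦ ?_
    rw [← h.lower_gradVec hu k, Finset.sum_mul]
    exact Finset.sum_congr rfl fun k _ ↦ by ring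
  have e2 : ∑ k, ∑ l, pd c (g k l) u * (gradVec gi ρ k u * gradVec gi ρ l u) =
      2 * ∑ k, gradVec gi ρ k u * ∑ m, Γ m c k u * pd m ρ u := by
    have s1 : ∑ k, ∑ l, (∑ m, Γ m c k u * g m l u) * (gradVec gi ρ k u * gradVec gi ρ l u) =
        ∑ k, gradVec gi ρ k u * ∑ m, Γ m c k u * pd m ρ u := by
      refine Finset.sum_congr rfl fun k _ ↦ ?_
      simp only [← h.lower_gradVec (ρ := ρ) hu, Finset.mul_sum, Finset.sum_mul]
      rw [Finset.sum_comm]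
      exact Finset.sum_congr rfl fun k _ ↦ Finset.sum_congr rfl fun k _ ↦ by ring
    have s2 : ∑ k, ∑ l, (∑ m, Γ m c l u * g k m u) * (gradVec gi ρ k u * gradVec gi ρ l u) =
        ∑ k, gradVec gi ρ k u * ∑ m, Γ m c k u * pd m ρ u := by
      rw [← s1, Finset.sum_comm]
      refine Finset.sum_congr rfl fun k _ ↦ Finset.sum_congr rfl fun l _ ↦ ?_
      simp only [h.symm u hu l]
      ring
    simp only [h.compat u hu, Finset.sum_add_distrib, add_mul, s1, s2]
    ring
  have e3 : ∑ k, ∑ l, pd c (fun w ↦ Real.exp (2 * ρ w) * g k l w) u *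
        (conformalTension gi ρ k u * conformalTension gi ρ l u) =
      a * (a * Real.exp (2 * ρ u)) *
        (2 * pd c ρ u * ∑ k, ∑ l, g k l u * (gradVec gi ρ k u * gradVec gi ρ l u)
        + ∑ k, ∑ l, pd c (g k l) u * (gradVec gi ρ k u * gradVec gi ρ l u)) := by
    simp only [Finset.mul_sum, ← Finset.sum_add_distrib]
    refine Finset.sum_congr rfl fun k _ ↦ Finset.sum_congr rfl fun l _ ↦ ?_
    rw [pd_mul (by fun_prop) (by fun_prop), pd_exp hρ]
    simp only [conformalTension, ← ha]
    ring
  rw [e3, e1, e2, h.pd_gradSq hu hρ]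
  simp only [covDForm, mul_sub, Finset.sum_sub_distrib]
  ring

/-- The Euler–Lagrange expression of the bienergy at the identity map from a metric to a conformal
metric. -/
theorem eulerLagrange_conformal (h : IsLeviCivita g gi Γ U) (hu : u ∈ U)
    (hρ : ∀ w ∈ U, ContDiffAt ℝ ∞ ρ w) (c : Fin n) :
    eulerLagrange gi Γ (fun k l w ↦ Real.exp (2 * ρ w) * g k l w) (conformalChr g gi Γ ρ)
        (conformalTension gi ρ) (conformalTensionForm ρ) c u =
      (2 - (n : ℝ)) * Real.exp (2 * ρ u) *
        (∑ k, g c k u * ∑ i, ∑ j, gi i j u * covDVec2 Γ (gradVec gi ρ) k i j u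
          + ∑ m, (∑ i, curvature Γ i i c m u) * gradVec gi ρ m u
          + (-2 * divergence Γ (gradVec gi ρ) u + (2 - (n : ℝ)) * gradSq gi ρ u) * pd c ρ u
          + (6 - (n : ℝ)) / 2 * pd c (gradSq gi ρ) u) := by
  have hρu := hρ u hu
  have hgi := h.smooth_inv u hu
  have hg := h.smooth u hu
  have hΓ := h.smooth_chr u hu
  have hη := smooth_conformalTensionForm hρu
  have hΓ' := smooth_conformalChr hg hgi hΓ hρu
  have h1 := h.divergence_sub_eq_divTensor_add_curvature hu hη c
  -- The `Γ` part is the one occurring in the covariant identity `h1`; the rest is the conformal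
  -- correction.
  have hsplit : divergence Γ (fun i w ↦ ∑ j, gi i j w * ∑ k, conformalChr g gi Γ ρ k c j w *
        conformalTensionForm ρ k w) u =
      divergence Γ (fun i w ↦ ∑ j, gi i j w * ∑ k, Γ k c j w * conformalTensionForm ρ k w) u
      + divergence Γ (fun i w ↦ ∑ j, gi i j w * ∑ k, (conformalChr g gi Γ ρ k c j w - Γ k c j w) *
        conformalTensionForm ρ k w) u := by
    simp only [divergence, ← Finset.sum_add_distrib]
    refine Finset.sum_congr rfl fun i _ ↦ ?_
    have : (fun w ↦ ∑ j, gi i j w * ∑ k, conformalChr g gi Γ ρ k c j w *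
        conformalTensionForm ρ k w) = fun w ↦
        (∑ j, gi i j w * ∑ k, Γ k c j w * conformalTensionForm ρ k w) +
        (∑ j, gi i j w * ∑ k, (conformalChr g gi Γ ρ k c j w - Γ k c j w) *
          conformalTensionForm ρ k w) := by
      funext w
      simp only [sub_mul, Finset.sum_sub_distrib, mul_sub]
      ring
    rw [this, pd_add (by fun_prop) (by fun_prop), congrFun this u]
    ring
  have hlow : divTensor gi Γ (covDForm Γ fun k ↦ pd k ρ) c u =
      ∑ k, g c k u * ∑ i, ∑ j, gi i j u * covDVec2 Γ (gradVec gi ρ) k i j u := by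
    rw [← h.divTensor_lower hu (fun w hw ↦ smooth_gradVec (h.smooth_inv w hw) (hρ w hw)) c]
    have e (w : Eu n) (hw : w ∈ U) (j c : Fin n) : covDForm Γ (fun k ↦ pd k ρ) j c w =
        covDForm Γ (fun c w ↦ ∑ k, g c k w * gradVec gi ρ k w) j c w := by
      simp only [covDForm, h.lower_gradVec hw]
      congr 1
      exact pd_congr ((h.eventually_mem hw).mono fun v hv ↦ (h.lower_gradVec hv c).symm) j
    simp only [divTensor, ← e u hu]
    refine Finset.sum_congr rfl fun i _ ↦ Finset.sum_congr rfl fun j _ ↦ ?_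
    rw [pd_congr ((h.eventually_mem hu).mono fun v hv ↦ e v hv j c)]
  have hric : ∑ i, ∑ j, gi i j u * ∑ k, curvature Γ k c i j u * conformalTensionForm ρ k u =
      (2 - (n : ℝ)) * Real.exp (2 * ρ u) *
        ∑ m, (∑ i, curvature Γ i i c m u) * gradVec gi ρ m u := by
    rw [← h.contract_curvature hu]
    simp only [h.lower_gradVec hu, conformalTensionForm, Finset.mul_sum]
    exact Finset.sum_congr rfl fun i _ ↦ Finset.sum_congr rfl fun j _ ↦
      Finset.sum_congr rfl fun k _ ↦ by ring
  have hcomm : ∑ i, gradVec gi ρ i u * pd i (pd c ρ) u = ∑ j, gradVec gi ρ j u * pd c (pd j ρ) u :=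
    Finset.sum_congr rfl fun i _ ↦ by rw [pd_comm hρu]
  have h2 := h.divTensor_covDForm_conformal hu hρ c
  have h3 := h.divergence_conformal_difference hu hρ c
  have h4 := h.contract_pd_conformal_difference hu hρ c
  have h5 := h.pd_conformal_contract hu hρu c
  rw [hcomm] at h3
  rw [hlow] at h2
  rw [eulerLagrange, hsplit, h3, h4, h5]
  -- After the factor `(2 - n) e^{2ρ}` is taken out, the noncovariant terms `gradʲρ ∂_c∂ⱼρ` have
  -- total coefficient `(2 - n) + 2 + n - 4 = 0`. The derivative of `|grad ρ|²` gets `-(2 - n)/2 - n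
  -- + 2 + 2 = (6 - n)/2`, the term `|grad ρ|² ∂_cρ` gets `(2 - n) - 4 + 4`, and the divergence term
  -- gets `-4 + 2`.
  linear_combination h1 + h2 + hric

end IsLeviCivita

end Conformal

/-! ### Matrix-valued metrics on open subsets of `ℝⁿ` -/

section MatrixMetric

variable {n : ℕ}

/-- The Christoffel symbols of a matrix-valued metric. -/
def chr (G : Eu n → Matrix (Fin n) (Fin n) ℝ) (k i j : Fin n) (u : Eu n) : ℝ :=
  1 / 2 * ∑ l, (G u)⁻¹ k l *
    (pd i (fun w ↦ G w j l) u + pd j (fun w ↦ G w i l) u - pd l (fun w ↦ G w i j) u)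

/-- `G` is a smooth Riemannian metric on the open set `U`. -/
structure IsMetric (G : Eu n → Matrix (Fin n) (Fin n) ℝ) (U : Set (Eu n)) : Prop where
  isOpen : IsOpen U
  smooth : ∀ u ∈ U, ∀ i j, ContDiffAt ℝ ∞ (fun w ↦ G w i j) u
  posDef : ∀ u ∈ U, (G u).PosDef

theorem contDiffAt_det {E : Type*} [NormedAddCommGroup E] [NormedSpace ℝ E]
    {A : E → Matrix (Fin n) (Fin n) ℝ} {q : E}
    (hA : ∀ i j, ContDiffAt ℝ ∞ (fun w ↦ A w i j) q) : ContDiffAt ℝ ∞ (fun w ↦ (A w).det) q := by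
  simp only [Matrix.det_apply, Units.smul_def, zsmul_eq_mul]
  exact ContDiffAt.sum fun σ _ ↦ contDiffAt_const.mul (contDiffAt_prod fun i _ ↦ hA _ _)

/-- Cramer's rule: the entries of the adjugate are determinants of matrices with one row replaced by
a constant vector. -/
theorem contDiffAt_inv {A : Eu n → Matrix (Fin n) (Fin n) ℝ} {q : Eu n}
    (hA : ∀ i j, ContDiffAt ℝ ∞ (fun w ↦ A w i j) q) (hd : (A q).det ≠ 0) (i j : Fin n) :
    ContDiffAt ℝ ∞ (fun w ↦ (A w)⁻¹ i j) q := by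
  simp only [Matrix.inv_def, Ring.inverse_eq_inv', Matrix.smul_apply, Matrix.adjugate_apply,
    smul_eq_mul]
  refine (contDiffAt_det hA |>.inv hd).mul (contDiffAt_det fun a b ↦ ?_)
  by_cases h : a = j
  · subst h; simpa using contDiffAt_const
  · simpa [Matrix.updateRow_apply, h] using hA a b

/-- Jacobi's formula. By the chain rule it suffices to differentiate the determinant along the line
`A + tB = G(1 + tM)` with `M = G⁻¹B`, and `det (1 + tM)` is a polynomial in `t` with linear
coefficient `trace M`. -/
theorem pd_det {G : Eu n → Matrix (Fin n) (Fin n) ℝ} {u : Eu n}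
    (hG : ∀ i j, ContDiffAt ℝ ∞ (fun w ↦ G w i j) u) (hd : IsUnit (G u).det) (c : Fin n) :
    pd c (fun w ↦ (G w).det) u =
      (G u).det * ∑ i, ∑ j, (G u)⁻¹ i j * pd c (fun w ↦ G w j i) u := by
  let D : (Fin n → Fin n → ℝ) → ℝ := fun A ↦ (Matrix.of A).det
  have hD : ContDiff ℝ ∞ D := contDiff_iff_contDiffAt.2 fun A ↦
    contDiffAt_det fun i j ↦ by
      simp only [Matrix.of_apply]
      fun_prop
  let A : Fin n → Fin n → ℝ := fun i j ↦ G u i j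
  let B : Fin n → Fin n → ℝ := fun i j ↦ pd c (fun w ↦ G w i j) u
  have h1 : pd c (fun w ↦ (G w).det) u = fderiv ℝ D A B := by
    have hcomp : (fun w ↦ (G w).det) = D ∘ fun w i j ↦ G w i j := by
      funext w; rfl
    have hGd : HasFDerivAt (fun w (i : Fin n) (j : Fin n) ↦ G w i j)
        (ContinuousLinearMap.pi fun i ↦ ContinuousLinearMap.pi fun j ↦
          fderiv ℝ (fun w ↦ G w i j) u) u :=
      hasFDerivAt_pi.2 fun i ↦ hasFDerivAt_pi.2 fun j ↦
        (differentiableAt_of_smooth (hG i j)).hasFDerivAt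
    have hDd : HasFDerivAt D (fderiv ℝ D A) ((fun w (i : Fin n) (j : Fin n) ↦ G w i j) u) :=
      (hD.differentiable (by simp) A).hasFDerivAt
    rw [pd, hcomp, (hDd.comp u hGd).fderiv]
    rfl
  have h2 : HasDerivAt (fun t : ℝ ↦ D (A + t • B)) (fderiv ℝ D A B) 0 := by
    have hl : HasDerivAt (fun t : ℝ ↦ A + t • B) B 0 := by
      simpa using ((hasDerivAt_id (0 : ℝ)).smul_const B).const_add A
    have hDd : HasFDerivAt D (fderiv ℝ D A) (A + (0 : ℝ) • B) := by
      simpa using (hD.differentiable (by simp) A).hasFDerivAt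
    exact hDd.comp_hasDerivAt 0 hl
  let M : Matrix (Fin n) (Fin n) ℝ := (G u)⁻¹ * Matrix.of B
  let P : Polynomial ℝ := (1 + (Polynomial.X : Polynomial ℝ) • M.map Polynomial.C).det
  have h3 (t : ℝ) : D (A + t • B) = (G u).det * P.eval t := by
    have e1 : P.eval t = (1 + t • M).det := by
      simp only [P]
      rw [← Polynomial.coe_evalRingHom, RingHom.map_det]
      congr 1
      ext i j
      simp [Matrix.one_apply, apply_ite]
      ring
    have e2 : Matrix.of (A + t • B) = G u * (1 + t • M) := by
      rw [Matrix.mul_add, Matrix.mul_one, Matrix.mul_smul, ← Matrix.mul_assoc,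
        Matrix.mul_nonsing_inv _ hd, Matrix.one_mul]
      rfl
    simp only [D]
    rw [e1, e2, Matrix.det_mul]
  have h4 : HasDerivAt (fun t : ℝ ↦ D (A + t • B)) ((G u).det * M.trace) 0 := by
    simp only [h3]
    have := (P.hasDerivAt 0).const_mul (G u).det
    rwa [Matrix.derivative_det_one_add_X_smul] at this
  rw [h1, h2.unique h4]
  simp [Matrix.trace, M, Matrix.mul_apply, B]

namespace IsMetric

variable {G : Eu n → Matrix (Fin n) (Fin n) ℝ} {U : Set (Eu n)} {u : Eu n}

theorem det_pos (h : IsMetric G U) (hu : u ∈ U) : 0 < (G u).det := (h.posDef u hu).det_pos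

theorem isUnit_det (h : IsMetric G U) (hu : u ∈ U) : IsUnit (G u).det :=
  (h.det_pos hu).ne'.isUnit

theorem symm (h : IsMetric G U) (hu : u ∈ U) (i j : Fin n) : G u i j = G u j i := by
  simpa using (h.posDef u hu).1.apply j i

theorem eventually_mem (h : IsMetric G U) (hu : u ∈ U) : ∀ᶠ w in 𝓝 u, w ∈ U :=
  h.isOpen.mem_nhds hu

theorem pd_symm (h : IsMetric G U) (hu : u ∈ U) (c i j : Fin n) :
    pd c (fun w ↦ G w i j) u = pd c (fun w ↦ G w j i) u :=
  pd_congr ((h.eventually_mem hu).mono fun _ hw ↦ h.symm hw i j) c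

theorem symm_inv (h : IsMetric G U) (hu : u ∈ U) (i j : Fin n) : (G u)⁻¹ i j = (G u)⁻¹ j i := by
  have : ((G u)⁻¹).IsHermitian := (h.posDef u hu).1.inv
  simpa using this.apply j i

theorem smooth_inv (h : IsMetric G U) (hu : u ∈ U) (i j : Fin n) :
    ContDiffAt ℝ ∞ (fun w ↦ (G w)⁻¹ i j) u :=
  contDiffAt_inv (h.smooth u hu) (h.det_pos hu).ne' i j

theorem lower_chr (h : IsMetric G U) (hu : u ∈ U) (i j m : Fin n) :
    ∑ k, G u m k * chr G k i j u = 1 / 2 * (pd i (fun w ↦ G w j m) u + pd j (fun w ↦ G w i m) u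
      - pd m (fun w ↦ G w i j) u) := by
  set F : Fin n → ℝ := fun l ↦ pd i (fun w ↦ G w j l) u + pd j (fun w ↦ G w i l) u
      - pd l (fun w ↦ G w i j) u with hF
  have h1 : ∑ k, G u m k * chr G k i j u = 1 / 2 * ∑ l, (∑ k, G u m k * (G u)⁻¹ k l) * F l := by
    simp only [chr, Finset.mul_sum, Finset.sum_mul]
    rw [Finset.sum_comm]
    exact Finset.sum_congr rfl fun _ _ ↦ Finset.sum_congr rfl fun _ _ ↦ by simp only [hF]; ring
  have h2 (l : Fin n) : ∑ k, G u m k * (G u)⁻¹ k l = (1 : Matrix (Fin n) (Fin n) ℝ) m l := by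
    rw [← Matrix.mul_apply, Matrix.mul_nonsing_inv _ (h.isUnit_det hu)]
  rw [h1]
  simp [h2, Matrix.one_apply, hF]

theorem smooth_chr (h : IsMetric G U) (hu : u ∈ U) (k i j : Fin n) :
    ContDiffAt ℝ ∞ (chr G k i j) u := by
  have h1 := h.smooth u hu
  have h2 := h.smooth_inv hu
  have h3 (a b c : Fin n) : ContDiffAt ℝ ∞ (pd a fun w ↦ G w b c) u := contDiffAt_pd (h1 b c) a
  unfold chr
  exact contDiffAt_const.mul (ContDiffAt.sum fun l _ ↦
    (h2 k l).mul (((h3 _ _ _).add (h3 _ _ _)).sub (h3 _ _ _)))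

theorem symm_chr (h : IsMetric G U) (hu : u ∈ U) (k i j : Fin n) :
    chr G k i j u = chr G k j i u := by
  simp only [chr]
  congr 1
  exact Finset.sum_congr rfl fun l _ ↦ by rw [h.pd_symm hu l i j]; ring

theorem mul_inv (h : IsMetric G U) (hu : u ∈ U) (i j : Fin n) :
    ∑ k, G u i k * (G u)⁻¹ k j = if i = j then 1 else 0 := by
  rw [← Matrix.mul_apply, Matrix.mul_nonsing_inv _ (h.isUnit_det hu), Matrix.one_apply]

/-- In the sum of two lowered Christoffel symbols all derivatives of the metric cancel except twice
the one in direction `c`. -/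
theorem compat (h : IsMetric G U) (hu : u ∈ U) (c i j : Fin n) :
    pd c (fun w ↦ G w i j) u = ∑ l, (chr G l c i u * G u l j + chr G l c j u * G u i l) := by
  have h1 := h.lower_chr hu c i j
  have h2 := h.lower_chr hu c j i
  have e1 : ∑ l, chr G l c i u * G u l j = ∑ l, G u j l * chr G l c i u :=
    Finset.sum_congr rfl fun l _ ↦ by rw [h.symm hu, mul_comm]
  have e2 : ∑ l, chr G l c j u * G u i l = ∑ l, G u i l * chr G l c j u :=
    Finset.sum_congr rfl fun l _ ↦ by rw [mul_comm]
  rw [Finset.sum_add_distrib, e1, e2, h1, h2, h.pd_symm hu c j i]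
  ring

theorem isLeviCivita (h : IsMetric G U) :
    IsLeviCivita (fun i j w ↦ G w i j) (fun i j w ↦ (G w)⁻¹ i j) (chr G) U where
  isOpen := h.isOpen
  smooth := h.smooth
  smooth_inv _ hu := h.smooth_inv hu
  smooth_chr _ hu := h.smooth_chr hu
  symm _ hu := h.symm hu
  symm_inv _ hu := h.symm_inv hu
  symm_chr _ hu := h.symm_chr hu
  mul_inv _ hu := h.mul_inv hu
  compat _ hu := h.compat hu

theorem smooth_sqrt_det (h : IsMetric G U) (hu : u ∈ U) :
    ContDiffAt ℝ ∞ (fun w ↦ Real.sqrt (G w).det) u :=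
  (contDiffAt_det (h.smooth u hu)).sqrt (h.det_pos hu).ne'

/-- Differentiating `√det · √det = det` reduces this to `pd_det` and `contract_pd`. Its purpose is
that `√det g` times a divergence becomes a sum of ordinary partial derivatives. -/
theorem pd_sqrt_det (h : IsMetric G U) (hu : u ∈ U) (c : Fin n) :
    pd c (fun w ↦ Real.sqrt (G w).det) u = Real.sqrt (G u).det * ∑ k, chr G k k c u := by
  have hs := h.smooth_sqrt_det hu
  have hpos := Real.sqrt_pos.2 (h.det_pos hu)
  have h1 : pd c (fun w ↦ (G w).det) u =
      2 * Real.sqrt (G u).det * pd c (fun w ↦ Real.sqrt (G w).det) u := by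
    have : (fun w ↦ (G w).det) =ᶠ[𝓝 u] fun w ↦ Real.sqrt (G w).det * Real.sqrt (G w).det :=
      (h.eventually_mem hu).mono fun w hw ↦ (Real.mul_self_sqrt (h.det_pos hw).le).symm
    rw [pd_congr this, pd_mul hs hs]
    ring
  have h2 := pd_det (h.smooth u hu) (h.isUnit_det hu) c
  have h4 : ∑ i, ∑ j, (G u)⁻¹ i j * pd c (fun w ↦ G w j i) u = 2 * ∑ k, chr G k k c u := by
    rw [← h.isLeviCivita.contract_pd hu c]
    exact Finset.sum_congr rfl fun i _ ↦ Finset.sum_congr rfl fun j _ ↦ by rw [h.pd_symm hu]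
  have h5 : Real.sqrt (G u).det * Real.sqrt (G u).det = (G u).det :=
    Real.mul_self_sqrt (h.det_pos hu).le
  rw [h1, h4] at h2
  refine mul_left_cancel₀ (show 2 * Real.sqrt (G u).det ≠ 0 by positivity) ?_
  rw [h2]
  linear_combination (-2 * ∑ k, chr G k k c u) * h5

end IsMetric

/-- The factor `e^{2ρ}` in the derivatives of the metric cancels against `e^{-2ρ}` in the inverse,
so only the derivatives of the exponent leave a trace. -/
theorem IsMetric.chr_conformal {G : Eu n → Matrix (Fin n) (Fin n) ℝ} {U : Set (Eu n)} {u : Eu n}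
    (h : IsMetric G U) (hu : u ∈ U) {ρ : Eu n → ℝ} (hρ : ContDiffAt ℝ ∞ ρ u) (k i j : Fin n) :
    chr (fun w ↦ Real.exp (2 * ρ w) • G w) k i j u =
      conformalChr (fun i j w ↦ G w i j) (fun i j w ↦ (G w)⁻¹ i j) (chr G) ρ k i j u := by
  have hG := h.smooth u hu
  have hL := h.isLeviCivita
  have hinv : (Real.exp (2 * ρ u) • G u)⁻¹ = (Real.exp (2 * ρ u))⁻¹ • (G u)⁻¹ := by
    have : Invertible (Real.exp (2 * ρ u)) := invertibleOfNonzero (Real.exp_pos _).ne'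
    rw [Matrix.inv_smul _ _ (h.isUnit_det hu), invOf_eq_inv]
  have hpd (a b c : Fin n) : pd a (fun w ↦ (Real.exp (2 * ρ w) • G w) b c) u =
      Real.exp (2 * ρ u) * (2 * pd a ρ u * G u b c + pd a (fun w ↦ G w b c) u) := by
    simp only [Matrix.smul_apply, smul_eq_mul]
    rw [pd_mul (by fun_prop) (hG _ _), pd_exp hρ]
    ring
  have hterm (l : Fin n) : (Real.exp (2 * ρ u) • G u)⁻¹ k l *
      (pd i (fun w ↦ (Real.exp (2 * ρ w) • G w) j l) u
        + pd j (fun w ↦ (Real.exp (2 * ρ w) • G w) i l) u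
        - pd l (fun w ↦ (Real.exp (2 * ρ w) • G w) i j) u) =
      (G u)⁻¹ k l * (pd i (fun w ↦ G w j l) u + pd j (fun w ↦ G w i l) u
        - pd l (fun w ↦ G w i j) u)
      + 2 * (pd i ρ u * ((G u)⁻¹ k l * G u l j) + pd j ρ u * ((G u)⁻¹ k l * G u l i)
        - G u i j * ((G u)⁻¹ k l * pd l ρ u)) := by
    rw [hinv, hpd, hpd, hpd, Matrix.smul_apply, smul_eq_mul, h.symm hu j l, h.symm hu i l]
    have : (Real.exp (2 * ρ u))⁻¹ * Real.exp (2 * ρ u) = 1 :=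
      inv_mul_cancel₀ (Real.exp_pos _).ne'
    linear_combination ((G u)⁻¹ k l * ((2 * pd i ρ u * G u l j + pd i (fun w ↦ G w j l) u)
      + (2 * pd j ρ u * G u l i + pd j (fun w ↦ G w i l) u)
      - (2 * pd l ρ u * G u i j + pd l (fun w ↦ G w i j) u))) * this
  have e1 := hL.inv_mul hu k j
  have e2 := hL.inv_mul hu k i
  unfold chr
  simp only [hterm]
  simp only [Finset.sum_add_distrib, Finset.sum_sub_distrib, ← Finset.mul_sum, conformalChr,
    gradVec]
  rw [e1, e2]
  split_ifs <;> ring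

/-- Each Kronecker term contributes one copy of `grad ρ`, and the trace `gⁱʲ gᵢⱼ = n` subtracts `n`
copies; this is the origin of `2 - n`. -/
theorem IsLeviCivita.contract_conformal_difference {g gi : Fin n → Fin n → Eu n → ℝ}
    {Γ : Fin n → Fin n → Fin n → Eu n → ℝ} {U : Set (Eu n)} {u : Eu n}
    (h : IsLeviCivita g gi Γ U) (hu : u ∈ U) (ρ : Eu n → ℝ) (k : Fin n) :
    ∑ i, ∑ j, gi i j u * (conformalChr g gi Γ ρ k i j u - Γ k i j u) =
      conformalTension gi ρ k u := by
  have t3 : ∑ i, ∑ j, gi i j u * g i j u = n := by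
    have (i : Fin n) : ∑ j, gi i j u * g i j u = 1 := by
      have := h.inv_mul hu i i
      simp only [if_true] at this
      rw [← this]
      exact Finset.sum_congr rfl fun j _ ↦ by rw [h.symm u hu]
    simp [this]
  simp only [conformalChr, add_sub_cancel_left, mul_sub, mul_add, Finset.sum_sub_distrib,
    Finset.sum_add_distrib, mul_ite, mul_zero]
  have e1 : ∑ i, ∑ j, (if k = i then gi i j u * pd j ρ u else 0) = gradVec gi ρ k u := by
    rw [Finset.sum_comm]
    simp [gradVec]
  have e2 : ∑ i, ∑ j, (if k = j then gi i j u * pd i ρ u else 0) = gradVec gi ρ k u := by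
    simp only [Finset.sum_ite_eq, Finset.mem_univ, if_true, gradVec]
    exact Finset.sum_congr rfl fun j _ ↦ by rw [h.symm_inv u hu]
  have e3 : ∑ i, ∑ j, gi i j u * (g i j u * gradVec gi ρ k u) = n * gradVec gi ρ k u := by
    rw [← t3, Finset.sum_mul]
    refine Finset.sum_congr rfl fun i _ ↦ ?_
    rw [Finset.sum_mul]
    exact Finset.sum_congr rfl fun j _ ↦ by ring
  rw [e1, e2, e3, conformalTension]
  ring

end MatrixMetric

/-! ### Integration by parts on open subsets of `ℝⁿ` -/

section IntegrationByParts

variable {n : ℕ} {U C : Set (Eu n)}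

theorem integrableOn_of_eq_zero_off_compact {f : Eu n → ℝ} (hU : IsOpen U)
    (hf : ContinuousOn f U) (hC : IsCompact C) (hCU : C ⊆ U) (h0 : ∀ u ∈ U, u ∉ C → f u = 0) :
    IntegrableOn f U := by
  have h1 : IntegrableOn f C := (hf.mono hCU).integrableOn_compact hC
  exact h1.of_forall_sdiff_eq_zero hU.measurableSet fun u hu ↦ h0 u hu.1 hu.2

/-- Extension by zero is smooth on the whole space, since `U` and the complement of `C` are open and
cover it. The extension has compact support, and integration by parts against the constant `1` gives
the claim. -/
theorem setIntegral_pd_eq_zero {f : Eu n → ℝ} (hU : IsOpen U)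
    (hf : ∀ u ∈ U, ContDiffAt ℝ ∞ f u) (hC : IsCompact C) (hCU : C ⊆ U)
    (h0 : ∀ u ∈ U, u ∉ C → f u = 0) (i : Fin n) : ∫ u in U, pd i f u = 0 := by
  classical
  let F : Eu n → ℝ := U.indicator f
  have hFU (u : Eu n) (hu : u ∈ U) : F =ᶠ[𝓝 u] f :=
    (show ∀ᶠ w in 𝓝 u, w ∈ U from hU.mem_nhds hu).mono fun w hw ↦ indicator_of_mem hw f
  have hFC (u : Eu n) (hu : u ∉ C) : F =ᶠ[𝓝 u] fun _ ↦ 0 :=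
    (show ∀ᶠ w in 𝓝 u, w ∈ Cᶜ from hC.isClosed.isOpen_compl.mem_nhds hu).mono fun w hw ↦ by
      by_cases hwU : w ∈ U
      · simp [F, hwU, h0 w hwU hw]
      · simp [F, hwU]
  have hF : ContDiff ℝ ∞ F := contDiff_iff_contDiffAt.2 fun u ↦ by
    by_cases hu : u ∈ U
    · exact (hf u hu).congr_of_eventuallyEq (hFU u hu)
    · exact contDiffAt_const.congr_of_eventuallyEq (hFC u fun h ↦ hu (hCU h))
  have hcF : HasCompactSupport F := HasCompactSupport.intro hC fun u hu ↦ (hFC u hu).eq_of_nhds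
  have hpF : Continuous (pd i F) :=
    (contDiff_iff_contDiffAt.2 fun u ↦ contDiffAt_pd hF.contDiffAt i).continuous
  have hcpF : HasCompactSupport (pd i F) := HasCompactSupport.intro hC fun u hu ↦ by
    rw [pd_congr (hFC u hu), pd_const]
  have e1 : ∫ u in U, pd i f u = ∫ u in U, pd i F u :=
    setIntegral_congr_fun hU.measurableSet fun u hu ↦ (pd_congr (hFU u hu) i).symm
  have e2 : ∫ u in U, pd i F u = ∫ u, pd i F u :=
    setIntegral_eq_integral_of_forall_compl_eq_zero fun u hu ↦ by
      rw [pd_congr (hFC u fun h ↦ hu (hCU h)), pd_const]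
  have e3 := integral_mul_fderiv_eq_neg_fderiv_mul_of_integrable (𝕜 := ℝ) (μ := volume)
    (f := fun _ : Eu n ↦ (1 : ℝ)) (g := F) (v := EuclideanSpace.single i 1)
    (by simp) (by simpa using! hpF.integrable_of_hasCompactSupport hcpF)
    (by simpa using hF.continuous.integrable_of_hasCompactSupport hcF)
    (fun _ _ ↦ differentiableAt_const _) (fun u _ ↦ hF.differentiable (by simp) u)
  rw [e1, e2]
  simpa using! e3

namespace IsMetric

variable {G : Eu n → Matrix (Fin n) (Fin n) ℝ}

/-- The divergence theorem without boundary term: by `pd_sqrt_det` the integrand is `∑ᵢ ∂ᵢ(√det G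
Xⁱ)`. -/
theorem setIntegral_divergence_eq_zero (h : IsMetric G U) (hC : IsCompact C) (hCU : C ⊆ U)
    {X : Fin n → Eu n → ℝ} (hX : ∀ u ∈ U, ∀ i, ContDiffAt ℝ ∞ (X i) u)
    (h0 : ∀ u ∈ U, u ∉ C → ∀ i, X i u = 0) :
    ∫ u in U, divergence (chr G) X u * Real.sqrt (G u).det = 0 := by
  have hs : ∀ u ∈ U, ∀ i, ContDiffAt ℝ ∞ (fun w ↦ Real.sqrt (G w).det * X i w) u :=
    fun u hu i ↦ (h.smooth_sqrt_det hu).mul (hX u hu i)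
  have e1 : ∀ u ∈ U, divergence (chr G) X u * Real.sqrt (G u).det =
      ∑ i, pd i (fun w ↦ Real.sqrt (G w).det * X i w) u := fun u hu ↦ by
    simp only [divergence, Finset.sum_mul]
    refine Finset.sum_congr rfl fun i _ ↦ ?_
    rw [pd_mul (h.smooth_sqrt_det hu) (hX u hu i), h.pd_sqrt_det hu, ← Finset.sum_mul]
    ring
  rw [setIntegral_congr_fun h.isOpen.measurableSet e1, integral_finsetSum]
  · exact Finset.sum_eq_zero fun i _ ↦
      setIntegral_pd_eq_zero h.isOpen (fun u hu ↦ hs u hu i) hC hCU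
        (fun u hu hu' ↦ by simp [h0 u hu hu']) i
  · intro i _
    refine integrableOn_of_eq_zero_off_compact h.isOpen (fun u hu ↦
      (contDiffAt_pd (hs u hu i) i).continuousAt.continuousWithinAt) hC hCU fun u hu hu' ↦ ?_
    have : (fun w ↦ Real.sqrt (G w).det * X i w) =ᶠ[𝓝 u] fun _ ↦ 0 := by
      filter_upwards [h.isOpen.mem_nhds hu, hC.isClosed.isOpen_compl.mem_nhds hu'] with w hw hw'
      simp [h0 w hw hw']
    rw [pd_congr this, pd_const]

theorem setIntegral_firstVariation (h : IsMetric G U) (hC : IsCompact C) (hCU : C ⊆ U)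
    {g' : Fin n → Fin n → Eu n → ℝ} {Γ' : Fin n → Fin n → Fin n → Eu n → ℝ}
    {τ η V : Fin n → Eu n → ℝ}
    (hg' : ∀ u ∈ U, ∀ i j, ContDiffAt ℝ ∞ (g' i j) u)
    (hΓ' : ∀ u ∈ U, ∀ k i j, ContDiffAt ℝ ∞ (Γ' k i j) u)
    (hτ : ∀ u ∈ U, ∀ k, ContDiffAt ℝ ∞ (τ k) u) (hη : ∀ u ∈ U, ∀ k, ContDiffAt ℝ ∞ (η k) u)
    (hV : ∀ u ∈ U, ∀ k, ContDiffAt ℝ ∞ (V k) u) (h0 : ∀ u ∈ U, u ∉ C → ∀ k, V k u = 0) :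
    ∫ u in U, firstVariation (fun i j w ↦ (G w)⁻¹ i j) (chr G) g' Γ' τ η V u *
        Real.sqrt (G u).det =
      ∫ u in U, (∑ c, eulerLagrange (fun i j w ↦ (G w)⁻¹ i j) (chr G) g' Γ' τ η c u * V c u) *
        Real.sqrt (G u).det := by
  have hL := h.isLeviCivita
  set gi : Fin n → Fin n → Eu n → ℝ := fun i j w ↦ (G w)⁻¹ i j with hgi
  have hB : ∀ u ∈ U, ∀ i, ContDiffAt ℝ ∞ (fun w ↦ ∑ j, gi i j w * boundaryForm Γ' η V j w) u := by
    intro u hu i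
    have h1 := hL.smooth_inv u hu
    have h2 := hΓ' u hu
    have h3 := hη u hu
    have h4 := hV u hu
    unfold boundaryForm
    fun_prop
  have hpd0 : ∀ u ∈ U, u ∉ C → ∀ j k, pd j (V k) u = 0 := fun u hu hu' j k ↦ by
    have : V k =ᶠ[𝓝 u] fun _ ↦ 0 := by
      filter_upwards [h.isOpen.mem_nhds hu, hC.isClosed.isOpen_compl.mem_nhds hu'] with w hw hw'
      exact h0 w hw hw' k
    rw [pd_congr this, pd_const]
  have hB0 : ∀ u ∈ U, u ∉ C → ∀ i, ∑ j, gi i j u * boundaryForm Γ' η V j u = 0 :=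
    fun u hu hu' i ↦ by simp [boundaryForm, h0 u hu hu', hpd0 u hu hu']
  have hdiv := h.setIntegral_divergence_eq_zero hC hCU hB hB0
  have hE : IntegrableOn (fun u ↦ (∑ c, eulerLagrange gi (chr G) g' Γ' τ η c u * V c u) *
      Real.sqrt (G u).det) U := by
    refine integrableOn_of_eq_zero_off_compact h.isOpen (fun u hu ↦ ?_) hC hCU fun u hu hu' ↦ by
      simp [h0 u hu hu']
    have h1 := hL.smooth_inv u hu
    have h2 := hΓ' u hu
    have h3 := hη u hu
    have h4 := hV u hu
    have h5 := hL.smooth_chr u hu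
    have h6 := hg' u hu
    have h7 := hτ u hu
    have h8 := h.smooth_sqrt_det hu
    refine ContDiffAt.continuousAt (𝕜 := ℝ) (n := ∞) ?_ |>.continuousWithinAt
    refine ContDiffAt.mul ?_ h8
    unfold eulerLagrange divergence
    fun_prop
  have hD : IntegrableOn (fun u ↦
      divergence (chr G) (fun i w ↦ ∑ j, gi i j w * boundaryForm Γ' η V j w) u *
      Real.sqrt (G u).det) U := by
    refine integrableOn_of_eq_zero_off_compact h.isOpen (fun u hu ↦ ?_) hC hCU fun u hu hu' ↦ ?_
    · have h1 := hB u hu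
      have h5 := hL.smooth_chr u hu
      have h8 := h.smooth_sqrt_det hu
      refine ContDiffAt.continuousAt (𝕜 := ℝ) (n := ∞) ?_ |>.continuousWithinAt
      refine ContDiffAt.mul ?_ h8
      unfold divergence
      refine ContDiffAt.sum fun i _ ↦ (contDiffAt_pd (h1 i) i).add
        ((ContDiffAt.sum fun k _ ↦ h5 k k i).mul (h1 i))
    · have : ∀ i, (fun w ↦ ∑ j, gi i j w * boundaryForm Γ' η V j w) =ᶠ[𝓝 u] fun _ ↦ 0 := fun i ↦ by
        filter_upwards [h.isOpen.mem_nhds hu, hC.isClosed.isOpen_compl.mem_nhds hu'] with w hw hw'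
        exact hB0 w hw hw' i
      rw [divergence_congr this]
      simp [divergence]
  have e1 : ∀ u ∈ U, firstVariation gi (chr G) g' Γ' τ η V u * Real.sqrt (G u).det =
      (∑ c, eulerLagrange gi (chr G) g' Γ' τ η c u * V c u) * Real.sqrt (G u).det
      + divergence (chr G) (fun i w ↦ ∑ j, gi i j w * boundaryForm Γ' η V j w) u *
        Real.sqrt (G u).det := fun u hu ↦ by
    rw [hL.firstVariation_eq hu (hΓ' u hu) (hη u hu) (hV u hu), add_mul]
  rw [setIntegral_congr_fun h.isOpen.measurableSet e1, integral_add hE hD, hdiv, add_zero]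

end IsMetric

end IntegrationByParts

/-! ### The bienergy density of a family of maps between open subsets of `ℝⁿ` -/

section DirectionalDerivative

variable {E : Type*} [NormedAddCommGroup E] [NormedSpace ℝ E]

/-- The directional derivative, as a function of the point. -/
def dirDeriv (v : E) (f : E → ℝ) (q : E) : ℝ := fderiv ℝ f q v

@[fun_prop] theorem contDiffAt_dirDeriv {f : E → ℝ} {q : E} (hf : ContDiffAt ℝ ∞ f q) (v : E) :
    ContDiffAt ℝ ∞ (dirDeriv v f) q :=
  (hf.fderiv_right (m := ∞) le_rfl).clm_apply contDiffAt_const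

theorem dirDeriv_comm {f : E → ℝ} {q : E} (hf : ContDiffAt ℝ ∞ f q) (v w : E) :
    dirDeriv v (dirDeriv w f) q = dirDeriv w (dirDeriv v f) q := by
  have hd : DifferentiableAt ℝ (fderiv ℝ f) q :=
    (hf.fderiv_right (m := ∞) le_rfl).differentiableAt (by simp)
  have key (a b : E) : dirDeriv a (dirDeriv b f) q = fderiv ℝ (fderiv ℝ f) q a b := by
    change fderiv ℝ (fun w ↦ fderiv ℝ f w b) q _ = _
    rw [fderiv_clm_apply hd (differentiableAt_const _)]
    simp
  rw [key, key]
  exact (hf.isSymmSndFDerivAt (by simp; norm_cast)).eq _ _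

end DirectionalDerivative

/-! ### Derivatives of functions of time and position. -/

section Slices

variable {n : ℕ}

/-- The spatial partial derivative of a function of `(t, u)`. -/
abbrev spaceDeriv (i : Fin n) (f : ℝ × Eu n → ℝ) : ℝ × Eu n → ℝ :=
  dirDeriv (0, EuclideanSpace.single i 1) f

/-- The time derivative of a function of `(t, u)`. -/
abbrev timeDeriv (f : ℝ × Eu n → ℝ) : ℝ × Eu n → ℝ := dirDeriv (1, 0) f

theorem pd_slice {f : ℝ × Eu n → ℝ} {q : ℝ × Eu n} (hf : ContDiffAt ℝ ∞ f q) (i : Fin n) :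
    pd i (fun u ↦ f (q.1, u)) q.2 = spaceDeriv i f q := by
  have h1 : HasFDerivAt (fun u : Eu n ↦ (q.1, u)) (ContinuousLinearMap.inr ℝ ℝ (Eu n)) q.2 :=
    hasFDerivAt_prodMk_right q.1 q.2
  have h2 : HasFDerivAt f (fderiv ℝ f q) (q.1, q.2) :=
    (hf.differentiableAt (by simp)).hasFDerivAt
  have h3 := (h2.comp q.2 h1).fderiv
  simp only [pd, dirDeriv]
  change fderiv ℝ (f ∘ fun u ↦ (q.1, u)) q.2 _ = _
  rw [h3]
  simp

theorem hasDerivAt_slice {f : ℝ × Eu n → ℝ} {q : ℝ × Eu n} (hf : ContDiffAt ℝ ∞ f q) :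
    HasDerivAt (fun t ↦ f (t, q.2)) (timeDeriv f q) q.1 := by
  have h1 : HasFDerivAt (fun t : ℝ ↦ (t, q.2)) (ContinuousLinearMap.inl ℝ ℝ (Eu n)) q.1 :=
    hasFDerivAt_prodMk_left q.1 q.2
  have h2 : HasFDerivAt f (fderiv ℝ f q) (q.1, q.2) :=
    (hf.differentiableAt (by simp)).hasFDerivAt
  have h3 := (h2.comp q.1 h1).hasDerivAt
  simpa [dirDeriv] using! h3

variable {O : Set (ℝ × Eu n)}

theorem slice_mem_nhds (hO : IsOpen O) {q : ℝ × Eu n} (hq : q ∈ O) :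
    ∀ᶠ u in 𝓝 q.2, (q.1, u) ∈ O :=
  (Continuous.prodMk_right q.1).continuousAt.eventually_mem (hO.mem_nhds hq)

theorem pd_pd_slice {f : ℝ × Eu n → ℝ} (hO : IsOpen O) (hf : ∀ q ∈ O, ContDiffAt ℝ ∞ f q)
    {q : ℝ × Eu n} (hq : q ∈ O) (i j : Fin n) :
    pd i (pd j fun u ↦ f (q.1, u)) q.2 = spaceDeriv i (spaceDeriv j f) q := by
  rw [← pd_slice (contDiffAt_dirDeriv (hf q hq) _)]
  refine pd_congr ?_ i
  filter_upwards [slice_mem_nhds hO hq] with u hu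
  exact pd_slice (hf _ hu) j

theorem timeDeriv_spaceDeriv {f : ℝ × Eu n → ℝ} {q : ℝ × Eu n} (hf : ContDiffAt ℝ ∞ f q)
    (i : Fin n) : timeDeriv (spaceDeriv i f) q = pd i (fun u ↦ timeDeriv f (q.1, u)) q.2 := by
  -- Smoothness in `(t, u)` jointly is what allows time and space derivatives to be exchanged.
  rw [pd_slice (contDiffAt_dirDeriv hf _), timeDeriv, dirDeriv_comm hf]

theorem timeDeriv_spaceDeriv_spaceDeriv {f : ℝ × Eu n → ℝ} (hO : IsOpen O)
    (hf : ∀ q ∈ O, ContDiffAt ℝ ∞ f q) {q : ℝ × Eu n} (hq : q ∈ O) (i j : Fin n) :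
    timeDeriv (spaceDeriv i (spaceDeriv j f)) q =
      pd i (pd j fun u ↦ timeDeriv f (q.1, u)) q.2 := by
  rw [timeDeriv_spaceDeriv (contDiffAt_dirDeriv (hf q hq) _)]
  refine pd_congr ?_ i
  filter_upwards [slice_mem_nhds hO hq] with u hu
  exact timeDeriv_spaceDeriv (hf _ hu) j

end Slices

/-! ### The tension field in coordinates and its derivative along a family of maps. -/

section EnergyDensity

variable {n : ℕ}

/-- The components of the second fundamental form of a map between open subsets of `ℝⁿ`. -/
def secondForm (G G' : Eu n → Matrix (Fin n) (Fin n) ℝ) (F : Eu n → Eu n) (k i j : Fin n)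
    (u : Eu n) : ℝ :=
  pd i (pd j fun w ↦ F w k) u - ∑ l, chr G l i j u * pd l (fun w ↦ F w k) u
    + ∑ a, ∑ b, chr G' k a b (F u) * pd i (fun w ↦ F w a) u * pd j (fun w ↦ F w b) u

/-- The components of the tension field of a map between open subsets of `ℝⁿ`. -/
def tensionComp (G G' : Eu n → Matrix (Fin n) (Fin n) ℝ) (F : Eu n → Eu n) (k : Fin n)
    (u : Eu n) : ℝ :=
  ∑ i, ∑ j, (G u)⁻¹ i j * secondForm G G' F k i j u

/-- The squared norm of the tension field. -/
def tensionSq (G G' : Eu n → Matrix (Fin n) (Fin n) ℝ) (F : Eu n → Eu n) (u : Eu n) : ℝ :=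
  ∑ k, ∑ l, G' (F u) k l * (tensionComp G G' F k u * tensionComp G G' F l u)

/-- The tension field of the identity map. -/
def idTension (G G' : Eu n → Matrix (Fin n) (Fin n) ℝ) (k : Fin n) (u : Eu n) : ℝ :=
  ∑ i, ∑ j, (G u)⁻¹ i j * (chr G' k i j u - chr G k i j u)

/-- The covector field dual to the tension field of the identity map. -/
def idTensionForm (G G' : Eu n → Matrix (Fin n) (Fin n) ℝ) (k : Fin n) (u : Eu n) : ℝ :=
  ∑ l, G' u k l * idTension G G' l u

variable {G G' : Eu n → Matrix (Fin n) (Fin n) ℝ} {U U' : Set (Eu n)} {O : Set (ℝ × Eu n)}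
  {F : ℝ × Eu n → Eu n}

theorem pd_coord (i a : Fin n) (u : Eu n) : pd i (fun w ↦ w a) u = if i = a then 1 else 0 := by
  simp only [pd]
  rw [show (fun w : Eu n ↦ w a) = (EuclideanSpace.proj (𝕜 := ℝ) a : Eu n →L[ℝ] ℝ) from rfl,
    ContinuousLinearMap.fderiv]
  simp [eq_comm]

theorem secondForm_slice (hO : IsOpen O) (hF : ∀ q ∈ O, ContDiffAt ℝ ∞ F q) {q : ℝ × Eu n}
    (hq : q ∈ O) (k i j : Fin n) :
    secondForm G G' (fun u ↦ F (q.1, u)) k i j q.2 =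
      spaceDeriv i (spaceDeriv j fun q ↦ F q k) q
        - ∑ l, chr G l i j q.2 * spaceDeriv l (fun q ↦ F q k) q
        + ∑ a, ∑ b, chr G' k a b (F q) * spaceDeriv i (fun q ↦ F q a) q *
          spaceDeriv j (fun q ↦ F q b) q := by
  have hk (k : Fin n) : ∀ q ∈ O, ContDiffAt ℝ ∞ (fun q ↦ F q k) q :=
    fun q hq ↦ contDiffAt_apply (hF q hq) k
  simp only [secondForm]
  rw [pd_pd_slice (f := fun q ↦ F q k) hO (hk k) hq]
  simp only [pd_slice (f := fun q ↦ F q _) (hk _ q hq)]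

theorem contDiffAt_tensionComp (hG : IsMetric G U) (hG' : IsMetric G' U') (hO : IsOpen O)
    (hF : ∀ q ∈ O, ContDiffAt ℝ ∞ F q) (hOU : ∀ q ∈ O, q.2 ∈ U) (hOU' : ∀ q ∈ O, F q ∈ U')
    {q : ℝ × Eu n} (hq : q ∈ O) (k : Fin n) :
    ContDiffAt ℝ ∞ (fun q : ℝ × Eu n ↦ tensionComp G G' (fun u ↦ F (q.1, u)) k q.2) q := by
  have hk (k : Fin n) : ContDiffAt ℝ ∞ (fun q ↦ F q k) q := contDiffAt_apply (hF q hq) k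
  have h1 (i j : Fin n) : ContDiffAt ℝ ∞ (fun q : ℝ × Eu n ↦ (G q.2)⁻¹ i j) q :=
    (hG.smooth_inv (hOU q hq) i j).comp q contDiffAt_snd
  have h2 (l i j : Fin n) : ContDiffAt ℝ ∞ (fun q : ℝ × Eu n ↦ chr G l i j q.2) q :=
    (hG.smooth_chr (hOU q hq) l i j).comp q contDiffAt_snd
  have h3 (l i j : Fin n) : ContDiffAt ℝ ∞ (fun q : ℝ × Eu n ↦ chr G' l i j (F q)) q :=
    (hG'.smooth_chr (hOU' q hq) l i j).comp q (hF q hq)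
  have : (fun q : ℝ × Eu n ↦ tensionComp G G' (fun u ↦ F (q.1, u)) k q.2) =ᶠ[𝓝 q]
      fun q ↦ ∑ i, ∑ j, (G q.2)⁻¹ i j * (spaceDeriv i (spaceDeriv j fun q ↦ F q k) q
        - ∑ l, chr G l i j q.2 * spaceDeriv l (fun q ↦ F q k) q
        + ∑ a, ∑ b, chr G' k a b (F q) * spaceDeriv i (fun q ↦ F q a) q *
          spaceDeriv j (fun q ↦ F q b) q) := by
    filter_upwards [hO.mem_nhds hq] with p hp
    simp only [tensionComp, secondForm_slice hO hF hp]
  have h4 (i k : Fin n) : ContDiffAt ℝ ∞ (spaceDeriv i fun q ↦ F q k) q :=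
    contDiffAt_dirDeriv (hk k) _
  refine ContDiffAt.congr_of_eventuallyEq ?_ this
  exact ContDiffAt.sum fun i _ ↦ ContDiffAt.sum fun j _ ↦ (h1 i j).mul
    (((contDiffAt_dirDeriv (h4 j k) _).sub (ContDiffAt.sum fun l _ ↦ (h2 l i j).mul (h4 l k))).add
      (ContDiffAt.sum fun a _ ↦ ContDiffAt.sum fun b _ ↦
        ((h3 k a b).mul (h4 i a)).mul (h4 j b)))

theorem contDiffAt_tensionSq (hG : IsMetric G U) (hG' : IsMetric G' U') (hO : IsOpen O)
    (hF : ∀ q ∈ O, ContDiffAt ℝ ∞ F q) (hOU : ∀ q ∈ O, q.2 ∈ U) (hOU' : ∀ q ∈ O, F q ∈ U')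
    {q : ℝ × Eu n} (hq : q ∈ O) :
    ContDiffAt ℝ ∞ (fun q : ℝ × Eu n ↦ tensionSq G G' (fun u ↦ F (q.1, u)) q.2) q := by
  have h1 := contDiffAt_tensionComp hG hG' hO hF hOU hOU' hq
  have h2 (k l : Fin n) : ContDiffAt ℝ ∞ (fun q : ℝ × Eu n ↦ G' (F q) k l) q :=
    (hG'.smooth _ (hOU' q hq) k l).comp q (hF q hq)
  exact ContDiffAt.sum fun k _ ↦ ContDiffAt.sum fun l _ ↦ (h2 k l).mul ((h1 k).mul (h1 l))

theorem hasDerivAt_comp_curve {f : Eu n → ℝ} {γ : ℝ → Eu n} {t : ℝ} {v : Fin n → ℝ}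
    (hf : ContDiffAt ℝ ∞ f (γ t)) (hγ : ∀ c, HasDerivAt (fun s ↦ γ s c) (v c) t) :
    HasDerivAt (fun s ↦ f (γ s)) (∑ c, pd c f (γ t) * v c) t := by
  have h1 : HasDerivAt γ (WithLp.toLp 2 v) t := by
    rw [← hasDerivWithinAt_univ, hasDerivWithinAt_iff_hasFDerivWithinAt,
      hasFDerivWithinAt_euclidean]
    exact fun c ↦ ((hγ c).hasFDerivAt.congr_fderiv (by ext; simp)).hasFDerivWithinAt
  have := (differentiableAt_of_smooth hf).hasFDerivAt.comp_hasDerivAt t h1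
  rw [fderiv_eq_sum_pd] at this
  convert! this using 1
  exact Finset.sum_congr rfl fun c _ ↦ mul_comm _ _

/-- At `t = 0` the Jacobian of the map is the identity matrix. The product rule for `Γ'(F) ∂F ∂F`
then gives one term with the derivative of `Γ'` and two terms linear in `∂V`; the latter coincide
after contraction, by the symmetry of `Γ'` and of `gⁱʲ`, hence the factor `2`. -/
theorem hasDerivAt_tensionComp (hG : IsMetric G U) (hG' : IsMetric G' U) (hO : IsOpen O)
    (hF : ∀ q ∈ O, ContDiffAt ℝ ∞ F q) (hOU : ∀ q ∈ O, q.2 ∈ U)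
    (hid : ∀ u, (0, u) ∈ O → F (0, u) = u) {u : Eu n} (hu : (0, u) ∈ O) (k : Fin n) :
    HasDerivAt (fun t ↦ tensionComp G G' (fun w ↦ F (t, w)) k u)
      (∑ i, ∑ j, (G u)⁻¹ i j * (pd i (pd j fun w ↦ timeDeriv (fun q ↦ F q k) (0, w)) u
        - ∑ l, chr G l i j u * pd l (fun w ↦ timeDeriv (fun q ↦ F q k) (0, w)) u
        + ∑ c, pd c (chr G' k i j) u * timeDeriv (fun q ↦ F q c) (0, u)
        + 2 * ∑ a, chr G' k a j u * pd i (fun w ↦ timeDeriv (fun q ↦ F q a) (0, w)) u)) 0 := by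
  have huU : u ∈ U := hOU _ hu
  have hk (k : Fin n) : ∀ q ∈ O, ContDiffAt ℝ ∞ (fun q ↦ F q k) q :=
    fun q hq ↦ contDiffAt_apply (hF q hq) k
  set V : Fin n → Eu n → ℝ := fun k w ↦ timeDeriv (fun q ↦ F q k) (0, w) with hV
  have hev : ∀ᶠ t in 𝓝 (0 : ℝ), (t, u) ∈ O :=
    (Continuous.prodMk_left u).continuousAt.eventually_mem (hO.mem_nhds hu)
  have heq : (fun t ↦ tensionComp G G' (fun w ↦ F (t, w)) k u) =ᶠ[𝓝 0] fun t ↦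
      ∑ i, ∑ j, (G u)⁻¹ i j * (spaceDeriv i (spaceDeriv j fun q ↦ F q k) (t, u)
        - ∑ l, chr G l i j u * spaceDeriv l (fun q ↦ F q k) (t, u)
        + ∑ a, ∑ b, chr G' k a b (F (t, u)) * spaceDeriv i (fun q ↦ F q a) (t, u) *
          spaceDeriv j (fun q ↦ F q b) (t, u)) := by
    filter_upwards [hev] with t ht
    simp only [tensionComp, secondForm_slice hO hF ht]
  have d2 (i j : Fin n) : HasDerivAt (fun t ↦ spaceDeriv i (spaceDeriv j fun q ↦ F q k) (t, u))
      (pd i (pd j (V k)) u) 0 := by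
    have := hasDerivAt_slice (q := (0, u)) (contDiffAt_dirDeriv (contDiffAt_dirDeriv (hk k _ hu)
      (0, EuclideanSpace.single j 1)) (0, EuclideanSpace.single i 1))
    rwa [timeDeriv_spaceDeriv_spaceDeriv hO (hk k) hu] at this
  have d1 (a i : Fin n) : HasDerivAt (fun t ↦ spaceDeriv i (fun q ↦ F q a) (t, u))
      (pd i (V a) u) 0 := by
    have := hasDerivAt_slice (q := (0, u)) (contDiffAt_dirDeriv (hk a _ hu)
      (0, EuclideanSpace.single i 1))
    rwa [timeDeriv_spaceDeriv (hk a _ hu)] at this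
  have d0 (c : Fin n) : HasDerivAt (fun t ↦ F (t, u) c) (V c u) 0 :=
    hasDerivAt_slice (q := (0, u)) (hk c _ hu)
  have dΓ (a b : Fin n) : HasDerivAt (fun t ↦ chr G' k a b (F (t, u)))
      (∑ c, pd c (chr G' k a b) u * V c u) 0 := by
    have hF0 : F (0, u) = u := hid u hu
    have := hasDerivAt_comp_curve (f := chr G' k a b) (γ := fun t ↦ F (t, u)) (t := 0)
      (v := fun c ↦ V c u) (by simp only [hF0]; exact hG'.smooth_chr huU k a b) d0
    simpa only [hF0] using this
  have v1 (a i : Fin n) : spaceDeriv i (fun q ↦ F q a) (0, u) = if i = a then 1 else 0 := by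
    rw [← pd_slice (hk a _ hu)]
    have : (fun w ↦ F (0, w) a) =ᶠ[𝓝 u] fun w ↦ w a := by
      filter_upwards [slice_mem_nhds hO hu] with w hw
      rw [hid w hw]
    rw [pd_congr this, pd_coord]
  have hd : HasDerivAt (fun t ↦
      ∑ i, ∑ j, (G u)⁻¹ i j * (spaceDeriv i (spaceDeriv j fun q ↦ F q k) (t, u)
        - ∑ l, chr G l i j u * spaceDeriv l (fun q ↦ F q k) (t, u)
        + ∑ a, ∑ b, chr G' k a b (F (t, u)) * spaceDeriv i (fun q ↦ F q a) (t, u) *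
          spaceDeriv j (fun q ↦ F q b) (t, u)))
      (∑ i, ∑ j, (G u)⁻¹ i j * (pd i (pd j (V k)) u - ∑ l, chr G l i j u * pd l (V k) u
        + ∑ a, ∑ b, (((∑ c, pd c (chr G' k a b) u * V c u) * spaceDeriv i (fun q ↦ F q a) (0, u)
            + chr G' k a b (F (0, u)) * pd i (V a) u) * spaceDeriv j (fun q ↦ F q b) (0, u)
          + chr G' k a b (F (0, u)) * spaceDeriv i (fun q ↦ F q a) (0, u) * pd j (V b) u))) 0 :=
    HasDerivAt.fun_sum fun i _ ↦ HasDerivAt.fun_sum fun j _ ↦ HasDerivAt.const_mul _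
      (((d2 i j).sub (HasDerivAt.fun_sum fun l _ ↦ (d1 k l).const_mul _)).add
        (HasDerivAt.fun_sum fun a _ ↦ HasDerivAt.fun_sum fun b _ ↦
          ((dΓ a b).mul (d1 a i)).mul (d1 b j)))
  refine (hd.congr_of_eventuallyEq heq).congr_deriv ?_
  rw [hid u hu]
  have e1 (i j : Fin n) : ∑ a, ∑ b, (((∑ c, pd c (chr G' k a b) u * V c u) *
          spaceDeriv i (fun q ↦ F q a) (0, u)
            + chr G' k a b u * pd i (V a) u) * spaceDeriv j (fun q ↦ F q b) (0, u)
          + chr G' k a b u * spaceDeriv i (fun q ↦ F q a) (0, u) * pd j (V b) u) =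
      ∑ c, pd c (chr G' k i j) u * V c u + ∑ a, chr G' k a j u * pd i (V a) u
        + ∑ b, chr G' k b i u * pd j (V b) u := by
    simp only [v1, mul_ite, mul_one, mul_zero, Finset.sum_add_distrib, Finset.sum_ite_eq,
      Finset.mem_univ, if_true, ite_mul, zero_mul]
    congr 1
    rw [Finset.sum_comm]
    simp only [Finset.sum_ite_eq, Finset.mem_univ, if_true]
    exact Finset.sum_congr rfl fun b _ ↦ by rw [hG'.symm_chr huU]
  simp only [e1]
  have e2 : ∑ i, ∑ j, (G u)⁻¹ i j * ∑ b, chr G' k b i u * pd j (V b) u =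
      ∑ i, ∑ j, (G u)⁻¹ i j * ∑ a, chr G' k a j u * pd i (V a) u :=
    hG.isLeviCivita.contract_swap huU fun i j ↦ ∑ b, chr G' k b i u * pd j (V b) u
  simp only [two_mul, mul_add, Finset.sum_add_distrib, e2]
  ring

theorem tensionComp_zero (hO : IsOpen O) (hid : ∀ u, (0, u) ∈ O → F (0, u) = u) {u : Eu n} (hu : (0, u) ∈ O)
    (k : Fin n) : tensionComp G G' (fun w ↦ F (0, w)) k u = idTension G G' k u := by
  have hone (i a : Fin n) (w : Eu n) (hw : (0, w) ∈ O) :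
      pd i (fun w ↦ F (0, w) a) w = if i = a then 1 else 0 := by
    have : (fun w ↦ F (0, w) a) =ᶠ[𝓝 w] fun w ↦ w a := by
      filter_upwards [slice_mem_nhds hO hw] with v hv
      rw [hid v hv]
    rw [pd_congr this, pd_coord]
  have htwo (i j a : Fin n) : pd i (pd j fun w ↦ F (0, w) a) u = 0 := by
    have : (pd j fun w ↦ F (0, w) a) =ᶠ[𝓝 u] fun _ ↦ if j = a then 1 else 0 := by
      filter_upwards [slice_mem_nhds hO hu] with v hv
      exact hone j a v hv
    rw [pd_congr this, pd_const]
  simp only [tensionComp, idTension, secondForm, htwo, hone _ _ u hu, hid u hu]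
  refine Finset.sum_congr rfl fun i _ ↦ Finset.sum_congr rfl fun j _ ↦ ?_
  simp only [mul_ite, mul_one, mul_zero, Finset.sum_ite_eq, Finset.sum_ite_eq', Finset.mem_univ,
    if_true]
  ring

/-- The first variation of the squared norm of the tension field at the identity map. -/
theorem hasDerivAt_tensionSq (hG : IsMetric G U) (hG' : IsMetric G' U) (hO : IsOpen O)
    (hF : ∀ q ∈ O, ContDiffAt ℝ ∞ F q) (hOU : ∀ q ∈ O, q.2 ∈ U)
    (hid : ∀ u, (0, u) ∈ O → F (0, u) = u) {u : Eu n} (hu : (0, u) ∈ O) :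
    HasDerivAt (fun t ↦ tensionSq G G' (fun w ↦ F (t, w)) u)
      (2 * firstVariation (fun i j w ↦ (G w)⁻¹ i j) (chr G) (fun i j w ↦ G' w i j) (chr G')
        (idTension G G') (idTensionForm G G')
        (fun k w ↦ timeDeriv (fun q ↦ F q k) (0, w)) u) 0 := by
  have huU : u ∈ U := hOU _ hu
  have hF0 : F (0, u) = u := hid u hu
  have hk (k : Fin n) : ∀ q ∈ O, ContDiffAt ℝ ∞ (fun q ↦ F q k) q :=
    fun q hq ↦ contDiffAt_apply (hF q hq) k
  have dτ := hasDerivAt_tensionComp hG hG' hO hF hOU hid hu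
  set V : Fin n → Eu n → ℝ := fun k w ↦ timeDeriv (fun q ↦ F q k) (0, w) with hV
  set δ : Fin n → ℝ := fun k ↦ ∑ i, ∑ j, (G u)⁻¹ i j * (pd i (pd j (V k)) u
        - ∑ l, chr G l i j u * pd l (V k) u
        + ∑ c, pd c (chr G' k i j) u * V c u
        + 2 * ∑ a, chr G' k a j u * pd i (V a) u) with hδ
  have d0 (c : Fin n) : HasDerivAt (fun t ↦ F (t, u) c) (V c u) 0 :=
    hasDerivAt_slice (q := (0, u)) (hk c _ hu)
  have dG (k l : Fin n) : HasDerivAt (fun t ↦ G' (F (t, u)) k l)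
      (∑ c, pd c (fun w ↦ G' w k l) u * V c u) 0 := by
    have := hasDerivAt_comp_curve (f := fun w ↦ G' w k l) (γ := fun t ↦ F (t, u)) (t := 0)
      (v := fun c ↦ V c u) (by simp only [hF0]; exact hG'.smooth u huU k l) d0
    simpa only [hF0] using this
  have hd : HasDerivAt (fun t ↦ tensionSq G G' (fun w ↦ F (t, w)) u)
      (∑ k, ∑ l, ((∑ c, pd c (fun w ↦ G' w k l) u * V c u) *
          (tensionComp G G' (fun w ↦ F (0, w)) k u * tensionComp G G' (fun w ↦ F (0, w)) l u)
        + G' (F (0, u)) k l * (δ k * tensionComp G G' (fun w ↦ F (0, w)) l u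
          + tensionComp G G' (fun w ↦ F (0, w)) k u * δ l))) 0 :=
    HasDerivAt.fun_sum fun k _ ↦ HasDerivAt.fun_sum fun l _ ↦ (dG k l).mul ((dτ k).mul (dτ l))
  refine hd.congr_deriv ?_
  simp only [tensionComp_zero hO hid hu, hF0]
  have e1 : ∑ k, ∑ l, (∑ c, pd c (fun w ↦ G' w k l) u * V c u) *
        (idTension G G' k u * idTension G G' l u) =
      ∑ c, V c u * ∑ k, ∑ l, pd c (fun w ↦ G' w k l) u *
        (idTension G G' k u * idTension G G' l u) := by
    simp only [Finset.sum_mul, Finset.mul_sum]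
    conv_rhs => rw [Finset.sum_comm]
    refine Finset.sum_congr rfl fun k _ ↦ ?_
    conv_rhs => rw [Finset.sum_comm]
    exact Finset.sum_congr rfl fun k _ ↦ Finset.sum_congr rfl fun l _ ↦ by ring
  have e2 : ∑ k, ∑ l, G' u k l * (δ k * idTension G G' l u) =
      ∑ k, idTensionForm G G' k u * δ k := by
    simp only [idTensionForm, Finset.sum_mul]
    exact Finset.sum_congr rfl fun k _ ↦ Finset.sum_congr rfl fun l _ ↦ by ring
  have e3 : ∑ k, ∑ l, G' u k l * (idTension G G' k u * δ l) =
      ∑ k, idTensionForm G G' k u * δ k := by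
    rw [← e2, Finset.sum_comm]
    exact Finset.sum_congr rfl fun k _ ↦ Finset.sum_congr rfl fun l _ ↦ by
      rw [hG'.symm huU]; ring
  simp only [mul_add (G' u _ _), Finset.sum_add_distrib, e1, e2, e3]
  have e5 : firstVariation (fun i j w ↦ (G w)⁻¹ i j) (chr G) (fun i j w ↦ G' w i j) (chr G')
      (idTension G G') (idTensionForm G G') V u = ∑ c, V c u * (1 / 2 * ∑ k, ∑ l,
        pd c (fun w ↦ G' w k l) u * (idTension G G' k u * idTension G G' l u))
      + ∑ k, idTensionForm G G' k u * δ k := rfl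
  have e4 : ∑ c, V c u * (1 / 2 * ∑ k, ∑ l, pd c (fun w ↦ G' w k l) u *
      (idTension G G' k u * idTension G G' l u)) = 1 / 2 * ∑ c, V c u * ∑ k, ∑ l,
      pd c (fun w ↦ G' w k l) u * (idTension G G' k u * idTension G G' l u) := by
    rw [Finset.mul_sum]
    exact Finset.sum_congr rfl fun c _ ↦ by ring
  rw [e5, e4]
  ring

end EnergyDensity

/-! ### Coordinate changes -/

section ChainRule

variable {n : ℕ}

/-- The Jacobian matrix of a map between open subsets of `ℝⁿ`. -/
def jac (ψ : Eu n → Eu n) (u : Eu n) : Matrix (Fin n) (Fin n) ℝ :=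
  Matrix.of fun a i ↦ pd i (fun w ↦ ψ w a) u

theorem pd_comp {f : Eu n → ℝ} {ψ : Eu n → Eu n} {u : Eu n} (hf : ContDiffAt ℝ ∞ f (ψ u))
    (hψ : ContDiffAt ℝ ∞ ψ u) (i : Fin n) :
    pd i (fun w ↦ f (ψ w)) u = ∑ a, pd a f (ψ u) * pd i (fun w ↦ ψ w a) u := by
  have h1 := (differentiableAt_of_smooth hf).hasFDerivAt
  have h2 := (hψ.differentiableAt (by simp)).hasFDerivAt
  have h3 : fderiv ℝ (fun w ↦ f (ψ w)) u = (fderiv ℝ f (ψ u)).comp (fderiv ℝ ψ u) :=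
    (h1.comp u h2).fderiv
  have h4 (a : Fin n) : fderiv ℝ (fun w ↦ ψ w a) u =
      (EuclideanSpace.proj (𝕜 := ℝ) a).comp (fderiv ℝ ψ u) :=
    ((EuclideanSpace.proj (𝕜 := ℝ) a).hasFDerivAt.comp u h2).fderiv
  rw [pd, h3, ContinuousLinearMap.comp_apply, fderiv_eq_sum_pd]
  refine Finset.sum_congr rfl fun a _ ↦ ?_
  simp only [pd, h4]
  exact mul_comm _ _

theorem pd_pd_comp {f : Eu n → ℝ} {ψ : Eu n → Eu n} {u : Eu n} {A W : Set (Eu n)}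
    (hA : IsOpen A) (hu : u ∈ A) (hψ : ∀ w ∈ A, ContDiffAt ℝ ∞ ψ w) (hAW : MapsTo ψ A W)
    (hf : ∀ w ∈ W, ContDiffAt ℝ ∞ f w) (i j : Fin n) :
    pd i (pd j fun w ↦ f (ψ w)) u =
      ∑ a, ∑ b, pd a (pd b f) (ψ u) * (pd i (fun w ↦ ψ w a) u * pd j (fun w ↦ ψ w b) u)
      + ∑ a, pd a f (ψ u) * pd i (pd j fun w ↦ ψ w a) u := by
  have h1 : (pd j fun w ↦ f (ψ w)) =ᶠ[𝓝 u]
      fun w ↦ ∑ a, pd a f (ψ w) * pd j (fun w ↦ ψ w a) w := by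
    filter_upwards [hA.mem_nhds hu] with w hw
    exact pd_comp (hf _ (hAW hw)) (hψ w hw) j
  have hψu := hψ u hu
  have hk (a : Fin n) : ContDiffAt ℝ ∞ (fun w ↦ ψ w a) u := contDiffAt_apply hψu a
  have hf2 (a : Fin n) : ContDiffAt ℝ ∞ (pd a f) (ψ u) := contDiffAt_pd (hf _ (hAW hu)) a
  have hfc (a : Fin n) : ContDiffAt ℝ ∞ (fun w ↦ pd a f (ψ w)) u := (hf2 a).comp u hψu
  rw [pd_congr h1, pd_sum (fun a _ ↦ (hfc a).mul (contDiffAt_pd (hk a) j))]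
  have h2 (a : Fin n) : pd i (fun w ↦ pd a f (ψ w) * pd j (fun w ↦ ψ w a) w) u =
      ∑ b, pd b (pd a f) (ψ u) * (pd i (fun w ↦ ψ w b) u * pd j (fun w ↦ ψ w a) u)
      + pd a f (ψ u) * pd i (pd j fun w ↦ ψ w a) u := by
    rw [pd_mul (hfc a) (contDiffAt_pd (hk a) j), pd_comp (hf2 a) hψu, Finset.sum_mul]
    congr 1
    exact Finset.sum_congr rfl fun b _ ↦ by ring
  simp only [h2, Finset.sum_add_distrib]
  rw [Finset.sum_comm]

/-- `ψ` is, on the open set `A ⊆ U`, a smooth isometric map into `W`. -/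
structure IsIsometricOn (G : Eu n → Matrix (Fin n) (Fin n) ℝ) (U : Set (Eu n))
    (H : Eu n → Matrix (Fin n) (Fin n) ℝ) (W : Set (Eu n)) (ψ : Eu n → Eu n) (A : Set (Eu n)) :
    Prop where
  source : IsMetric G U
  target : IsMetric H W
  isOpen : IsOpen A
  subset : A ⊆ U
  mapsTo : MapsTo ψ A W
  smooth : ∀ w ∈ A, ContDiffAt ℝ ∞ ψ w
  gram_eq : ∀ w ∈ A, G w = (jac ψ w).transpose * H (ψ w) * jac ψ w

namespace IsIsometricOn

variable {G H : Eu n → Matrix (Fin n) (Fin n) ℝ} {U W A : Set (Eu n)} {ψ : Eu n → Eu n} {u : Eu n}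

/-- The determinant of `G = Jᵀ H J` is positive, so `J` is invertible without any appeal to an
inverse map. -/
theorem isUnit_det_jac (h : IsIsometricOn G U H W ψ A) (hu : u ∈ A) : IsUnit (jac ψ u).det := by
  have h1 := h.source.det_pos (h.subset hu)
  rw [h.gram_eq u hu, Matrix.det_mul] at h1
  exact (right_ne_zero_of_mul h1.ne').isUnit

theorem gram_apply (h : IsIsometricOn G U H W ψ A) (hu : u ∈ A) (i j : Fin n) :
    G u i j = ∑ a, ∑ b, H (ψ u) a b * (pd i (fun w ↦ ψ w a) u * pd j (fun w ↦ ψ w b) u) := by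
  rw [h.gram_eq u hu]
  simp only [Matrix.mul_apply, Matrix.transpose_apply, jac, Matrix.of_apply, Finset.sum_mul]
  rw [Finset.sum_comm]
  exact Finset.sum_congr rfl fun a _ ↦ Finset.sum_congr rfl fun b _ ↦ by ring

theorem contract_inv (h : IsIsometricOn G U H W ψ A) (hu : u ∈ A) (a b : Fin n) :
    ∑ i, ∑ j, (G u)⁻¹ i j * (pd i (fun w ↦ ψ w a) u * pd j (fun w ↦ ψ w b) u) =
      (H (ψ u))⁻¹ a b := by
  have hJ := h.isUnit_det_jac hu
  have hJT : IsUnit (jac ψ u).transpose.det := by rwa [Matrix.det_transpose]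
  have h1 : jac ψ u * (G u)⁻¹ * (jac ψ u).transpose = (H (ψ u))⁻¹ := by
    rw [h.gram_eq u hu, Matrix.mul_inv_rev, Matrix.mul_inv_rev, ← Matrix.mul_assoc,
      Matrix.mul_nonsing_inv _ hJ, Matrix.one_mul, Matrix.mul_assoc, Matrix.nonsing_inv_mul _ hJT,
      Matrix.mul_one]
  rw [← h1]
  simp only [Matrix.mul_apply, Matrix.transpose_apply, jac, Matrix.of_apply, Finset.sum_mul]
  rw [Finset.sum_comm]
  exact Finset.sum_congr rfl fun i _ ↦ Finset.sum_congr rfl fun j _ ↦ by ring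

theorem pd_gram (h : IsIsometricOn G U H W ψ A) (hu : u ∈ A) (l i j : Fin n) :
    pd l (fun w ↦ G w i j) u =
      ∑ a, ∑ b, ∑ c, pd c (fun w ↦ H w a b) (ψ u) * (pd l (fun w ↦ ψ w c) u *
        (pd i (fun w ↦ ψ w a) u * pd j (fun w ↦ ψ w b) u))
      + ∑ a, ∑ b, H (ψ u) a b * (pd l (pd i fun w ↦ ψ w a) u * pd j (fun w ↦ ψ w b) u)
      + ∑ a, ∑ b, H (ψ u) a b * (pd i (fun w ↦ ψ w a) u * pd l (pd j fun w ↦ ψ w b) u) := by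
  have hψ := h.smooth u hu
  have hk (a : Fin n) : ContDiffAt ℝ ∞ (fun w ↦ ψ w a) u := contDiffAt_apply hψ a
  have hJ (i a : Fin n) : ContDiffAt ℝ ∞ (pd i fun w ↦ ψ w a) u := contDiffAt_pd (hk a) i
  have hH (a b : Fin n) : ContDiffAt ℝ ∞ (fun w ↦ H w a b) (ψ u) :=
    h.target.smooth _ (h.mapsTo hu) a b
  have hHc (a b : Fin n) : ContDiffAt ℝ ∞ (fun w ↦ H (ψ w) a b) u := (hH a b).comp u hψ
  have h1 : (fun w ↦ G w i j) =ᶠ[𝓝 u] fun w ↦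
      ∑ a, ∑ b, H (ψ w) a b * (pd i (fun w ↦ ψ w a) w * pd j (fun w ↦ ψ w b) w) := by
    filter_upwards [h.isOpen.mem_nhds hu] with w hw using h.gram_apply hw i j
  rw [pd_congr h1, pd_sum (fun a _ ↦ ContDiffAt.sum fun b _ ↦
    (hHc a b).mul ((hJ i a).mul (hJ j b)))]
  simp only [← Finset.sum_add_distrib]
  refine Finset.sum_congr rfl fun a _ ↦ ?_
  rw [pd_sum (fun b _ ↦ (hHc a b).mul ((hJ i a).mul (hJ j b)))]
  refine Finset.sum_congr rfl fun b _ ↦ ?_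
  rw [pd_mul (hHc a b) ((hJ i a).mul (hJ j b)), pd_mul (hJ i a) (hJ j b),
    pd_comp (f := fun w ↦ H w a b) (hH a b) hψ, Finset.sum_mul, mul_add, ← add_assoc]
  congr 2
  exact Finset.sum_congr rfl fun c _ ↦ by ring

/-- The transformation law of the Christoffel symbols. -/
theorem chr_transform (h : IsIsometricOn G U H W ψ A) (hu : u ∈ A) (a i j : Fin n) :
    ∑ k, pd k (fun w ↦ ψ w a) u * chr G k i j u =
      ∑ b, ∑ c, chr H a b c (ψ u) * (pd i (fun w ↦ ψ w b) u * pd j (fun w ↦ ψ w c) u)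
        + pd i (pd j fun w ↦ ψ w a) u := by
  have hψ := h.smooth u hu
  have hk (a : Fin n) : ContDiffAt ℝ ∞ (fun w ↦ ψ w a) u := contDiffAt_apply hψ a
  have hψW := h.mapsTo hu
  have huU := h.subset hu
  set J : Fin n → Fin n → ℝ := fun a i ↦ pd i (fun w ↦ ψ w a) u with hJ
  set K : Fin n → Fin n → Fin n → ℝ := fun a i j ↦ pd i (pd j fun w ↦ ψ w a) u with hK
  have hKs (a i j : Fin n) : K a i j = K a j i := pd_comm (hk a) i j
  let Tri : Fin n → Fin n → Fin n → ℝ := fun l i j ↦ ∑ a, ∑ b, ∑ c,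
    pd c (fun w ↦ H w a b) (ψ u) * (J c l * (J a i * J b j))
  -- The second derivatives of `ψ` enter `∂ₗ gᵢⱼ` only through `Bil`, which is symmetric in its
  -- first two arguments. In the combination defining the Christoffel symbol four of the six
  -- occurrences cancel and two equal ones remain.
  let Bil : Fin n → Fin n → Fin n → ℝ := fun l i j ↦ ∑ a, ∑ b, H (ψ u) a b * (K a l i * J b j)
  have hBs (l i j : Fin n) : Bil l i j = Bil i l j := by
    simp only [Bil, hKs _ l i]
  have hpd (l i j : Fin n) : pd l (fun w ↦ G w i j) u = Tri l i j + Bil l i j + Bil l j i := by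
    rw [h.pd_gram hu]
    congr 1
    simp only [Bil]
    rw [Finset.sum_comm]
    exact Finset.sum_congr rfl fun a _ ↦ Finset.sum_congr rfl fun b _ ↦ by
      rw [h.target.symm hψW]; ring
  let Y : Fin n → ℝ := fun a ↦ ∑ b, ∑ c, chr H a b c (ψ u) * (J b i * J c j) + K a i j
  let Z : Fin n → ℝ := fun a ↦ ∑ k, J a k * chr G k i j u
  -- The two sides are compared after multiplication by the invertible matrix `Jᵀ H`; there the
  -- Christoffel symbols become combinations of first derivatives of the metrics, and no inverse
  -- metric occurs.
  have hlow (m : Fin n) : ∑ d, J d m * ∑ a, H (ψ u) d a * Z a =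
      ∑ d, J d m * ∑ a, H (ψ u) d a * Y a := by
    have e1 : ∑ d, J d m * ∑ a, H (ψ u) d a * Z a = ∑ k, G u m k * chr G k i j u := by
      simp only [h.gram_apply hu, Z, Finset.mul_sum, Finset.sum_mul]
      conv_rhs => rw [Finset.sum_comm]
      refine Finset.sum_congr rfl fun d _ ↦ ?_
      conv_rhs => rw [Finset.sum_comm]
      exact Finset.sum_congr rfl fun _ _ ↦ Finset.sum_congr rfl fun _ _ ↦ by simp only [hJ]; ring
    have e2 (d : Fin n) : ∑ a, H (ψ u) d a * Y a =
        ∑ b, ∑ c, (1 / 2 * (pd b (fun w ↦ H w c d) (ψ u) + pd c (fun w ↦ H w b d) (ψ u)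
          - pd d (fun w ↦ H w b c) (ψ u))) * (J b i * J c j) + ∑ a, H (ψ u) d a * K a i j := by
      simp only [Y, mul_add, Finset.sum_add_distrib]
      congr 1
      simp only [← h.target.lower_chr hψW, Finset.mul_sum, Finset.sum_mul]
      rw [Finset.sum_comm]
      refine Finset.sum_congr rfl fun d _ ↦ ?_
      rw [Finset.sum_comm]
      exact Finset.sum_congr rfl fun _ _ ↦ Finset.sum_congr rfl fun _ _ ↦ by ring
    have e3 : ∑ d, J d m * ∑ b, ∑ c, (1 / 2 * (pd b (fun w ↦ H w c d) (ψ u)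
        + pd c (fun w ↦ H w b d) (ψ u) - pd d (fun w ↦ H w b c) (ψ u))) * (J b i * J c j) =
        1 / 2 * (Tri i j m + Tri j i m - Tri m i j) := by
      have s1 : Tri i j m = ∑ d, ∑ b, ∑ c, pd b (fun w ↦ H w c d) (ψ u) *
          (J b i * (J c j * J d m)) := by
        simp only [Tri]
        rw [Finset.sum_comm]
        exact Finset.sum_congr rfl fun _ _ ↦ Finset.sum_comm
      have s2 : Tri j i m = ∑ d, ∑ b, ∑ c, pd c (fun w ↦ H w b d) (ψ u) *
          (J c j * (J b i * J d m)) := by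
        simp only [Tri]
        rw [Finset.sum_comm]
      have s3 : Tri m i j = ∑ d, ∑ b, ∑ c, pd d (fun w ↦ H w b c) (ψ u) *
          (J d m * (J b i * J c j)) := by
        simp only [Tri]
        conv_rhs => rw [Finset.sum_comm]
        exact Finset.sum_congr rfl fun _ _ ↦ Finset.sum_comm
      rw [s1, s2, s3]
      simp only [Finset.mul_sum, ← Finset.sum_add_distrib, ← Finset.sum_sub_distrib]
      exact Finset.sum_congr rfl fun _ _ ↦ Finset.sum_congr rfl fun _ _ ↦
        Finset.sum_congr rfl fun _ _ ↦ by ring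
    have e4 : ∑ d, J d m * ∑ a, H (ψ u) d a * K a i j = Bil i j m := by
      simp only [Bil, Finset.mul_sum]
      rw [Finset.sum_comm]
      exact Finset.sum_congr rfl fun _ _ ↦ Finset.sum_congr rfl fun _ _ ↦ by
        rw [h.target.symm hψW]; ring
    rw [e1, h.source.lower_chr huU, hpd, hpd, hpd]
    simp only [e2, mul_add, Finset.sum_add_distrib, e3, e4]
    rw [hBs i m j, hBs j m i, hBs j i m]
    ring
  have hmat : Matrix.mulVec ((jac ψ u).transpose * H (ψ u)) Z =
      Matrix.mulVec ((jac ψ u).transpose * H (ψ u)) Y := by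
    ext m
    have := hlow m
    simp only [Matrix.mulVec, dotProduct, Matrix.mul_apply, Matrix.transpose_apply, jac,
      Matrix.of_apply, Finset.sum_mul]
    simp only [Finset.mul_sum] at this
    rw [Finset.sum_comm, Finset.sum_comm (f := fun x i ↦ _ * Y x)]
    simpa only [mul_assoc] using! this
  have hunit : IsUnit ((jac ψ u).transpose * H (ψ u)).det := by
    rw [Matrix.det_mul, Matrix.det_transpose]
    exact (h.isUnit_det_jac hu).mul (h.target.isUnit_det hψW)
  have hZY : Z = Y := by
    have := congrArg (Matrix.mulVec (((jac ψ u).transpose * H (ψ u))⁻¹)) hmat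
    simpa only [Matrix.mulVec_mulVec, Matrix.nonsing_inv_mul _ hunit, Matrix.one_mulVec] using this
  exact congrFun hZY a

end IsIsometricOn

variable {G H G' H' : Eu n → Matrix (Fin n) (Fin n) ℝ} {U W A U' W' A' : Set (Eu n)}
  {ψ θ F E : Eu n → Eu n} {u : Eu n}

/-- The second fundamental form is tensorial. Differentiating `E ∘ ψ = θ ∘ F` twice produces second
derivatives of `ψ` and `θ`, and these cancel against the inhomogeneous terms in the transformation
of the Christoffel symbols of the source (`t2`) and of the target (`t3`). -/
theorem secondForm_transform (hψ : IsIsometricOn G U H W ψ A) (hθ : IsIsometricOn G' U' H' W' θ A')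
    {B D : Set (Eu n)} (hB : IsOpen B) (hu : u ∈ B) (hBA : B ⊆ A)
    (hF : ∀ w ∈ B, ContDiffAt ℝ ∞ F w) (hFA' : MapsTo F B A')
    (hBD : MapsTo ψ B D) (hE : ∀ w ∈ D, ContDiffAt ℝ ∞ E w)
    (hEF : ∀ w ∈ B, E (ψ w) = θ (F w)) (k i j : Fin n) :
    ∑ a, ∑ b, secondForm H H' E k a b (ψ u) *
        (pd i (fun w ↦ ψ w a) u * pd j (fun w ↦ ψ w b) u) =
      ∑ m, pd m (fun w ↦ θ w k) (F u) * secondForm G G' F m i j u := by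
  have huA := hBA hu
  have hFu := hFA' hu
  have hEk (k : Fin n) : ∀ w ∈ D, ContDiffAt ℝ ∞ (fun w ↦ E w k) w :=
    fun w hw ↦ contDiffAt_apply (hE w hw) k
  have hθk (k : Fin n) : ∀ w ∈ A', ContDiffAt ℝ ∞ (fun w ↦ θ w k) w :=
    fun w hw ↦ contDiffAt_apply (hθ.smooth w hw) k
  have hψB : ∀ w ∈ B, ContDiffAt ℝ ∞ ψ w := fun w hw ↦ hψ.smooth w (hBA hw)
  have hEθ (k : Fin n) : (fun w ↦ E (ψ w) k) =ᶠ[𝓝 u] fun w ↦ θ (F w) k := by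
    filter_upwards [hB.mem_nhds hu] with w hw
    rw [hEF w hw]
  have first (k i : Fin n) : ∑ a, pd a (fun w ↦ E w k) (ψ u) * pd i (fun w ↦ ψ w a) u =
      ∑ m, pd m (fun w ↦ θ w k) (F u) * pd i (fun w ↦ F w m) u := by
    rw [← pd_comp (f := fun w ↦ E w k) (hEk k _ (hBD hu)) (hψB u hu),
      ← pd_comp (f := fun w ↦ θ w k) (hθk k _ hFu) (hF u hu), pd_congr (hEθ k)]
  have second : ∑ a, ∑ b, pd a (pd b fun w ↦ E w k) (ψ u) *
        (pd i (fun w ↦ ψ w a) u * pd j (fun w ↦ ψ w b) u)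
      + ∑ a, pd a (fun w ↦ E w k) (ψ u) * pd i (pd j fun w ↦ ψ w a) u =
      ∑ a, ∑ b, pd a (pd b fun w ↦ θ w k) (F u) *
        (pd i (fun w ↦ F w a) u * pd j (fun w ↦ F w b) u)
      + ∑ a, pd a (fun w ↦ θ w k) (F u) * pd i (pd j fun w ↦ F w a) u := by
    rw [← pd_pd_comp (f := fun w ↦ E w k) hB hu hψB hBD (hEk k),
      ← pd_pd_comp (f := fun w ↦ θ w k) hB hu hF hFA' (hθk k)]
    exact pd_congr (pd_congr_nhds (hEθ k) j) i
  have hc (c : Fin n) := hψ.chr_transform huA c i j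
  have hc' (r s : Fin n) := hθ.chr_transform hFu k r s
  have t2 : ∑ a, ∑ b, (∑ l, chr H l a b (ψ u) * pd l (fun w ↦ E w k) (ψ u)) *
        (pd i (fun w ↦ ψ w a) u * pd j (fun w ↦ ψ w b) u) =
      ∑ m, pd m (fun w ↦ θ w k) (F u) * ∑ l, chr G l i j u * pd l (fun w ↦ F w m) u
      - ∑ a, pd a (fun w ↦ E w k) (ψ u) * pd i (pd j fun w ↦ ψ w a) u := by
    have e1 : ∑ a, ∑ b, (∑ l, chr H l a b (ψ u) * pd l (fun w ↦ E w k) (ψ u)) *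
        (pd i (fun w ↦ ψ w a) u * pd j (fun w ↦ ψ w b) u) =
        ∑ l, pd l (fun w ↦ E w k) (ψ u) * ∑ a, ∑ b, chr H l a b (ψ u) *
          (pd i (fun w ↦ ψ w a) u * pd j (fun w ↦ ψ w b) u) := by
      simp only [Finset.mul_sum, Finset.sum_mul]
      conv_rhs => rw [Finset.sum_comm]
      refine Finset.sum_congr rfl fun d _ ↦ ?_
      conv_rhs => rw [Finset.sum_comm]
      exact Finset.sum_congr rfl fun _ _ ↦ Finset.sum_congr rfl fun _ _ ↦ by ring
    have e2 : ∑ m, pd m (fun w ↦ θ w k) (F u) * ∑ l, chr G l i j u * pd l (fun w ↦ F w m) u =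
        ∑ c, pd c (fun w ↦ E w k) (ψ u) * ∑ l, pd l (fun w ↦ ψ w c) u * chr G l i j u := by
      have (l : Fin n) := first k l
      calc _ = ∑ l, chr G l i j u * ∑ m, pd m (fun w ↦ θ w k) (F u) * pd l (fun w ↦ F w m) u := by
            simp only [Finset.mul_sum]
            rw [Finset.sum_comm]
            exact Finset.sum_congr rfl fun _ _ ↦ Finset.sum_congr rfl fun _ _ ↦ by ring
        _ = _ := by
            simp only [← first, Finset.mul_sum]
            rw [Finset.sum_comm]
            exact Finset.sum_congr rfl fun _ _ ↦ Finset.sum_congr rfl fun _ _ ↦ by ring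
    rw [e1, e2, ← Finset.sum_sub_distrib]
    exact Finset.sum_congr rfl fun c _ ↦ by rw [hc]; ring
  have t3 : ∑ a, ∑ b, (∑ d, ∑ e, chr H' k d e (E (ψ u)) * pd a (fun w ↦ E w d) (ψ u) *
        pd b (fun w ↦ E w e) (ψ u)) * (pd i (fun w ↦ ψ w a) u * pd j (fun w ↦ ψ w b) u) =
      ∑ m, pd m (fun w ↦ θ w k) (F u) * (∑ r, ∑ s, chr G' m r s (F u) * pd i (fun w ↦ F w r) u *
        pd j (fun w ↦ F w s) u)
      - ∑ a, ∑ b, pd a (pd b fun w ↦ θ w k) (F u) *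
        (pd i (fun w ↦ F w a) u * pd j (fun w ↦ F w b) u) := by
    have swap4 (f : Fin n → Fin n → Fin n → Fin n → ℝ) :
        ∑ a, ∑ b, ∑ d, ∑ e, f a b d e = ∑ d, ∑ e, ∑ a, ∑ b, f a b d e := by
      calc _ = ∑ a, ∑ d, ∑ b, ∑ e, f a b d e :=
            Finset.sum_congr rfl fun a _ ↦ Finset.sum_comm
        _ = ∑ d, ∑ a, ∑ b, ∑ e, f a b d e := Finset.sum_comm
        _ = ∑ d, ∑ a, ∑ e, ∑ b, f a b d e :=
            Finset.sum_congr rfl fun d _ ↦ Finset.sum_congr rfl fun a _ ↦ Finset.sum_comm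
        _ = _ := Finset.sum_congr rfl fun d _ ↦ Finset.sum_comm
    have e1 : ∑ a, ∑ b, (∑ d, ∑ e, chr H' k d e (E (ψ u)) * pd a (fun w ↦ E w d) (ψ u) *
        pd b (fun w ↦ E w e) (ψ u)) * (pd i (fun w ↦ ψ w a) u * pd j (fun w ↦ ψ w b) u) =
        ∑ d, ∑ e, chr H' k d e (E (ψ u)) *
          ((∑ a, pd a (fun w ↦ E w d) (ψ u) * pd i (fun w ↦ ψ w a) u) *
          ∑ b, pd b (fun w ↦ E w e) (ψ u) * pd j (fun w ↦ ψ w b) u) := by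
      simp only [Finset.sum_mul_sum]
      simp only [Finset.mul_sum, Finset.sum_mul]
      rw [swap4]
      exact Finset.sum_congr rfl fun _ _ ↦ Finset.sum_congr rfl fun _ _ ↦
        Finset.sum_congr rfl fun _ _ ↦ Finset.sum_congr rfl fun _ _ ↦ by ring
    have e2 : ∑ d, ∑ e, chr H' k d e (E (ψ u)) *
          ((∑ m, pd m (fun w ↦ θ w d) (F u) * pd i (fun w ↦ F w m) u) *
          ∑ m, pd m (fun w ↦ θ w e) (F u) * pd j (fun w ↦ F w m) u) =
        ∑ r, ∑ s, (pd i (fun w ↦ F w r) u * pd j (fun w ↦ F w s) u) *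
          ∑ d, ∑ e, chr H' k d e (θ (F u)) *
            (pd r (fun w ↦ θ w d) (F u) * pd s (fun w ↦ θ w e) (F u)) := by
      rw [hEF u hu]
      simp only [Finset.sum_mul_sum]
      simp only [Finset.mul_sum]
      rw [swap4]
      exact Finset.sum_congr rfl fun _ _ ↦ Finset.sum_congr rfl fun _ _ ↦
        Finset.sum_congr rfl fun _ _ ↦ Finset.sum_congr rfl fun _ _ ↦ by ring
    have e3 : ∑ m, pd m (fun w ↦ θ w k) (F u) * (∑ r, ∑ s, chr G' m r s (F u) *
        pd i (fun w ↦ F w r) u * pd j (fun w ↦ F w s) u) =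
        ∑ r, ∑ s, (pd i (fun w ↦ F w r) u * pd j (fun w ↦ F w s) u) *
          ∑ m, pd m (fun w ↦ θ w k) (F u) * chr G' m r s (F u) := by
      simp only [Finset.mul_sum]
      rw [Finset.sum_comm]
      refine Finset.sum_congr rfl fun d _ ↦ ?_
      rw [Finset.sum_comm]
      exact Finset.sum_congr rfl fun _ _ ↦ Finset.sum_congr rfl fun _ _ ↦ by ring
    simp only [e1, first]
    rw [e2, e3, ← Finset.sum_sub_distrib]
    refine Finset.sum_congr rfl fun r _ ↦ ?_
    rw [← Finset.sum_sub_distrib]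
    refine Finset.sum_congr rfl fun s _ ↦ ?_
    rw [hc']
    ring
  simp only [secondForm, add_mul, sub_mul, mul_add, mul_sub, Finset.sum_add_distrib,
    Finset.sum_sub_distrib]
  rw [t2, t3]
  linarith

theorem tensionComp_transform (hψ : IsIsometricOn G U H W ψ A)
    (hθ : IsIsometricOn G' U' H' W' θ A')
    {B D : Set (Eu n)} (hB : IsOpen B) (hu : u ∈ B) (hBA : B ⊆ A)
    (hF : ∀ w ∈ B, ContDiffAt ℝ ∞ F w) (hFA' : MapsTo F B A')
    (hBD : MapsTo ψ B D) (hE : ∀ w ∈ D, ContDiffAt ℝ ∞ E w)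
    (hEF : ∀ w ∈ B, E (ψ w) = θ (F w)) (k : Fin n) :
    tensionComp H H' E k (ψ u) =
      ∑ m, pd m (fun w ↦ θ w k) (F u) * tensionComp G G' F m u := by
  have h1 := secondForm_transform hψ hθ hB hu hBA hF hFA' hBD hE hEF k
  have e1 : ∑ m, pd m (fun w ↦ θ w k) (F u) * tensionComp G G' F m u =
      ∑ i, ∑ j, (G u)⁻¹ i j * ∑ m, pd m (fun w ↦ θ w k) (F u) * secondForm G G' F m i j u := by
    simp only [tensionComp, Finset.mul_sum]
    rw [Finset.sum_comm]
    refine Finset.sum_congr rfl fun d _ ↦ ?_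
    rw [Finset.sum_comm]
    exact Finset.sum_congr rfl fun _ _ ↦ Finset.sum_congr rfl fun _ _ ↦ by ring
  rw [e1]
  simp only [← h1, tensionComp, ← hψ.contract_inv (hBA hu), Finset.mul_sum, Finset.sum_mul]
  calc _ = ∑ a, ∑ i, ∑ b, ∑ j, (G u)⁻¹ i j * (pd i (fun w ↦ ψ w a) u * pd j (fun w ↦ ψ w b) u) *
          secondForm H H' E k a b (ψ u) := Finset.sum_congr rfl fun a _ ↦ Finset.sum_comm
    _ = ∑ i, ∑ a, ∑ b, ∑ j, (G u)⁻¹ i j * (pd i (fun w ↦ ψ w a) u * pd j (fun w ↦ ψ w b) u) *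
          secondForm H H' E k a b (ψ u) := Finset.sum_comm
    _ = ∑ i, ∑ a, ∑ j, ∑ b, (G u)⁻¹ i j * (pd i (fun w ↦ ψ w a) u * pd j (fun w ↦ ψ w b) u) *
          secondForm H H' E k a b (ψ u) :=
        Finset.sum_congr rfl fun d _ ↦ Finset.sum_congr rfl fun a _ ↦ Finset.sum_comm
    _ = ∑ i, ∑ j, ∑ a, ∑ b, (G u)⁻¹ i j * (pd i (fun w ↦ ψ w a) u * pd j (fun w ↦ ψ w b) u) *
          secondForm H H' E k a b (ψ u) := Finset.sum_congr rfl fun d _ ↦ Finset.sum_comm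
    _ = _ := Finset.sum_congr rfl fun _ _ ↦ Finset.sum_congr rfl fun _ _ ↦
        Finset.sum_congr rfl fun _ _ ↦ Finset.sum_congr rfl fun _ _ ↦ by ring

/-- The squared norm of the tension field does not depend on the coordinates. -/
theorem tensionSq_transform (hψ : IsIsometricOn G U H W ψ A)
    (hθ : IsIsometricOn G' U' H' W' θ A')
    {B D : Set (Eu n)} (hB : IsOpen B) (hu : u ∈ B) (hBA : B ⊆ A)
    (hF : ∀ w ∈ B, ContDiffAt ℝ ∞ F w) (hFA' : MapsTo F B A')
    (hBD : MapsTo ψ B D) (hE : ∀ w ∈ D, ContDiffAt ℝ ∞ E w)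
    (hEF : ∀ w ∈ B, E (ψ w) = θ (F w)) :
    tensionSq H H' E (ψ u) = tensionSq G G' F u := by
  have h1 := tensionComp_transform hψ hθ hB hu hBA hF hFA' hBD hE hEF
  simp only [tensionSq, h1, hEF u hu, hθ.gram_apply (hFA' hu)]
  simp only [Finset.sum_mul_sum]
  simp only [Finset.mul_sum, Finset.sum_mul]
  calc _ = ∑ k, ∑ m, ∑ l, ∑ r, H' (θ (F u)) k l * (pd m (fun w ↦ θ w k) (F u) *
          tensionComp G G' F m u * (pd r (fun w ↦ θ w l) (F u) * tensionComp G G' F r u)) :=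
        Finset.sum_congr rfl fun k _ ↦ Finset.sum_comm
    _ = ∑ m, ∑ k, ∑ l, ∑ r, H' (θ (F u)) k l * (pd m (fun w ↦ θ w k) (F u) *
          tensionComp G G' F m u * (pd r (fun w ↦ θ w l) (F u) * tensionComp G G' F r u)) :=
        Finset.sum_comm
    _ = ∑ m, ∑ k, ∑ r, ∑ l, H' (θ (F u)) k l * (pd m (fun w ↦ θ w k) (F u) *
          tensionComp G G' F m u * (pd r (fun w ↦ θ w l) (F u) * tensionComp G G' F r u)) :=
        Finset.sum_congr rfl fun m _ ↦ Finset.sum_congr rfl fun k _ ↦ Finset.sum_comm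
    _ = ∑ m, ∑ r, ∑ k, ∑ l, H' (θ (F u)) k l * (pd m (fun w ↦ θ w k) (F u) *
          tensionComp G G' F m u * (pd r (fun w ↦ θ w l) (F u) * tensionComp G G' F r u)) :=
        Finset.sum_congr rfl fun m _ ↦ Finset.sum_comm
    _ = _ := Finset.sum_congr rfl fun _ _ ↦ Finset.sum_congr rfl fun _ _ ↦
        Finset.sum_congr rfl fun _ _ ↦ Finset.sum_congr rfl fun _ _ ↦ by ring

end ChainRule

/-! ### Metrics, gradients and tension fields in charts -/

section Charts

variable {n : ℕ} {N : Type*} [TopologicalSpace N] [ChartedSpace (Eu n) N]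

/-- The domain, in the chart around `p`, of the transition map to the chart around `q`. -/
def overlap (n : ℕ) {N : Type*} [TopologicalSpace N] [ChartedSpace (Eu n) N] (p q : N) :
    Set (Eu n) :=
  (extChartAt (𝓡 n) p).target ∩ (extChartAt (𝓡 n) p).symm ⁻¹' (extChartAt (𝓡 n) q).source

/-- The transition map from the chart around `p` to the chart around `q`. -/
def transition (n : ℕ) {N : Type*} [TopologicalSpace N] [ChartedSpace (Eu n) N] (p q : N) :
    Eu n → Eu n :=
  fun u ↦ extChartAt (𝓡 n) q ((extChartAt (𝓡 n) p).symm u)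

theorem isOpen_overlap (p q : N) : IsOpen (overlap n p q) :=
  (continuousOn_extChartAt_symm p).isOpen_inter_preimage (isOpen_extChartAt_target p)
    (isOpen_extChartAt_source q)

theorem contDiffAt_transition [IsManifold (𝓡 n) ∞ N] (p q : N) {u : Eu n} (hu : u ∈ overlap n p q) :
    ContDiffAt ℝ ∞ (transition n p q) u := by
  have := contDiffWithinAt_ext_coord_change (I := 𝓡 n) (n := ∞) q p (y := u)
    (by rw [PartialEquiv.trans_source]; exact hu)
  simpa using! this

theorem symm_transition (p q : N) {u : Eu n} (hu : u ∈ overlap n p q) :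
    (extChartAt (𝓡 n) q).symm (transition n p q u) = (extChartAt (𝓡 n) p).symm u :=
  (extChartAt (𝓡 n) q).left_inv hu.2

theorem transition_mapsTo (p q : N) :
    MapsTo (transition n p q) (overlap n p q) (overlap n q p) := fun u hu ↦ by
  refine ⟨(extChartAt (𝓡 n) q).map_source hu.2, ?_⟩
  rw [mem_preimage, symm_transition p q hu]
  exact (extChartAt (𝓡 n) p).map_target hu.1

theorem transition_transition (p q : N) {u : Eu n} (hu : u ∈ overlap n p q) :
    transition n q p (transition n p q u) = u := by
  change extChartAt (𝓡 n) p ((extChartAt (𝓡 n) q).symm (transition n p q u)) = u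
  rw [symm_transition p q hu]
  exact (extChartAt (𝓡 n) p).right_inv hu.1

variable [IsManifold (𝓡 n) ∞ N]

/-- A tangent vector at `y` is stored by its components in the preferred chart at `y`. A coordinate
vector of another chart is therefore a column of the differential of the transition into that
preferred chart. -/
theorem coordField_eq_tangentCoordChange {p y : N} (hy : y ∈ (extChartAt (𝓡 n) p).source)
    (i : Fin n) :
    coordField p i y = tangentCoordChange (𝓡 n) p y y (EuclideanSpace.single i (1 : ℝ)) := by
  rw [extChartAt_source] at hy
  rw [coordField, TangentBundle.symmL_trivializationAt_eq_core hy]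
  rfl

theorem tangentCoordChange_eq_fderiv (p q : N) {y : N} :
    tangentCoordChange (𝓡 n) p q y = fderiv ℝ (transition n p q) (extChartAt (𝓡 n) p y) := by
  rw [tangentCoordChange_def]
  simp only [modelWithCornersSelf_coe, range_id, fderivWithin_univ]
  rfl

theorem fderiv_apply_coord {ψ : Eu n → Eu n} {u : Eu n} (hψ : ContDiffAt ℝ ∞ ψ u) (v : Eu n)
    (a : Fin n) : fderiv ℝ ψ u v a = ∑ i, v i * pd i (fun w ↦ ψ w a) u := by
  have h2 := (hψ.differentiableAt (by simp)).hasFDerivAt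
  have h4 : fderiv ℝ (fun w ↦ ψ w a) u = (EuclideanSpace.proj (𝕜 := ℝ) a).comp (fderiv ℝ ψ u) :=
    ((EuclideanSpace.proj (𝕜 := ℝ) a).hasFDerivAt.comp u h2).fderiv
  rw [← fderiv_eq_sum_pd, h4]
  rfl

theorem eq_sum_single (v : Eu n) : v = ∑ a, v a • EuclideanSpace.single a (1 : ℝ) := by
  ext j
  simp [Finset.sum_apply, Pi.single_apply]

/-- The transformation law of the coordinate vector fields. -/
theorem coordField_transform {p q y : N} (hp : y ∈ (extChartAt (𝓡 n) p).source)
    (hq : y ∈ (extChartAt (𝓡 n) q).source) (i : Fin n) :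
    coordField p i y =
      ∑ a, jac (transition n p q) (extChartAt (𝓡 n) p y) a i • coordField q a y := by
  have hu : extChartAt (𝓡 n) p y ∈ overlap n p q :=
    ⟨(extChartAt (𝓡 n) p).map_source hp, by
      rw [mem_preimage, (extChartAt (𝓡 n) p).left_inv hp]; exact hq⟩
  have hy : y ∈ (extChartAt (𝓡 n) y).source := mem_extChartAt_source y
  have h1 := tangentCoordChange_comp (I := 𝓡 n) (w := p) (x := q) (y := y) (z := y)
    (v := EuclideanSpace.single i (1 : ℝ)) ⟨⟨hp, hq⟩, hy⟩
  rw [coordField_eq_tangentCoordChange hp, ← h1]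
  have h2 : tangentCoordChange (𝓡 n) p q y (EuclideanSpace.single i (1 : ℝ)) =
      ∑ a, jac (transition n p q) (extChartAt (𝓡 n) p y) a i •
        EuclideanSpace.single a (1 : ℝ) := by
    rw [eq_sum_single (tangentCoordChange (𝓡 n) p q y (EuclideanSpace.single i (1 : ℝ)))]
    refine Finset.sum_congr rfl fun a _ ↦ ?_
    congr 1
    rw [tangentCoordChange_eq_fderiv, fderiv_apply_coord (contDiffAt_transition p q hu)]
    simp [jac]
  rw [h2, map_sum]
  refine Finset.sum_congr rfl fun a _ ↦ ?_
  rw [map_smul, coordField_eq_tangentCoordChange hq]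
  rfl

theorem gram_extChartAt (g : RMetric n N) {p y : N} (hy : y ∈ (extChartAt (𝓡 n) p).source)
    (i j : Fin n) :
    gram g p (extChartAt (𝓡 n) p y) i j = g.inner y (coordField p i y) (coordField p j y) := by
  simp only [gram, Matrix.of_apply]
  rw [(extChartAt (𝓡 n) p).left_inv hy]

theorem inner_sum_smul (g : RMetric n N) {p y : N} (hy : y ∈ (extChartAt (𝓡 n) p).source)
    (v w : Fin n → ℝ) :
    g.inner y (∑ i, v i • coordField p i y) (∑ j, w j • coordField p j y) =
      ∑ i, ∑ j, gram g p (extChartAt (𝓡 n) p y) i j * (v i * w j) := by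
  simp only [map_sum, map_smul, sum_apply, smul_apply,
    gram_extChartAt g hy, smul_eq_mul, Finset.mul_sum]
  rw [Finset.sum_comm]
  exact Finset.sum_congr rfl fun i _ ↦ Finset.sum_congr rfl fun j _ ↦ by ring

theorem sum_smul_coordField_eq_symmL (p y : N) (v : Fin n → ℝ) :
    ∑ i, v i • coordField p i y =
      (trivializationAt (Eu n) (TangentSpace (𝓡 n) : N → Type _) p).symmL ℝ y (WithLp.toLp 2 v) := by
  conv_rhs => rw [eq_sum_single (WithLp.toLp 2 v), map_sum]
  exact Finset.sum_congr rfl fun i _ ↦ by rw [map_smul]; rfl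

theorem continuousLinearMapAt_sum_coordField {p y : N} (hy : y ∈ (extChartAt (𝓡 n) p).source)
    (v : Fin n → ℝ) :
    (trivializationAt (Eu n) (TangentSpace (𝓡 n) : N → Type _) p).continuousLinearMapAt ℝ y
      (∑ i, v i • coordField p i y) = WithLp.toLp 2 v := by
  rw [sum_smul_coordField_eq_symmL, Trivialization.continuousLinearMapAt_symmL]
  rwa [TangentBundle.trivializationAt_baseSet, ← extChartAt_source (𝓡 n)]

theorem sum_smul_coordField_eq_zero_iff {p y : N} (hy : y ∈ (extChartAt (𝓡 n) p).source)
    (v : Fin n → ℝ) : ∑ i, v i • coordField p i y = 0 ↔ ∀ i, v i = 0 := by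
  constructor
  · intro h i
    have h1 := continuousLinearMapAt_sum_coordField hy v
    rw [h, map_zero] at h1
    exact (congrArg (fun w : Eu n ↦ w i) h1).symm
  · intro h
    simp [h]

theorem contDiffAt_comp_symm {f : N → ℝ} {p : N} {u : Eu n}
    (hu : u ∈ (extChartAt (𝓡 n) p).target)
    (hf : ContMDiffAt (𝓡 n) 𝓘(ℝ, ℝ) ∞ f ((extChartAt (𝓡 n) p).symm u)) :
    ContDiffAt ℝ ∞ (fun w ↦ f ((extChartAt (𝓡 n) p).symm w)) u := by
  have h1 : ContMDiffAt 𝓘(ℝ, Eu n) (𝓡 n) ∞ (extChartAt (𝓡 n) p).symm u :=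
    (contMDiffOn_extChartAt_symm p).contMDiffAt ((isOpen_extChartAt_target p).mem_nhds hu)
  exact contMDiffAt_iff_contDiffAt.1 (hf.comp u h1)

/-- The coordinate fields are the local frame that the trivialization around `p` attaches to the
standard basis. -/
theorem contMDiffAt_coordField {p y : N} (hy : y ∈ (extChartAt (𝓡 n) p).source) (i : Fin n) :
    ContMDiffAt (𝓡 n) ((𝓡 n).prod 𝓘(ℝ, Eu n)) ∞
      (fun y ↦ TotalSpace.mk' (Eu n) (E := (TangentSpace (𝓡 n) : N → Type _)) y
        (coordField p i y)) y := by
  have hb : y ∈ (trivializationAt (Eu n) (TangentSpace (𝓡 n) : N → Type _) p).baseSet := by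
    rwa [TangentBundle.trivializationAt_baseSet, ← extChartAt_source (𝓡 n)]
  have h1 := contMDiffAt_localFrame_of_mem (I := 𝓡 n) ∞
    (trivializationAt (Eu n) (TangentSpace (𝓡 n) : N → Type _) p)
    (EuclideanSpace.basisFun (Fin n) ℝ).toBasis i hb
  refine h1.congr_of_eventuallyEq ?_
  filter_upwards [(trivializationAt (Eu n) (TangentSpace (𝓡 n) : N → Type _) p).open_baseSet.mem_nhds
    hb] with z hz
  congr 1
  rw [Trivialization.localFrame_apply_of_mem_baseSet _ _ hz]
  simp only [Trivialization.basisAt, Module.Basis.map_apply, coordField, Trivialization.symmL]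
  simp only [OrthonormalBasis.coe_toBasis, EuclideanSpace.basisFun_apply,
    Trivialization.linearEquivAt_symm_apply]
  exact congrFun (Trivialization.coe_symmₗ _ hz) _

theorem contDiffAt_gram (g : RMetric n N) {p : N} {u : Eu n}
    (hu : u ∈ (extChartAt (𝓡 n) p).target) (i j : Fin n) :
    ContDiffAt ℝ ∞ (fun w ↦ gram g p w i j) u := by
  have hy := (extChartAt (𝓡 n) p).map_target hu
  refine contDiffAt_comp_symm (f := fun y ↦ g.inner y (coordField p i y) (coordField p j y)) hu ?_
  have h := ContMDiffAt.clm_bundle_apply₂ (F₁ := Eu n) (F₂ := Eu n) (F₃ := ℝ)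
    (E₁ := (TangentSpace (𝓡 n) : N → Type _)) (E₂ := (TangentSpace (𝓡 n) : N → Type _))
    (E₃ := Bundle.Trivial N ℝ)
    (g.contMDiff.contMDiffAt (x := (extChartAt (𝓡 n) p).symm u))
    (contMDiffAt_coordField hy i) (contMDiffAt_coordField hy j)
  simpa only [contMDiffAt_section] using! h

theorem posDef_gram (g : RMetric n N) {p : N} {u : Eu n}
    (hu : u ∈ (extChartAt (𝓡 n) p).target) : (gram g p u).PosDef := by
  obtain ⟨y, hy, rfl⟩ : ∃ y ∈ (extChartAt (𝓡 n) p).source, extChartAt (𝓡 n) p y = u :=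
    ⟨_, (extChartAt (𝓡 n) p).map_target hu, (extChartAt (𝓡 n) p).right_inv hu⟩
  refine Matrix.PosDef.of_dotProduct_mulVec_pos ?_ fun v hv ↦ ?_
  · refine Matrix.IsHermitian.ext fun i j ↦ ?_
    rw [star_trivial, gram_extChartAt g hy, gram_extChartAt g hy]
    exact g.symm y _ _
  · have h1 : ∑ i, v i • coordField p i y ≠ 0 := fun h ↦
      hv (funext ((sum_smul_coordField_eq_zero_iff hy v).1 h))
    have h2 := g.pos y _ h1
    rw [inner_sum_smul g hy] at h2
    refine h2.trans_eq ?_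
    simp only [dotProduct, Matrix.mulVec, star_trivial, Finset.mul_sum]
    exact Finset.sum_congr rfl fun i _ ↦ Finset.sum_congr rfl fun j _ ↦ by ring

theorem isMetric_gram (g : RMetric n N) (p : N) :
    IsMetric (gram g p) (extChartAt (𝓡 n) p).target where
  isOpen := isOpen_extChartAt_target p
  smooth _ hu := contDiffAt_gram g hu
  posDef _ hu := posDef_gram g hu

theorem isIsometricOn_transition (g : RMetric n N) (p q : N) :
    IsIsometricOn (gram g p) (extChartAt (𝓡 n) p).target (gram g q) (extChartAt (𝓡 n) q).target
      (transition n p q) (overlap n p q) where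
  source := isMetric_gram g p
  target := isMetric_gram g q
  isOpen := isOpen_overlap p q
  subset _ hu := hu.1
  mapsTo _ hu := (transition_mapsTo p q hu).1
  smooth _ hu := contDiffAt_transition p q hu
  gram_eq u hu := by
    obtain ⟨y, hy, rfl⟩ : ∃ y ∈ (extChartAt (𝓡 n) p).source, extChartAt (𝓡 n) p y = u :=
      ⟨_, (extChartAt (𝓡 n) p).map_target hu.1, (extChartAt (𝓡 n) p).right_inv hu.1⟩
    have hq : y ∈ (extChartAt (𝓡 n) q).source := by
      have := hu.2
      rwa [mem_preimage, (extChartAt (𝓡 n) p).left_inv hy] at this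
    have hT : transition n p q (extChartAt (𝓡 n) p y) = extChartAt (𝓡 n) q y := by
      rw [transition, (extChartAt (𝓡 n) p).left_inv hy]
    ext i j
    rw [gram_extChartAt g hy, coordField_transform hy hq, coordField_transform hy hq,
      inner_sum_smul g hq, hT]
    simp only [Matrix.mul_apply, Matrix.transpose_apply, Finset.sum_mul]
    rw [Finset.sum_comm]
    exact Finset.sum_congr rfl fun i _ ↦ Finset.sum_congr rfl fun j _ ↦ by ring

end Charts

/-! ### The Euler–Lagrange expression of the identity map between two metrics -/

section IdentityMap

variable {n : ℕ}

/-- `τ` enters undifferentiated, so equality at the point suffices for it; the other data are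
differentiated and must agree near the point. -/
theorem eulerLagrange_congr {gi : Fin n → Fin n → Eu n → ℝ}
    {Γ : Fin n → Fin n → Fin n → Eu n → ℝ} {g₁ g₂ : Fin n → Fin n → Eu n → ℝ}
    {Γ₁ Γ₂ : Fin n → Fin n → Fin n → Eu n → ℝ} {τ₁ τ₂ η₁ η₂ : Fin n → Eu n → ℝ} {u : Eu n}
    (hg : ∀ k l, g₁ k l =ᶠ[𝓝 u] g₂ k l) (hΓ : ∀ k i j, Γ₁ k i j =ᶠ[𝓝 u] Γ₂ k i j)
    (hτ : ∀ k, τ₁ k u = τ₂ k u) (hη : ∀ k, η₁ k =ᶠ[𝓝 u] η₂ k) (c : Fin n) :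
    eulerLagrange gi Γ g₁ Γ₁ τ₁ η₁ c u = eulerLagrange gi Γ g₂ Γ₂ τ₂ η₂ c u := by
  have h1 : divergence Γ (fun i w ↦ ∑ j, gi i j w * pd j (η₁ c) w) u =
      divergence Γ (fun i w ↦ ∑ j, gi i j w * pd j (η₂ c) w) u :=
    divergence_congr fun i ↦ by
      have h := fun j ↦ pd_congr_nhds (hη c) j
      filter_upwards [Filter.eventually_all.2 h] with w hw
      simp only [hw]
  have h2 : divergence Γ (fun i w ↦ ∑ j, gi i j w * ∑ k, Γ₁ k c j w * η₁ k w) u =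
      divergence Γ (fun i w ↦ ∑ j, gi i j w * ∑ k, Γ₂ k c j w * η₂ k w) u :=
    divergence_congr fun i ↦ by
      filter_upwards [Filter.eventually_all.2 fun k ↦ Filter.eventually_all.2 fun j ↦ hΓ k c j,
        Filter.eventually_all.2 hη] with w hw hw'
      simp only [hw, hw']
  simp only [eulerLagrange, h1, h2, hτ, pd_congr (hg _ _), pd_congr (hΓ _ _ _),
    (hη _).eq_of_nhds]

/-- The first variation of the bienergy density at the identity map from `G` to `G'`. -/
def idFirstVariation (G G' : Eu n → Matrix (Fin n) (Fin n) ℝ) (V : Fin n → Eu n → ℝ)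
    (u : Eu n) : ℝ :=
  firstVariation (fun i j w ↦ (G w)⁻¹ i j) (chr G) (fun i j w ↦ G' w i j) (chr G')
    (idTension G G') (idTensionForm G G') V u

/-- The Euler–Lagrange expression of the bienergy at the identity map from `G` to `G'`. -/
def idEulerLagrange (G G' : Eu n → Matrix (Fin n) (Fin n) ℝ) (c : Fin n) (u : Eu n) : ℝ :=
  eulerLagrange (fun i j w ↦ (G w)⁻¹ i j) (chr G) (fun i j w ↦ G' w i j) (chr G')
    (idTension G G') (idTensionForm G G') c u

/-- The components of the left-hand side of the biharmonic equation for `e^{2ρ} g`. -/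
def conformalBitension (gi : Fin n → Fin n → Eu n → ℝ) (Γ : Fin n → Fin n → Fin n → Eu n → ℝ)
    (ρ : Eu n → ℝ) (k : Fin n) (u : Eu n) : ℝ :=
  ∑ i, ∑ j, gi i j u * covDVec2 Γ (gradVec gi ρ) k i j u
    + (2 * -(∑ i, covDVec Γ (gradVec gi ρ) i i u) + (2 - (n : ℝ)) * gradSq gi ρ u) *
      gradVec gi ρ k u
    + (6 - (n : ℝ)) / 2 * gradVec gi (gradSq gi ρ) k u
    + ∑ j, ∑ m, gi k j u * (∑ i, curvature Γ i i j m u) * gradVec gi ρ m u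

variable {G G' : Eu n → Matrix (Fin n) (Fin n) ℝ} {U : Set (Eu n)} {u : Eu n} {ρ : Eu n → ℝ}

/-- The connection, tension field and dual covector of the identity are identified with their
conformal models on all of `U`, so that `IsLeviCivita.eulerLagrange_conformal` applies. It then
remains to lower the index of `conformalBitension` term by term. -/
theorem idEulerLagrange_conformal (h : IsMetric G U) (hρ : ∀ w ∈ U, ContDiffAt ℝ ∞ ρ w)
    (hG' : ∀ w ∈ U, G' w = Real.exp (2 * ρ w) • G w) (hu : u ∈ U) (c : Fin n) :
    idEulerLagrange G G' c u = (2 - (n : ℝ)) * Real.exp (2 * ρ u) *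
      ∑ k, G u c k * conformalBitension (fun i j w ↦ (G w)⁻¹ i j) (chr G) ρ k u := by
  have hL := h.isLeviCivita
  have hΓ (w : Eu n) (hw : w ∈ U) (k i j : Fin n) : chr G' k i j w =
      conformalChr (fun i j w ↦ G w i j) (fun i j w ↦ (G w)⁻¹ i j) (chr G) ρ k i j w := by
    rw [← h.chr_conformal hw (hρ w hw)]
    have hev (a b : Fin n) : (fun w ↦ G' w a b) =ᶠ[𝓝 w]
        fun w ↦ (Real.exp (2 * ρ w) • G w) a b := by
      filter_upwards [h.eventually_mem hw] with v hv
      rw [hG' v hv]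
    simp only [chr, hG' w hw, pd_congr (hev _ _)]
  have hτ (w : Eu n) (hw : w ∈ U) (k : Fin n) : idTension G G' k w =
      conformalTension (fun i j w ↦ (G w)⁻¹ i j) ρ k w := by
    simp only [idTension, hΓ w hw]
    exact hL.contract_conformal_difference hw ρ k
  have hη (w : Eu n) (hw : w ∈ U) (k : Fin n) : idTensionForm G G' k w =
      conformalTensionForm ρ k w := by
    simp only [idTensionForm, hτ w hw, hG' w hw, conformalTension, conformalTensionForm,
      ← hL.lower_gradVec hw (ρ := ρ), Matrix.smul_apply, smul_eq_mul, Finset.mul_sum]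
    exact Finset.sum_congr rfl fun l _ ↦ by ring
  have hEL : idEulerLagrange G G' c u = eulerLagrange (fun i j w ↦ (G w)⁻¹ i j) (chr G)
      (fun k l w ↦ Real.exp (2 * ρ w) * G w k l)
      (conformalChr (fun i j w ↦ G w i j) (fun i j w ↦ (G w)⁻¹ i j) (chr G) ρ)
      (conformalTension (fun i j w ↦ (G w)⁻¹ i j) ρ) (conformalTensionForm ρ) c u := by
    refine eulerLagrange_congr (fun k l ↦ ?_) (fun k i j ↦ ?_) (fun k ↦ hτ u hu k) (fun k ↦ ?_) c
    · filter_upwards [h.eventually_mem hu] with w hw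
      rw [hG' w hw, Matrix.smul_apply, smul_eq_mul]
    · filter_upwards [h.eventually_mem hu] with w hw using hΓ w hw k i j
    · filter_upwards [h.eventually_mem hu] with w hw using hη w hw k
  rw [hEL, hL.eulerLagrange_conformal hu hρ c]
  congr 1
  have e1 : ∑ k, G u c k * ∑ j, ∑ m, (G u)⁻¹ k j * (∑ i, curvature (chr G) i i j m u) *
        gradVec (fun i j w ↦ (G w)⁻¹ i j) ρ m u =
      ∑ m, (∑ i, curvature (chr G) i i c m u) * gradVec (fun i j w ↦ (G w)⁻¹ i j) ρ m u := by
    have := hL.lower_raise hu (fun j ↦ ∑ m, (∑ i, curvature (chr G) i i j m u) *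
      gradVec (fun i j w ↦ (G w)⁻¹ i j) ρ m u) c
    rw [← this]
    refine Finset.sum_congr rfl fun k _ ↦ congrArg _ (Finset.sum_congr rfl fun j _ ↦ ?_)
    rw [Finset.mul_sum]
    exact Finset.sum_congr rfl fun m _ ↦ mul_assoc _ _ _
  have e2 : divergence (chr G) (gradVec (fun i j w ↦ (G w)⁻¹ i j) ρ) u =
      ∑ i, covDVec (chr G) (gradVec (fun i j w ↦ (G w)⁻¹ i j) ρ) i i u := by
    simp only [divergence, covDVec, Finset.sum_add_distrib, Finset.sum_mul]
    congr 1
    exact Finset.sum_comm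
  have e3 (f : Eu n → ℝ) : ∑ k, G u c k * gradVec (fun i j w ↦ (G w)⁻¹ i j) f k u = pd c f u :=
    hL.lower_gradVec hu c
  have e4 (a : ℝ) (f : Eu n → ℝ) :
      ∑ k, G u c k * (a * gradVec (fun i j w ↦ (G w)⁻¹ i j) f k u) = a * pd c f u := by
    rw [← e3 f, Finset.mul_sum]
    exact Finset.sum_congr rfl fun k _ ↦ by ring
  simp only [conformalBitension, mul_add (G u c _), Finset.sum_add_distrib, e4, e1, e2]
  ring

/-- The scalar factor `(2 - n) e^{2ρ}` is nonzero and lowering an index is injective. -/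
theorem idEulerLagrange_eq_zero_iff (h : IsMetric G U) (hρ : ∀ w ∈ U, ContDiffAt ℝ ∞ ρ w)
    (hG' : ∀ w ∈ U, G' w = Real.exp (2 * ρ w) • G w) (hu : u ∈ U) (hn : n ≠ 2) :
    (∀ c, idEulerLagrange G G' c u = 0) ↔
      ∀ k, conformalBitension (fun i j w ↦ (G w)⁻¹ i j) (chr G) ρ k u = 0 := by
  have hn' : 2 - (n : ℝ) ≠ 0 := by
    rw [sub_ne_zero]; exact_mod_cast hn.symm
  have hne : (2 - (n : ℝ)) * Real.exp (2 * ρ u) ≠ 0 := mul_ne_zero hn' (Real.exp_pos _).ne'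
  simp only [idEulerLagrange_conformal h hρ hG' hu, mul_eq_zero, hne, false_or]
  constructor
  · intro h0 k
    rw [← h.isLeviCivita.raise_lower hu (fun k ↦ conformalBitension
      (fun i j w ↦ (G w)⁻¹ i j) (chr G) ρ k u) k]
    simp [h0]
  · intro h0 c
    simp [h0]

end IdentityMap

/-! ### The gradient and its derivatives in charts -/

section Gradient

variable {n : ℕ} {N : Type*} [TopologicalSpace N] [ChartedSpace (Eu n) N]

theorem extChartAt_mem_overlap {p q y : N} (hp : y ∈ (extChartAt (𝓡 n) p).source)
    (hq : y ∈ (extChartAt (𝓡 n) q).source) : extChartAt (𝓡 n) p y ∈ overlap n p q :=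
  ⟨(extChartAt (𝓡 n) p).map_source hp, by
    rw [mem_preimage, (extChartAt (𝓡 n) p).left_inv hp]; exact hq⟩

theorem transition_extChartAt {p q y : N} (hp : y ∈ (extChartAt (𝓡 n) p).source) :
    transition n p q (extChartAt (𝓡 n) p y) = extChartAt (𝓡 n) q y := by
  rw [transition, (extChartAt (𝓡 n) p).left_inv hp]

variable [IsManifold (𝓡 n) ∞ N]

/-- The manifold derivative is taken in the chart around `y`; the chain rule for the transition map
carries it to the chart around `p`. -/
theorem mvfderiv_coordField {f : N → ℝ} {p y : N} (hy : y ∈ (extChartAt (𝓡 n) p).source)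
    (hf : ContMDiffAt (𝓡 n) 𝓘(ℝ, ℝ) ∞ f y) (i : Fin n) :
    mvfderiv (𝓡 n) f y (coordField p i y) =
      pd i (fun w ↦ f ((extChartAt (𝓡 n) p).symm w)) (extChartAt (𝓡 n) p y) := by
  have hyy := mem_extChartAt_source (I := 𝓡 n) y
  have hu := extChartAt_mem_overlap hy hyy
  have hfd : ContDiffAt ℝ ∞ (fun w ↦ f ((extChartAt (𝓡 n) y).symm w)) (extChartAt (𝓡 n) y y) :=
    contDiffAt_comp_symm ((extChartAt (𝓡 n) y).map_source hyy)
      (by rwa [(extChartAt (𝓡 n) y).left_inv hyy])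
  rw [coordField_eq_tangentCoordChange hy, tangentCoordChange_eq_fderiv,
    (hf.mdifferentiableAt (by simp)).mvfderiv]
  simp only [modelWithCornersSelf_coe, range_id, fderivWithin_univ]
  have h1 : HasFDerivAt (fun w ↦ f ((extChartAt (𝓡 n) y).symm w))
      (fderiv ℝ (fun w ↦ f ((extChartAt (𝓡 n) y).symm w)) (extChartAt (𝓡 n) y y))
      (transition n p y (extChartAt (𝓡 n) p y)) := by
    rw [transition_extChartAt hy]
    exact (differentiableAt_of_smooth hfd).hasFDerivAt
  have h2 := ((contDiffAt_transition p y hu).differentiableAt (by simp)).hasFDerivAt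
  have h3 : (fun w ↦ f ((extChartAt (𝓡 n) p).symm w)) =ᶠ[𝓝 (extChartAt (𝓡 n) p y)]
      (fun w ↦ f ((extChartAt (𝓡 n) y).symm w)) ∘ transition n p y := by
    filter_upwards [(isOpen_overlap p y).mem_nhds hu] with w hw
    simp only [Function.comp_apply, symm_transition p y hw]
  rw [pd, h3.fderiv_eq, (h1.comp _ h2).fderiv]
  rfl

/-- The components of the gradient in an arbitrary chart. -/
theorem grad_eq_sum (g : RMetric n N) {f : N → ℝ} {p y : N}
    (hy : y ∈ (extChartAt (𝓡 n) p).source) (hf : ContMDiffAt (𝓡 n) 𝓘(ℝ, ℝ) ∞ f y) :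
    grad g f y = ∑ a, gradVec (fun i j w ↦ (gram g p w)⁻¹ i j)
      (fun w ↦ f ((extChartAt (𝓡 n) p).symm w)) a (extChartAt (𝓡 n) p y) • coordField p a y := by
  have hyy := mem_extChartAt_source (I := 𝓡 n) y
  have hu := extChartAt_mem_overlap hyy hy
  have hinv := (isIsometricOn_transition g y p).contract_inv hu
  rw [transition_extChartAt hyy] at hinv
  simp only [grad, gradVec, ← mvfderiv_coordField hy hf, ← hinv]
  simp only [coordField_transform hyy hy, map_sum, map_smul, smul_eq_mul, Finset.smul_sum,
    Finset.sum_smul, Finset.sum_mul, Finset.mul_sum, smul_smul, jac, Matrix.of_apply]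
  calc _ = ∑ i, ∑ a, ∑ j, ∑ b, ((gram g y (extChartAt (𝓡 n) y y))⁻¹ i j *
          (pd j (fun w ↦ transition n y p w b) (extChartAt (𝓡 n) y y) *
            mvfderiv (𝓡 n) f y (coordField p b y)) *
          pd i (fun w ↦ transition n y p w a) (extChartAt (𝓡 n) y y)) • coordField p a y :=
        Finset.sum_congr rfl fun i _ ↦ Finset.sum_comm
    _ = ∑ a, ∑ i, ∑ j, ∑ b, ((gram g y (extChartAt (𝓡 n) y y))⁻¹ i j *
          (pd j (fun w ↦ transition n y p w b) (extChartAt (𝓡 n) y y) *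
            mvfderiv (𝓡 n) f y (coordField p b y)) *
          pd i (fun w ↦ transition n y p w a) (extChartAt (𝓡 n) y y)) • coordField p a y :=
        Finset.sum_comm
    _ = _ := by
        refine Finset.sum_congr rfl fun a _ ↦ ?_
        have : ∀ i, ∑ j, ∑ b, ((gram g y (extChartAt (𝓡 n) y y))⁻¹ i j *
          (pd j (fun w ↦ transition n y p w b) (extChartAt (𝓡 n) y y) *
            mvfderiv (𝓡 n) f y (coordField p b y)) *
          pd i (fun w ↦ transition n y p w a) (extChartAt (𝓡 n) y y)) • coordField p a y =
          ∑ b, ∑ j, ((gram g y (extChartAt (𝓡 n) y y))⁻¹ i j *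
          (pd i (fun w ↦ transition n y p w a) (extChartAt (𝓡 n) y y) *
            pd j (fun w ↦ transition n y p w b) (extChartAt (𝓡 n) y y)) *
            mvfderiv (𝓡 n) f y (coordField p b y)) • coordField p a y := fun i ↦ by
          rw [Finset.sum_comm]
          exact Finset.sum_congr rfl fun b _ ↦ Finset.sum_congr rfl fun j _ ↦ by
            congr 1; ring
        simp only [this]
        exact Finset.sum_comm

theorem comp_sum_coordField {p : N} {u : Eu n} (hu : u ∈ (extChartAt (𝓡 n) p).target)
    {X : ∀ y : N, TangentSpace (𝓡 n) y} {v : Fin n → ℝ}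
    (hX : X ((extChartAt (𝓡 n) p).symm u) =
      ∑ a, v a • coordField p a ((extChartAt (𝓡 n) p).symm u)) (k : Fin n) :
    comp p X k u = v k := by
  rw [comp, hX, continuousLinearMapAt_sum_coordField ((extChartAt (𝓡 n) p).map_target hu)]

theorem comp_grad (g : RMetric n N) {f : N → ℝ} (hf : ContMDiff (𝓡 n) 𝓘(ℝ, ℝ) ∞ f) {p : N}
    {u : Eu n} (hu : u ∈ (extChartAt (𝓡 n) p).target) (k : Fin n) :
    comp p (grad g f) k u = gradVec (fun i j w ↦ (gram g p w)⁻¹ i j)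
      (fun w ↦ f ((extChartAt (𝓡 n) p).symm w)) k u := by
  refine (comp_sum_coordField hu (grad_eq_sum g ((extChartAt (𝓡 n) p).map_target hu) (hf _))
    k).trans ?_
  rw [(extChartAt (𝓡 n) p).right_inv hu]

theorem normSq_grad (g : RMetric n N) {f : N → ℝ} {p y : N}
    (hy : y ∈ (extChartAt (𝓡 n) p).source) (hf : ContMDiffAt (𝓡 n) 𝓘(ℝ, ℝ) ∞ f y) :
    normSq g (grad g f) y = gradSq (fun i j w ↦ (gram g p w)⁻¹ i j)
      (fun w ↦ f ((extChartAt (𝓡 n) p).symm w)) (extChartAt (𝓡 n) p y) := by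
  have hL := (isMetric_gram g p).isLeviCivita
  rw [normSq, grad_eq_sum g hy hf, inner_sum_smul g hy, gradSq]
  simp only [← hL.lower_gradVec ((extChartAt (𝓡 n) p).map_source hy), Finset.sum_mul]
  exact Finset.sum_congr rfl fun i _ ↦ Finset.sum_congr rfl fun j _ ↦ by ring

/-- `grad` uses a different chart at each point, so smoothness is not visible from its definition.
It follows because one fixed chart describes `|grad f|²` on its whole domain. -/
theorem contMDiffAt_normSq_grad (g : RMetric n N) {f : N → ℝ}
    (hf : ContMDiff (𝓡 n) 𝓘(ℝ, ℝ) ∞ f) (x : N) :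
    ContMDiffAt (𝓡 n) 𝓘(ℝ, ℝ) ∞ (normSq g (grad g f)) x := by
  have hx := mem_extChartAt_source (I := 𝓡 n) x
  have hu := (extChartAt (𝓡 n) x).map_source hx
  have h1 : ContDiffAt ℝ ∞ (gradSq (fun i j w ↦ (gram g x w)⁻¹ i j)
      (fun w ↦ f ((extChartAt (𝓡 n) x).symm w))) (extChartAt (𝓡 n) x x) :=
    smooth_gradSq ((isMetric_gram g x).smooth_inv hu) (contDiffAt_comp_symm hu (hf _))
  refine (h1.contMDiffAt.comp x (contMDiffAt_extChartAt (n := ∞))).congr_of_eventuallyEq ?_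
  filter_upwards [extChartAt_source_mem_nhds (I := 𝓡 n) x] with y hy
  exact normSq_grad g hy (hf y)

theorem covD_grad (g : RMetric n N) {f : N → ℝ} (hf : ContMDiff (𝓡 n) 𝓘(ℝ, ℝ) ∞ f) {p : N}
    {u : Eu n} (hu : u ∈ (extChartAt (𝓡 n) p).target) (k i : Fin n) :
    covD g p (grad g f) k i u = covDVec (chr (gram g p)) (gradVec (fun i j w ↦ (gram g p w)⁻¹ i j)
      (fun w ↦ f ((extChartAt (𝓡 n) p).symm w))) k i u := by
  have hev : comp p (grad g f) k =ᶠ[𝓝 u] gradVec (fun i j w ↦ (gram g p w)⁻¹ i j)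
      (fun w ↦ f ((extChartAt (𝓡 n) p).symm w)) k := by
    filter_upwards [(isOpen_extChartAt_target p).mem_nhds hu] with w hw
    exact comp_grad g hf hw k
  simp only [covD, covDVec, pd_congr hev, comp_grad g hf hu]
  rfl

theorem covD2_grad (g : RMetric n N) {f : N → ℝ} (hf : ContMDiff (𝓡 n) 𝓘(ℝ, ℝ) ∞ f) {p : N}
    {u : Eu n} (hu : u ∈ (extChartAt (𝓡 n) p).target) (k i j : Fin n) :
    covD2 g p (grad g f) k i j u =
      covDVec2 (chr (gram g p)) (gradVec (fun i j w ↦ (gram g p w)⁻¹ i j)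
        (fun w ↦ f ((extChartAt (𝓡 n) p).symm w))) k i j u := by
  have hev : covD g p (grad g f) k j =ᶠ[𝓝 u] covDVec (chr (gram g p))
      (gradVec (fun i j w ↦ (gram g p w)⁻¹ i j)
        (fun w ↦ f ((extChartAt (𝓡 n) p).symm w))) k j := by
    filter_upwards [(isOpen_extChartAt_target p).mem_nhds hu] with w hw
    exact covD_grad g hf hw k j
  simp only [covD2, covDVec2, pd_congr hev, covD_grad g hf hu]
  rfl

end Gradient

/-! ### The biharmonic equation in charts. -/

section BiharmonicEquation

variable {n : ℕ} {N : Type*} [TopologicalSpace N] [ChartedSpace (Eu n) N] [IsManifold (𝓡 n) ∞ N]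

/-- The left-hand side of the biharmonic equation in the chart around the point. -/
theorem biharmonicExpression_eq_sum (g : RMetric n N) {ρ : N → ℝ}
    (hρ : ContMDiff (𝓡 n) 𝓘(ℝ, ℝ) ∞ ρ) (x : N) :
    traceHess g (grad g ρ) x
        + (2 * laplacian g ρ x + (2 - (n : ℝ)) * normSq g (grad g ρ) x) • grad g ρ x
        + ((6 - (n : ℝ)) / 2) • grad g (normSq g (grad g ρ)) x + ricciOp g (grad g ρ) x =
      ∑ k, conformalBitension (fun i j w ↦ (gram g x w)⁻¹ i j) (chr (gram g x))
        (fun w ↦ ρ ((extChartAt (𝓡 n) x).symm w)) k (extChartAt (𝓡 n) x x) • coordField x k x := by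
  have hx := mem_extChartAt_source (I := 𝓡 n) x
  have hu := (extChartAt (𝓡 n) x).map_source hx
  have h1 : (fun w ↦ normSq g (grad g ρ) ((extChartAt (𝓡 n) x).symm w))
      =ᶠ[𝓝 (extChartAt (𝓡 n) x x)] gradSq (fun i j w ↦ (gram g x w)⁻¹ i j)
        (fun w ↦ ρ ((extChartAt (𝓡 n) x).symm w)) := by
    filter_upwards [(isOpen_extChartAt_target x).mem_nhds hu] with w hw
    rw [normSq_grad g ((extChartAt (𝓡 n) x).map_target hw) (hρ _),
      (extChartAt (𝓡 n) x).right_inv hw]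
  have h2 := grad_eq_sum g hx (contMDiffAt_normSq_grad g hρ x)
  have h3 (a : Fin n) : gradVec (fun i j w ↦ (gram g x w)⁻¹ i j)
      (fun w ↦ normSq g (grad g ρ) ((extChartAt (𝓡 n) x).symm w)) a (extChartAt (𝓡 n) x x) =
      gradVec (fun i j w ↦ (gram g x w)⁻¹ i j) (gradSq (fun i j w ↦ (gram g x w)⁻¹ i j)
        (fun w ↦ ρ ((extChartAt (𝓡 n) x).symm w))) a (extChartAt (𝓡 n) x x) := by
    simp only [gradVec, pd_congr h1]
  rw [h2, normSq_grad g hx (hρ x), grad_eq_sum g hx (hρ x)]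
  simp only [traceHess, laplacian, ricciOp, ricciTensor, covD_grad g hρ hu, covD2_grad g hρ hu,
    comp_grad g hρ hu, h3, Finset.smul_sum, smul_smul, ← Finset.sum_add_distrib, ← add_smul]
  rfl

theorem gram_conformal {h h' : RMetric n N} {ρ : N → ℝ}
    (hh' : ∀ (x : N) (v w : TangentSpace (𝓡 n) x),
      h'.inner x v w = Real.exp (2 * ρ x) * h.inner x v w) (p : N) (u : Eu n) :
    gram h' p u = Real.exp (2 * ρ ((extChartAt (𝓡 n) p).symm u)) • gram h p u := by
  ext i j
  simp only [gram, Matrix.of_apply, hh', Matrix.smul_apply, smul_eq_mul]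

/-- The biharmonic equation is the vanishing of the Euler–Lagrange expression, in the chart around
each point. -/
theorem biharmonicExpression_eq_zero_iff (hn : n ≠ 2) {h h' : RMetric n N} {ρ : N → ℝ}
    (hρ : ContMDiff (𝓡 n) 𝓘(ℝ, ℝ) ∞ ρ) (hh' : ∀ (x : N) (v w : TangentSpace (𝓡 n) x),
      h'.inner x v w = Real.exp (2 * ρ x) * h.inner x v w) (x : N) :
    traceHess h (grad h ρ) x
        + (2 * laplacian h ρ x + (2 - (n : ℝ)) * normSq h (grad h ρ) x) • grad h ρ x
        + ((6 - (n : ℝ)) / 2) • grad h (normSq h (grad h ρ)) x + ricciOp h (grad h ρ) x = 0 ↔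
      ∀ c, idEulerLagrange (gram h x) (gram h' x) c (extChartAt (𝓡 n) x x) = 0 := by
  have hx := mem_extChartAt_source (I := 𝓡 n) x
  have hu := (extChartAt (𝓡 n) x).map_source hx
  rw [biharmonicExpression_eq_sum h hρ x, sum_smul_coordField_eq_zero_iff hx,
    idEulerLagrange_eq_zero_iff (isMetric_gram h x)
      (ρ := fun w ↦ ρ ((extChartAt (𝓡 n) x).symm w))
      (fun w hw ↦ contDiffAt_comp_symm hw (hρ _)) (fun w _ ↦ gram_conformal hh' x w) hu hn]

end BiharmonicEquation

/-! ### The bienergy density of a map in charts -/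

section DensityInCharts

variable {n : ℕ} {N : Type*} [TopologicalSpace N] [ChartedSpace (Eu n) N] [IsManifold (𝓡 n) ∞ N]

theorem contMDiffAt_extChartAt_symm {p : N} {u : Eu n} (hu : u ∈ (extChartAt (𝓡 n) p).target) :
    ContMDiffAt 𝓘(ℝ, Eu n) (𝓡 n) ∞ (extChartAt (𝓡 n) p).symm u :=
  (contMDiffOn_extChartAt_symm p).contMDiffAt ((isOpen_extChartAt_target p).mem_nhds hu)

theorem contMDiffAt_extChartAt_of_mem {q y : N} (hy : y ∈ (extChartAt (𝓡 n) q).source) :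
    ContMDiffAt (𝓡 n) 𝓘(ℝ, Eu n) ∞ (extChartAt (𝓡 n) q) y :=
  contMDiffAt_extChartAt' (by rwa [extChartAt_source] at hy)

theorem contDiffAt_inCharts {φ : N → N} {p q : N} {u : Eu n}
    (hu : u ∈ (extChartAt (𝓡 n) p).target)
    (hφ : ContMDiffAt (𝓡 n) (𝓡 n) ∞ φ ((extChartAt (𝓡 n) p).symm u))
    (hq : φ ((extChartAt (𝓡 n) p).symm u) ∈ (extChartAt (𝓡 n) q).source) :
    ContDiffAt ℝ ∞ (fun w ↦ extChartAt (𝓡 n) q (φ ((extChartAt (𝓡 n) p).symm w))) u := by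
  have h1 : ContMDiffAt 𝓘(ℝ, Eu n) (𝓡 n) ∞ (fun w ↦ φ ((extChartAt (𝓡 n) p).symm w)) u :=
    hφ.comp u (contMDiffAt_extChartAt_symm hu)
  exact contMDiffAt_iff_contDiffAt.1 (ContMDiffAt.comp u (contMDiffAt_extChartAt_of_mem hq) h1)

theorem tension_eq_sum (h h' : RMetric n N) (φ : N → N) (x : N) :
    tension h h' φ x = ∑ k, tensionComp (gram h x) (gram h' (φ x))
      (fun w ↦ extChartAt (𝓡 n) (φ x) (φ ((extChartAt (𝓡 n) x).symm w))) k
      (extChartAt (𝓡 n) x x) • coordField (φ x) k (φ x) := by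
  have hx : (extChartAt (𝓡 n) x).symm (extChartAt (𝓡 n) x x) = x :=
    (extChartAt (𝓡 n) x).left_inv (mem_extChartAt_source x)
  simp only [tension, secondFundamentalForm, tensionComp, secondForm, hx]
  rfl

/-- The squared norm of the tension field, in arbitrary charts. -/
theorem inner_tension (h h' : RMetric n N) {φ : N → N} (hφ : ContMDiff (𝓡 n) (𝓡 n) ∞ φ)
    {p q x : N} (hx : x ∈ (extChartAt (𝓡 n) p).source)
    (hφx : φ x ∈ (extChartAt (𝓡 n) q).source) :
    h'.inner (φ x) (tension h h' φ x) (tension h h' φ x) =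
      tensionSq (gram h p) (gram h' q)
        (fun w ↦ extChartAt (𝓡 n) q (φ ((extChartAt (𝓡 n) p).symm w))) (extChartAt (𝓡 n) p x) := by
  have hxx := mem_extChartAt_source (I := 𝓡 n) x
  have hyy := mem_extChartAt_source (I := 𝓡 n) (φ x)
  have hsymm : (extChartAt (𝓡 n) x).symm (extChartAt (𝓡 n) x x) = x :=
    (extChartAt (𝓡 n) x).left_inv hxx
  rw [tension_eq_sum, inner_sum_smul h' hyy]
  let F : Eu n → Eu n := fun w ↦ extChartAt (𝓡 n) (φ x) (φ ((extChartAt (𝓡 n) x).symm w))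
  -- The neighbourhood where the point lies in both source charts and its image in both target
  -- charts, so that both transition maps are available.
  let B : Set (Eu n) := overlap n x p ∩ (fun w ↦ φ ((extChartAt (𝓡 n) x).symm w)) ⁻¹'
    ((extChartAt (𝓡 n) (φ x)).source ∩ (extChartAt (𝓡 n) q).source)
  have hB : IsOpen B := by
    refine ContinuousOn.isOpen_inter_preimage ?_ (isOpen_overlap x p)
      ((isOpen_extChartAt_source _).inter (isOpen_extChartAt_source _))
    exact hφ.continuous.comp_continuousOn
      ((continuousOn_extChartAt_symm x).mono fun _ hu ↦ hu.1)
  have huB : extChartAt (𝓡 n) x x ∈ B :=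
    ⟨extChartAt_mem_overlap hxx hx, by simp only [mem_preimage, hsymm]; exact ⟨hyy, hφx⟩⟩
  have hF0 : F (extChartAt (𝓡 n) x x) = extChartAt (𝓡 n) (φ x) (φ x) := by simp only [F, hsymm]
  have key := tensionSq_transform (F := F)
    (E := fun w ↦ extChartAt (𝓡 n) q (φ ((extChartAt (𝓡 n) p).symm w)))
    (D := {w | w ∈ (extChartAt (𝓡 n) p).target ∧
      φ ((extChartAt (𝓡 n) p).symm w) ∈ (extChartAt (𝓡 n) q).source})
    (isIsometricOn_transition h x p) (isIsometricOn_transition h' (φ x) q) hB huB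
    (fun _ hu ↦ hu.1) (fun w hw ↦ contDiffAt_inCharts hw.1.1 (hφ _) hw.2.1)
    (fun w hw ↦ extChartAt_mem_overlap hw.2.1 hw.2.2)
    (fun w hw ↦ ⟨(transition_mapsTo x p hw.1).1, by
      rw [symm_transition x p hw.1]; exact hw.2.2⟩)
    (fun w hw ↦ contDiffAt_inCharts hw.1 (hφ _) hw.2)
    (fun w hw ↦ by
      simp only [F]
      rw [symm_transition x p hw.1, transition_extChartAt hw.2.1])
  rw [transition_extChartAt hxx] at key
  rw [key, tensionSq, hF0]

end DensityInCharts

/-! ### Smooth variations of the identity map -/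

section Variations

variable {n : ℕ} {N : Type*} [TopologicalSpace N] [ChartedSpace (Eu n) N]

/-- A smooth variation, with parameter in `(-ε, ε)`, of the identity map, supported in `K`. -/
structure IsVariation (n : ℕ) {N : Type*} [TopologicalSpace N] [ChartedSpace (Eu n) N]
    (ε : ℝ) (K : Set N) (Φ : ℝ → N → N) : Prop where
  pos : 0 < ε
  smooth : ContMDiffOn (𝓘(ℝ, ℝ).prod (𝓡 n)) (𝓡 n) ∞ (fun q : ℝ × N ↦ Φ q.1 q.2)
    (Ioo (-ε) ε ×ˢ univ)
  map_zero : ∀ x, Φ 0 x = x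
  eq_off : ∀ t ∈ Ioo (-ε) ε, ∀ x ∉ K, Φ t x = x

/-- A variation in the chart around `p`. -/
def chartMap (n : ℕ) {N : Type*} [TopologicalSpace N] [ChartedSpace (Eu n) N] (p : N)
    (Φ : ℝ → N → N) (q : ℝ × Eu n) : Eu n :=
  extChartAt (𝓡 n) p (Φ q.1 ((extChartAt (𝓡 n) p).symm q.2))

/-- The domain of `chartMap`. -/
def chartDomain (n : ℕ) {N : Type*} [TopologicalSpace N] [ChartedSpace (Eu n) N] (p : N) (ε : ℝ)
    (Φ : ℝ → N → N) : Set (ℝ × Eu n) :=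
  (Ioo (-ε) ε ×ˢ (extChartAt (𝓡 n) p).target) ∩
    (fun q ↦ Φ q.1 ((extChartAt (𝓡 n) p).symm q.2)) ⁻¹' (extChartAt (𝓡 n) p).source

/-- The components of the velocity field of a variation in the chart around `p`. -/
def velocity (p : N) (Φ : ℝ → N → N) (k : Fin n) (u : Eu n) : ℝ :=
  timeDeriv (fun q ↦ chartMap n p Φ q k) (0, u)

/-- The density `|τ(Φₜ)|²` of the bienergy along a variation. -/
def energyDensity [IsManifold (𝓡 n) ∞ N] (h h' : RMetric n N) (Φ : ℝ → N → N) (t : ℝ) (x : N) :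
    ℝ :=
  h'.inner (Φ t x) (tension h h' (Φ t) x) (tension h h' (Φ t) x)

namespace IsVariation

variable {ε : ℝ} {K : Set N} {Φ : ℝ → N → N}

theorem zero_mem (hΦ : IsVariation n ε K Φ) : (0 : ℝ) ∈ Ioo (-ε) ε :=
  ⟨by linarith [hΦ.pos], hΦ.pos⟩

theorem contMDiffAt (hΦ : IsVariation n ε K Φ) {t : ℝ} (ht : t ∈ Ioo (-ε) ε) (x : N) :
    ContMDiffAt (𝓘(ℝ, ℝ).prod (𝓡 n)) (𝓡 n) ∞ (fun q : ℝ × N ↦ Φ q.1 q.2) (t, x) :=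
  hΦ.smooth.contMDiffAt ((isOpen_Ioo.prod isOpen_univ).mem_nhds ⟨ht, mem_univ _⟩)

theorem contMDiff (hΦ : IsVariation n ε K Φ) {t : ℝ} (ht : t ∈ Ioo (-ε) ε) :
    ContMDiff (𝓡 n) (𝓡 n) ∞ (Φ t) := fun x ↦
  (hΦ.contMDiffAt ht x).comp x (contMDiffAt_const.prodMk contMDiffAt_id)

theorem zero_mem_chartDomain (hΦ : IsVariation n ε K Φ) {p : N} {u : Eu n}
    (hu : u ∈ (extChartAt (𝓡 n) p).target) : (0, u) ∈ chartDomain n p ε Φ :=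
  ⟨⟨hΦ.zero_mem, hu⟩, by
    simp only [mem_preimage, hΦ.map_zero]
    exact (extChartAt (𝓡 n) p).map_target hu⟩

theorem chartMap_zero (hΦ : IsVariation n ε K Φ) {p : N} {u : Eu n}
    (hu : u ∈ (extChartAt (𝓡 n) p).target) : chartMap n p Φ (0, u) = u := by
  simp only [chartMap, hΦ.map_zero]
  exact (extChartAt (𝓡 n) p).right_inv hu

variable [IsManifold (𝓡 n) ∞ N]

theorem contMDiffAt_comp_symm (hΦ : IsVariation n ε K Φ) (p : N) {q : ℝ × Eu n}
    (hq : q ∈ Ioo (-ε) ε ×ˢ (extChartAt (𝓡 n) p).target) :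
    ContMDiffAt 𝓘(ℝ, ℝ × Eu n) (𝓡 n) ∞
      (fun q : ℝ × Eu n ↦ Φ q.1 ((extChartAt (𝓡 n) p).symm q.2)) q := by
  have h1 : ContMDiffAt 𝓘(ℝ, ℝ × Eu n) 𝓘(ℝ, ℝ) ∞ (fun q : ℝ × Eu n ↦ q.1) q :=
    contDiffAt_fst.contMDiffAt
  have h2 : ContMDiffAt 𝓘(ℝ, ℝ × Eu n) 𝓘(ℝ, Eu n) ∞ (fun q : ℝ × Eu n ↦ q.2) q :=
    contDiffAt_snd.contMDiffAt
  have h3 := (contMDiffAt_extChartAt_symm hq.2).comp q h2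
  exact (hΦ.contMDiffAt hq.1 _).comp q (h1.prodMk h3)

theorem isOpen_chartDomain (hΦ : IsVariation n ε K Φ) (p : N) : IsOpen (chartDomain n p ε Φ) :=
  ContinuousOn.isOpen_inter_preimage
    (fun _ hq ↦ (hΦ.contMDiffAt_comp_symm p hq).continuousAt.continuousWithinAt)
    (isOpen_Ioo.prod (isOpen_extChartAt_target p)) (isOpen_extChartAt_source p)

theorem contDiffAt_chartMap (hΦ : IsVariation n ε K Φ) {p : N} {q : ℝ × Eu n}
    (hq : q ∈ chartDomain n p ε Φ) : ContDiffAt ℝ ∞ (chartMap n p Φ) q :=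
  contMDiffAt_iff_contDiffAt.1 (ContMDiffAt.comp q (contMDiffAt_extChartAt_of_mem hq.2)
    (hΦ.contMDiffAt_comp_symm p hq.1))

theorem contDiffAt_velocity (hΦ : IsVariation n ε K Φ) {p : N} {u : Eu n}
    (hu : u ∈ (extChartAt (𝓡 n) p).target) (k : Fin n) :
    ContDiffAt ℝ ∞ (velocity (n := n) p Φ k) u := by
  have h1 : ContDiffAt ℝ ∞ (timeDeriv fun q ↦ chartMap n p Φ q k) (0, u) :=
    contDiffAt_dirDeriv (contDiffAt_apply (hΦ.contDiffAt_chartMap (hΦ.zero_mem_chartDomain hu)) k) _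
  exact h1.comp u (contDiffAt_const.prodMk contDiffAt_id)

theorem hasDerivAt_chartMap (hΦ : IsVariation n ε K Φ) {p : N} {u : Eu n}
    (hu : u ∈ (extChartAt (𝓡 n) p).target) (k : Fin n) :
    HasDerivAt (fun t ↦ chartMap n p Φ (t, u) k) (velocity (n := n) p Φ k u) 0 :=
  hasDerivAt_slice (q := (0, u))
    (contDiffAt_apply (hΦ.contDiffAt_chartMap (hΦ.zero_mem_chartDomain hu)) k)

theorem velocity_eq_zero (hΦ : IsVariation n ε K Φ) {p : N} {u : Eu n}
    (hu : u ∈ (extChartAt (𝓡 n) p).target) (hK : (extChartAt (𝓡 n) p).symm u ∉ K) (k : Fin n) :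
    velocity (n := n) p Φ k u = 0 := by
  refine (hΦ.hasDerivAt_chartMap hu k).unique ((hasDerivAt_const (0 : ℝ) (u k)).congr_of_eventuallyEq ?_)
  filter_upwards [isOpen_Ioo.mem_nhds hΦ.zero_mem] with t ht
  simp only [chartMap]
  rw [hΦ.eq_off t ht _ hK, (extChartAt (𝓡 n) p).right_inv hu]

/-- The velocity field is a tangent vector. -/
theorem velocity_transform (hΦ : IsVariation n ε K Φ) {p q : N} {u : Eu n}
    (hu : u ∈ overlap n p q) (a : Fin n) :
    velocity (n := n) q Φ a (transition n p q u) =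
      ∑ c, pd c (fun w ↦ transition n p q w a) u * velocity (n := n) p Φ c u := by
  have h1 := hΦ.hasDerivAt_chartMap (transition_mapsTo p q hu).1 a
  have h2 := hasDerivAt_comp_curve (f := fun w ↦ transition n p q w a)
    (γ := fun t ↦ chartMap n p Φ (t, u)) (t := 0) (v := fun c ↦ velocity p Φ c u)
    (by simp only [hΦ.chartMap_zero hu.1]
        exact contDiffAt_apply (contDiffAt_transition p q hu) a)
    (fun c ↦ hΦ.hasDerivAt_chartMap hu.1 c)
  rw [hΦ.chartMap_zero hu.1] at h2
  refine h1.unique (h2.congr_of_eventuallyEq ?_)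
  have hev : ∀ᶠ t in 𝓝 (0 : ℝ), (t, u) ∈ chartDomain n p ε Φ :=
    (Continuous.prodMk_left u).continuousAt.eventually_mem
      ((hΦ.isOpen_chartDomain p).mem_nhds (hΦ.zero_mem_chartDomain hu.1))
  filter_upwards [hev] with t ht
  simp only [chartMap, symm_transition p q hu]
  rw [transition_extChartAt ht.2]

theorem energyDensity_eq (hΦ : IsVariation n ε K Φ) (h h' : RMetric n N) {p x : N}
    (hx : x ∈ (extChartAt (𝓡 n) p).source) {t : ℝ}
    (ht : (t, extChartAt (𝓡 n) p x) ∈ chartDomain n p ε Φ) :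
    energyDensity h h' Φ t x = tensionSq (gram h p) (gram h' p)
      (fun w ↦ chartMap n p Φ (t, w)) (extChartAt (𝓡 n) p x) := by
  refine inner_tension h h' (hΦ.contMDiff ht.1.1) hx ?_
  have := ht.2
  simpa only [mem_preimage, (extChartAt (𝓡 n) p).left_inv hx] using this

theorem contDiffAt_energyDensity (hΦ : IsVariation n ε K Φ) (h h' : RMetric n N) {p : N}
    {q : ℝ × Eu n} (hq : q ∈ chartDomain n p ε Φ) :
    ContDiffAt ℝ ∞ (fun q : ℝ × Eu n ↦ tensionSq (gram h p) (gram h' p)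
      (fun w ↦ chartMap n p Φ (q.1, w)) q.2) q :=
  contDiffAt_tensionSq (isMetric_gram h p) (isMetric_gram h' p) (hΦ.isOpen_chartDomain p)
    (fun _ hq ↦ hΦ.contDiffAt_chartMap hq) (fun _ hq ↦ hq.1.2)
    (fun _ hq ↦ (extChartAt (𝓡 n) p).map_source hq.2) hq

theorem eventually_mem_chartDomain (hΦ : IsVariation n ε K Φ) {p : N} {t : ℝ} {u : Eu n}
    (ht : (t, u) ∈ chartDomain n p ε Φ) : ∀ᶠ s in 𝓝 t, (s, u) ∈ chartDomain n p ε Φ :=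
  (Continuous.prodMk_left u).continuousAt.eventually_mem ((hΦ.isOpen_chartDomain p).mem_nhds ht)

/-- The derivative of the bienergy density along a variation. -/
theorem hasDerivAt_energyDensity (hΦ : IsVariation n ε K Φ) (h h' : RMetric n N) {p x : N}
    (hx : x ∈ (extChartAt (𝓡 n) p).source) :
    HasDerivAt (fun t ↦ energyDensity h h' Φ t x)
      (2 * idFirstVariation (gram h p) (gram h' p) (velocity p Φ) (extChartAt (𝓡 n) p x)) 0 := by
  have hu := (extChartAt (𝓡 n) p).map_source hx
  have h1 := hasDerivAt_tensionSq (F := chartMap n p Φ) (isMetric_gram h p) (isMetric_gram h' p)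
    (hΦ.isOpen_chartDomain p) (fun _ hq ↦ hΦ.contDiffAt_chartMap hq) (fun _ hq ↦ hq.1.2)
    (fun u hu ↦ hΦ.chartMap_zero hu.1.2) (hΦ.zero_mem_chartDomain hu)
  refine h1.congr_of_eventuallyEq ?_
  filter_upwards [hΦ.eventually_mem_chartDomain (hΦ.zero_mem_chartDomain hu)] with t ht
  exact hΦ.energyDensity_eq h h' hx ht

/-- At times other than `0` no formula is needed; differentiability and a continuous derivative are
enough for the domination argument. -/
theorem hasDerivAt_energyDensity_of_mem (hΦ : IsVariation n ε K Φ) (h h' : RMetric n N) {p x : N}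
    (hx : x ∈ (extChartAt (𝓡 n) p).source) {t : ℝ}
    (ht : (t, extChartAt (𝓡 n) p x) ∈ chartDomain n p ε Φ) :
    HasDerivAt (fun t ↦ energyDensity h h' Φ t x)
      (timeDeriv (fun q : ℝ × Eu n ↦ tensionSq (gram h p) (gram h' p)
        (fun w ↦ chartMap n p Φ (q.1, w)) q.2) (t, extChartAt (𝓡 n) p x)) t := by
  have h1 := hasDerivAt_slice (q := (t, extChartAt (𝓡 n) p x)) (hΦ.contDiffAt_energyDensity h h' ht)
  refine h1.congr_of_eventuallyEq ?_
  filter_upwards [hΦ.eventually_mem_chartDomain ht] with s hs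
  exact hΦ.energyDensity_eq h h' hx hs

theorem continuous_deriv_energyDensity (hΦ : IsVariation n ε K Φ) (h h' : RMetric n N) :
    Continuous fun x ↦ deriv (fun t ↦ energyDensity h h' Φ t x) 0 := by
  refine continuous_iff_continuousAt.2 fun x ↦ ?_
  have hx := mem_extChartAt_source (I := 𝓡 n) x
  have h0 := hΦ.zero_mem_chartDomain ((extChartAt (𝓡 n) x).map_source hx)
  have h1 := (contDiffAt_dirDeriv (hΦ.contDiffAt_energyDensity h h' h0) (1, 0)).continuousAt
  have h2 : ContinuousAt (fun y ↦ ((0 : ℝ), extChartAt (𝓡 n) x y)) x :=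
    continuousAt_const.prodMk (continuousAt_extChartAt x)
  refine (ContinuousAt.comp (x := x) (f := fun y ↦ ((0 : ℝ), extChartAt (𝓡 n) x y)) h1 h2).congr ?_
  filter_upwards [extChartAt_source_mem_nhds (I := 𝓡 n) x] with y hy
  exact (hΦ.hasDerivAt_energyDensity_of_mem h h' hy (hΦ.zero_mem_chartDomain
    ((extChartAt (𝓡 n) x).map_source hy))).deriv.symm

/-- Local regularity of the bienergy density along a variation. -/
theorem exists_local_bound (hΦ : IsVariation n ε K Φ) (h h' : RMetric n N) (x : N) :
    ∃ W ∈ 𝓝 x, ∃ δ > 0, ∃ C : ℝ, ∀ y ∈ W,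
      (∀ t ∈ Ioo (-δ) δ, DifferentiableAt ℝ (fun t ↦ energyDensity h h' Φ t y) t ∧
        ‖deriv (fun t ↦ energyDensity h h' Φ t y) t‖ ≤ C ∧
        ContinuousAt (energyDensity h h' Φ t) y) := by
  have hx := mem_extChartAt_source (I := 𝓡 n) x
  have hu := (extChartAt (𝓡 n) x).map_source hx
  let f : ℝ × Eu n → ℝ := fun q ↦ tensionSq (gram h x) (gram h' x)
    (fun w ↦ chartMap n x Φ (q.1, w)) q.2
  have h0 := hΦ.zero_mem_chartDomain hu
  have hc : ContinuousAt (timeDeriv f) (0, extChartAt (𝓡 n) x x) :=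
    (contDiffAt_dirDeriv (hΦ.contDiffAt_energyDensity h h' h0) _).continuousAt
  have hev : ∀ᶠ q in 𝓝 ((0 : ℝ), extChartAt (𝓡 n) x x),
      q ∈ chartDomain n x ε Φ ∧ ‖timeDeriv f q‖ < ‖timeDeriv f (0, extChartAt (𝓡 n) x x)‖ + 1 :=
    Filter.Eventually.and ((hΦ.isOpen_chartDomain x).mem_nhds h0)
      (hc.norm.eventually_lt_const (lt_add_one _))
  have hmap : Filter.Tendsto (fun q : ℝ × N ↦ (q.1, extChartAt (𝓡 n) x q.2)) (𝓝 (0, x))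
      (𝓝 ((0 : ℝ), extChartAt (𝓡 n) x x)) :=
    ContinuousAt.prodMap continuousAt_id (continuousAt_extChartAt x)
  have hev2 := hmap.eventually hev
  -- Splitting the neighbourhood of `(0, x)` into a product makes the time interval and the bound
  -- uniform over nearby points.
  rw [nhds_prod_eq] at hev2
  obtain ⟨P, hP, Q, hQ, hPQ⟩ := Filter.eventually_prod_iff.1 hev2
  obtain ⟨δ, hδ, hδP⟩ := Metric.eventually_nhds_iff.1 hP
  refine ⟨{y | Q y} ∩ (extChartAt (𝓡 n) x).source,
    Filter.inter_mem hQ (extChartAt_source_mem_nhds x), δ, hδ,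
    ‖timeDeriv f (0, extChartAt (𝓡 n) x x)‖ + 1, fun y hy t ht ↦ ?_⟩
  have htP : P t := hδP (by rw [Real.dist_eq, sub_zero, abs_lt]; exact ht)
  obtain ⟨hmem, hlt⟩ := hPQ htP hy.1
  have hd := hΦ.hasDerivAt_energyDensity_of_mem h h' hy.2 hmem
  refine ⟨hd.differentiableAt, ?_, ?_⟩
  · rw [hd.deriv]; exact hlt.le
  · have hcf : ContinuousAt (fun z ↦ f (t, extChartAt (𝓡 n) x z)) y :=
      ContinuousAt.comp (f := fun z ↦ (t, extChartAt (𝓡 n) x z)) (g := f)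
        (hΦ.contDiffAt_energyDensity h h' hmem).continuousAt
        (continuousAt_const.prodMk (contMDiffAt_extChartAt_of_mem hy.2).continuousAt)
    have hcm : ∀ᶠ z in 𝓝 y, (t, extChartAt (𝓡 n) x z) ∈ chartDomain n x ε Φ :=
      (continuousAt_const.prodMk (contMDiffAt_extChartAt_of_mem hy.2).continuousAt).eventually_mem
        ((hΦ.isOpen_chartDomain x).mem_nhds hmem)
    refine hcf.congr ?_
    filter_upwards [hcm, (isOpen_extChartAt_source (I := 𝓡 n) x).mem_nhds hy.2] with z hz hzs
    exact (hΦ.energyDensity_eq h h' hzs hz).symm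

end IsVariation

end Variations

/-! ### The Riemannian volume in charts -/

section Volume

variable {n : ℕ} {N : Type*} [TopologicalSpace N] [ChartedSpace (Eu n) N]

theorem det_fderiv {ψ : Eu n → Eu n} {u : Eu n} (hψ : ContDiffAt ℝ ∞ ψ u) :
    (fderiv ℝ ψ u).det = (jac ψ u).det := by
  rw [ContinuousLinearMap.det, ← LinearMap.det_toMatrix (EuclideanSpace.basisFun (Fin n) ℝ).toBasis]
  congr 1
  ext a i
  rw [LinearMap.toMatrix_apply]
  simp only [OrthonormalBasis.coe_toBasis, EuclideanSpace.basisFun_apply,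
    OrthonormalBasis.coe_toBasis_repr_apply, EuclideanSpace.basisFun_repr,
    ContinuousLinearMap.coe_coe]
  rw [fderiv_apply_coord hψ]
  simp [jac]

/-- The determinant of `Jᵀ H J` is `(det J)² det H`. This is the Jacobian factor that makes the
chart measures agree on overlaps. -/
theorem IsIsometricOn.sqrt_det {G H : Eu n → Matrix (Fin n) (Fin n) ℝ} {U W A : Set (Eu n)}
    {ψ : Eu n → Eu n} {u : Eu n} (h : IsIsometricOn G U H W ψ A) (hu : u ∈ A) :
    Real.sqrt (G u).det = |(jac ψ u).det| * Real.sqrt (H (ψ u)).det := by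
  rw [h.gram_eq u hu, Matrix.det_mul, Matrix.det_mul, Matrix.det_transpose, mul_comm, ← mul_assoc,
    Real.sqrt_mul (mul_self_nonneg _), Real.sqrt_mul_self_eq_abs]

/-- The inverse chart is continuous only on its target, so the preimage is taken in that subtype and
then mapped into the ambient space. -/
theorem measurableSet_target_inter_preimage [MeasurableSpace N] [BorelSpace N] (p : N) {A : Set N}
    (hA : MeasurableSet A) :
    MeasurableSet ((extChartAt (𝓡 n) p).target ∩ (extChartAt (𝓡 n) p).symm ⁻¹' A) := by
  have h1 := (continuousOn_iff_continuous_domRestrict.1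
    (continuousOn_extChartAt_symm (I := 𝓡 n) p)).measurable hA
  have h2 := (isOpen_extChartAt_target (I := 𝓡 n) p).measurableSet.subtype_image h1
  convert! h2 using 1
  ext u
  simp only [mem_inter_iff, mem_preimage, mem_image, domRestrict_apply, Subtype.exists, exists_and_left,
    exists_prop, exists_eq_right_right]
  tauto

variable [IsManifold (𝓡 n) ∞ N] [MeasurableSpace N]

/-- The measure `√(det gᵢⱼ) du` on the domain of the chart around `p`. -/
def chartVolume (g : RMetric n N) (p : N) : Measure N :=
  Measure.map (extChartAt (𝓡 n) p).symm
    ((volume.restrict (extChartAt (𝓡 n) p).target).withDensity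
      fun u ↦ ENNReal.ofReal (Real.sqrt (gram g p u).det))

variable [BorelSpace N]

theorem aemeasurable_extChartAt_symm (g : RMetric n N) (p : N) :
    AEMeasurable (extChartAt (𝓡 n) p).symm
      ((volume.restrict (extChartAt (𝓡 n) p).target).withDensity
        fun u ↦ ENNReal.ofReal (Real.sqrt (gram g p u).det)) :=
  ((continuousOn_extChartAt_symm p).aemeasurable
    (isOpen_extChartAt_target p).measurableSet).mono_ac (withDensity_absolutelyContinuous _ _)

theorem chartVolume_apply (g : RMetric n N) (p : N) {A : Set N} (hA : MeasurableSet A) :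
    chartVolume g p A =
      ∫⁻ u in (extChartAt (𝓡 n) p).target ∩ (extChartAt (𝓡 n) p).symm ⁻¹' A,
        ENNReal.ofReal (Real.sqrt (gram g p u).det) := by
  rw [chartVolume, Measure.map_apply_of_aemeasurable (aemeasurable_extChartAt_symm g p) hA,
    withDensity_apply', Measure.restrict_restrict' (isOpen_extChartAt_target p).measurableSet,
    inter_comm]

theorem chartVolume_source_compl (g : RMetric n N) (p : N) :
    chartVolume g p (extChartAt (𝓡 n) p).sourceᶜ = 0 := by
  rw [chartVolume_apply g p (isOpen_extChartAt_source p).measurableSet.compl]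
  have : (extChartAt (𝓡 n) p).target ∩
      (extChartAt (𝓡 n) p).symm ⁻¹' (extChartAt (𝓡 n) p).sourceᶜ = ∅ := by
    ext u
    simp only [mem_inter_iff, mem_preimage, mem_compl_iff, mem_empty_iff_false, iff_false, not_and,
      not_not]
    exact fun hu ↦ (extChartAt (𝓡 n) p).map_target hu
  rw [this]
  simp

theorem chartVolume_sdiff_source (g : RMetric n N) (p : N) (A : Set N) :
    chartVolume g p (A \ (extChartAt (𝓡 n) p).source) = 0 :=
  measure_mono_null (fun _ hx ↦ hx.2) (chartVolume_source_compl g p)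

/-- The chart measures agree on overlaps. -/
theorem chartVolume_eq_of_subset (g : RMetric n N) (p q : N) {A : Set N} (hA : MeasurableSet A)
    (hp : A ⊆ (extChartAt (𝓡 n) p).source) (hq : A ⊆ (extChartAt (𝓡 n) q).source) :
    chartVolume g p A = chartVolume g q A := by
  rw [chartVolume_apply g p hA, chartVolume_apply g q hA]
  set T := (extChartAt (𝓡 n) p).target ∩ (extChartAt (𝓡 n) p).symm ⁻¹' A with hT
  have hTo : T ⊆ overlap n p q := fun u hu ↦ ⟨hu.1, hq hu.2⟩
  have himage : (extChartAt (𝓡 n) q).target ∩ (extChartAt (𝓡 n) q).symm ⁻¹' A =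
      transition n p q '' T := by
    ext v
    constructor
    · rintro ⟨hv, hvA⟩
      have hvo : v ∈ overlap n q p := ⟨hv, hp hvA⟩
      refine ⟨transition n q p v, ⟨(transition_mapsTo q p hvo).1, ?_⟩,
        transition_transition q p hvo⟩
      rw [mem_preimage, symm_transition q p hvo]
      exact hvA
    · rintro ⟨u, hu, rfl⟩
      refine ⟨(transition_mapsTo p q (hTo hu)).1, ?_⟩
      rw [mem_preimage, symm_transition p q (hTo hu)]
      exact hu.2
  have hinj : InjOn (transition n p q) T := fun u hu v hv huv ↦ by
    rw [← transition_transition p q (hTo hu), ← transition_transition p q (hTo hv), huv]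
  have hTm : MeasurableSet T := measurableSet_target_inter_preimage p hA
  -- Change of variables along the transition map, which is injective on `T` because the reverse
  -- transition undoes it.
  rw [himage, lintegral_image_eq_lintegral_abs_det_fderiv_mul volume hTm
    (fun u hu ↦ ((contDiffAt_transition p q (hTo hu)).differentiableAt
      (by simp)).hasFDerivAt.hasFDerivWithinAt) hinj]
  refine setLIntegral_congr_fun hTm fun u hu ↦ ?_
  rw [(isIsometricOn_transition g p q).sqrt_det (hTo hu), det_fderiv
    (contDiffAt_transition p q (hTo hu)), ENNReal.ofReal_mul (abs_nonneg _)]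

theorem riemannianVolume_eq_of_subset (g : RMetric n N) (p : N) {A : Set N} (hA : MeasurableSet A)
    (hp : A ⊆ (extChartAt (𝓡 n) p).source) : riemannianVolume g A = chartVolume g p A := by
  have hS := (isOpen_extChartAt_source (I := 𝓡 n) p).measurableSet
  have hle (q : N) : chartVolume g q ≤ riemannianVolume g :=
    le_iSup (fun q ↦ chartVolume g q) q
  refine le_antisymm ?_ (hle p A)
  -- A supremum of measures is not computed set by set, so it is bounded by a measure that dominates
  -- every chart measure: inside the source of `p` the chart measures agree on overlaps, and outside
  -- it the supremum itself serves as the bound.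
  have h1 : riemannianVolume g ≤
      chartVolume g p + (riemannianVolume g).restrict (extChartAt (𝓡 n) p).sourceᶜ := by
    refine iSup_le fun q ↦ ?_
    change chartVolume g q ≤ _
    refine Measure.le_iff.2 fun B hB ↦ ?_
    rw [← measure_inter_add_sdiff B hS, Measure.add_apply, Measure.restrict_apply hB]
    refine add_le_add ?_ (hle q _)
    have hSq := (isOpen_extChartAt_source (I := 𝓡 n) q).measurableSet
    rw [← measure_inter_add_sdiff (B ∩ (extChartAt (𝓡 n) p).source) hSq,
      chartVolume_sdiff_source, add_zero,
      ← chartVolume_eq_of_subset g p q ((hB.inter hS).inter hSq) (fun x hx ↦ hx.1.2)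
        (fun x hx ↦ hx.2)]
    exact measure_mono fun x hx ↦ hx.1.1
  refine (h1 A).trans ?_
  rw [Measure.add_apply, Measure.restrict_apply hA]
  rw [show A ∩ (extChartAt (𝓡 n) p).sourceᶜ = ∅ from sdiff_eq_empty.2 hp, measure_empty, add_zero]

theorem riemannianVolume_restrict_source (g : RMetric n N) (p : N) :
    (riemannianVolume g).restrict (extChartAt (𝓡 n) p).source = chartVolume g p := by
  have hS := (isOpen_extChartAt_source (I := 𝓡 n) p).measurableSet
  ext A hA
  rw [Measure.restrict_apply hA, riemannianVolume_eq_of_subset g p (hA.inter hS) fun x hx ↦ hx.2,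
    ← measure_inter_add_sdiff (μ := chartVolume g p) A hS,
    chartVolume_sdiff_source, add_zero]

/-- The Riemannian volume is finite near every point. -/
theorem exists_nhds_riemannianVolume_lt_top (g : RMetric n N) (x : N) :
    ∃ W ∈ 𝓝 x, riemannianVolume g W < ⊤ := by
  have hx := mem_extChartAt_source (I := 𝓡 n) x
  have hu := (extChartAt (𝓡 n) x).map_source hx
  obtain ⟨C, hC, hCt, hCc⟩ := local_compact_nhds ((isOpen_extChartAt_target (I := 𝓡 n) x).mem_nhds hu)
  let W := (extChartAt (𝓡 n) x).source ∩ extChartAt (𝓡 n) x ⁻¹' interior C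
  have hW : IsOpen W := (continuousOn_extChartAt x).isOpen_inter_preimage
    (isOpen_extChartAt_source x) isOpen_interior
  refine ⟨W, hW.mem_nhds ⟨hx, mem_interior_iff_mem_nhds.2 hC⟩, ?_⟩
  rw [riemannianVolume_eq_of_subset g x hW.measurableSet fun y hy ↦ hy.1,
    chartVolume_apply g x hW.measurableSet]
  have hsub : (extChartAt (𝓡 n) x).target ∩ (extChartAt (𝓡 n) x).symm ⁻¹' W ⊆ C := fun u hu ↦ by
    have := hu.2.2
    rw [mem_preimage, (extChartAt (𝓡 n) x).right_inv hu.1] at this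
    exact interior_subset this
  refine (lintegral_mono_set hsub).trans_lt ?_
  have hint : IntegrableOn (fun u ↦ Real.sqrt (gram g x u).det) C :=
    ContinuousOn.integrableOn_compact hCc fun u hu ↦
      ((isMetric_gram g x).smooth_sqrt_det (hCt hu)).continuousAt.continuousWithinAt
  exact hint.lintegral_lt_top

theorem riemannianVolume_lt_top (g : RMetric n N) {K : Set N} (hK : IsCompact K) :
    riemannianVolume g K < ⊤ :=
  hK.measure_lt_top_of_nhdsWithin fun x _ ↦ by
    obtain ⟨W, hW, hlt⟩ := exists_nhds_riemannianVolume_lt_top g x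
    exact ⟨W, mem_nhdsWithin_of_mem_nhds hW, hlt⟩

/-- Integration of a function supported in a chart domain. -/
theorem setIntegral_riemannianVolume (g : RMetric n N) {p : N} {K : Set N} (hK : MeasurableSet K)
    {D : N → ℝ} (hD : ContinuousOn D (extChartAt (𝓡 n) p).source)
    (h0 : ∀ x, x ∉ K ∩ (extChartAt (𝓡 n) p).source → D x = 0) :
    ∫ x in K, D x ∂(riemannianVolume g) =
      ∫ u in (extChartAt (𝓡 n) p).target,
        D ((extChartAt (𝓡 n) p).symm u) * Real.sqrt (gram g p u).det := by
  have hS := (isOpen_extChartAt_source (I := 𝓡 n) p).measurableSet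
  have h1 : ∫ x in K, D x ∂(riemannianVolume g) =
      ∫ x in (extChartAt (𝓡 n) p).source, D x ∂(riemannianVolume g) := by
    rw [setIntegral_eq_of_subset_of_forall_sdiff_eq_zero hK inter_subset_left
        (s := K ∩ (extChartAt (𝓡 n) p).source) (fun x hx ↦ h0 x hx.2),
      setIntegral_eq_of_subset_of_forall_sdiff_eq_zero hS inter_subset_right
        (s := K ∩ (extChartAt (𝓡 n) p).source) (fun x hx ↦ h0 x hx.2)]
  have hm : AEStronglyMeasurable D (chartVolume g p) := by
    rw [← riemannianVolume_restrict_source]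
    exact hD.aestronglyMeasurable hS
  have hden : AEMeasurable (fun u ↦ ENNReal.ofReal (Real.sqrt (gram g p u).det))
      (volume.restrict (extChartAt (𝓡 n) p).target) := by
    refine AEMeasurable.ennreal_ofReal (ContinuousOn.aemeasurable (fun u hu ↦ ?_)
      (isOpen_extChartAt_target p).measurableSet)
    exact ((isMetric_gram g p).smooth_sqrt_det hu).continuousAt.continuousWithinAt
  rw [h1, riemannianVolume_restrict_source, chartVolume,
    integral_map (aemeasurable_extChartAt_symm g p) hm,
    integral_withDensity_eq_integral_toReal_smul₀ hden (by simp)]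
  refine integral_congr_ae (Filter.Eventually.of_forall fun u ↦ ?_)
  simp only [ENNReal.toReal_ofReal (Real.sqrt_nonneg _), smul_eq_mul]
  ring

end Volume

/-! ### The first variation of the bienergy -/

section Smoothness

variable {n : ℕ} {G G' : Eu n → Matrix (Fin n) (Fin n) ℝ} {U : Set (Eu n)} {u : Eu n}

theorem smooth_eulerLagrange {gi g' : Fin n → Fin n → Eu n → ℝ}
    {Γ Γ' : Fin n → Fin n → Fin n → Eu n → ℝ} {τ η : Fin n → Eu n → ℝ}
    (hgi : ∀ i j, ContDiffAt ℝ ∞ (gi i j) u) (hΓ : ∀ k i j, ContDiffAt ℝ ∞ (Γ k i j) u)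
    (hg' : ∀ i j, ContDiffAt ℝ ∞ (g' i j) u) (hΓ' : ∀ k i j, ContDiffAt ℝ ∞ (Γ' k i j) u)
    (hτ : ∀ k, ContDiffAt ℝ ∞ (τ k) u) (hη : ∀ k, ContDiffAt ℝ ∞ (η k) u) (c : Fin n) :
    ContDiffAt ℝ ∞ (eulerLagrange gi Γ g' Γ' τ η c) u := by
  unfold eulerLagrange divergence
  fun_prop

theorem IsMetric.smooth_idTension (hG : IsMetric G U) (hG' : IsMetric G' U) (hu : u ∈ U)
    (k : Fin n) : ContDiffAt ℝ ∞ (idTension G G' k) u :=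
  ContDiffAt.sum fun i _ ↦ ContDiffAt.sum fun j _ ↦
    (hG.smooth_inv hu i j).mul ((hG'.smooth_chr hu k i j).sub (hG.smooth_chr hu k i j))

theorem IsMetric.smooth_idTensionForm (hG : IsMetric G U) (hG' : IsMetric G' U) (hu : u ∈ U)
    (k : Fin n) : ContDiffAt ℝ ∞ (idTensionForm G G' k) u :=
  ContDiffAt.sum fun l _ ↦ (hG'.smooth u hu k l).mul (hG.smooth_idTension hG' hu l)

theorem IsMetric.smooth_idEulerLagrange (hG : IsMetric G U) (hG' : IsMetric G' U) (hu : u ∈ U)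
    (c : Fin n) : ContDiffAt ℝ ∞ (idEulerLagrange G G' c) u :=
  smooth_eulerLagrange (hG.smooth_inv hu) (hG.smooth_chr hu) (hG'.smooth u hu) (hG'.smooth_chr hu)
    (hG.smooth_idTension hG' hu) (hG.smooth_idTensionForm hG' hu) c

/-- Second derivatives of the field occur, so agreement near the point is required. -/
theorem firstVariation_congr {gi g' : Fin n → Fin n → Eu n → ℝ}
    {Γ Γ' : Fin n → Fin n → Fin n → Eu n → ℝ} {τ η V W : Fin n → Eu n → ℝ}
    (h : ∀ k, V k =ᶠ[𝓝 u] W k) :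
    firstVariation gi Γ g' Γ' τ η V u = firstVariation gi Γ g' Γ' τ η W u := by
  simp only [firstVariation, (h _).eq_of_nhds, pd_congr (h _), pd_congr (pd_congr_nhds (h _) _)]

theorem firstVariation_zero {gi g' : Fin n → Fin n → Eu n → ℝ}
    {Γ Γ' : Fin n → Fin n → Fin n → Eu n → ℝ} {τ η : Fin n → Eu n → ℝ} :
    firstVariation gi Γ g' Γ' τ η (fun _ _ ↦ 0) u = 0 := by
  have (i : Fin n) : pd i (fun _ : Eu n ↦ (0 : ℝ)) = fun _ ↦ 0 := funext fun _ ↦ pd_const 0 i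
  simp [firstVariation, this]

theorem firstVariation_add {gi g' : Fin n → Fin n → Eu n → ℝ}
    {Γ Γ' : Fin n → Fin n → Fin n → Eu n → ℝ} {τ η V W : Fin n → Eu n → ℝ} (hU : IsOpen U)
    (hu : u ∈ U) (hV : ∀ w ∈ U, ∀ k, ContDiffAt ℝ ∞ (V k) w)
    (hW : ∀ w ∈ U, ∀ k, ContDiffAt ℝ ∞ (W k) w) :
    firstVariation gi Γ g' Γ' τ η (fun k w ↦ V k w + W k w) u =
      firstVariation gi Γ g' Γ' τ η V u + firstVariation gi Γ g' Γ' τ η W u := by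
  have h1 (j k : Fin n) : pd j (fun w ↦ V k w + W k w) =ᶠ[𝓝 u]
      fun w ↦ pd j (V k) w + pd j (W k) w := by
    filter_upwards [hU.mem_nhds hu] with w hw
    exact pd_add (hV w hw k) (hW w hw k) j
  have h2 (i j k : Fin n) : pd i (pd j (fun w ↦ V k w + W k w)) u =
      pd i (pd j (V k)) u + pd i (pd j (W k)) u := by
    rw [pd_congr (h1 j k), pd_add (contDiffAt_pd (hV u hu k) j) (contDiffAt_pd (hW u hu k) j)]
  simp only [firstVariation, h2, (h1 _ _).eq_of_nhds]
  simp only [add_mul, mul_add, mul_sub, Finset.sum_add_distrib, Finset.sum_sub_distrib]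
  ring

theorem firstVariation_sum {gi g' : Fin n → Fin n → Eu n → ℝ}
    {Γ Γ' : Fin n → Fin n → Fin n → Eu n → ℝ} {τ η : Fin n → Eu n → ℝ} {ι : Type*} (s : Finset ι)
    {V : ι → Fin n → Eu n → ℝ} (hU : IsOpen U) (hu : u ∈ U)
    (hV : ∀ b, ∀ w ∈ U, ∀ k, ContDiffAt ℝ ∞ (V b k) w) :
    firstVariation gi Γ g' Γ' τ η (fun k w ↦ ∑ b ∈ s, V b k w) u =
      ∑ b ∈ s, firstVariation gi Γ g' Γ' τ η (V b) u := by
  classical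
  induction s using Finset.induction_on with
  | empty => simp only [Finset.sum_empty, firstVariation_zero]
  | insert b s hb ih =>
    simp only [Finset.sum_insert hb]
    rw [firstVariation_add hU hu (hV b) (fun w hw k ↦ ContDiffAt.sum fun a _ ↦ hV a w hw k), ih]

end Smoothness

/-! ### Differentiation of the bienergy along a variation. -/

section Bienergy

variable {n : ℕ} {N : Type*} [TopologicalSpace N] [ChartedSpace (Eu n) N]
  [IsManifold (𝓡 n) ∞ N] {ε : ℝ} {K L : Set N} {Φ : ℝ → N → N}

namespace IsVariation

/-- Compactness patches the local bounds: a union of two sets is handled by the smaller time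
interval and the larger constant. -/
theorem exists_uniform_bound (hΦ : IsVariation n ε K Φ) (h h' : RMetric n N) (hL : IsCompact L) :
    ∃ δ > 0, ∃ C : ℝ, ∀ y ∈ L, ∀ t ∈ Ioo (-δ) δ,
      DifferentiableAt ℝ (fun t ↦ energyDensity h h' Φ t y) t ∧
        ‖deriv (fun t ↦ energyDensity h h' Φ t y) t‖ ≤ C ∧
        ContinuousAt (energyDensity h h' Φ t) y := by
  refine hL.induction_on (p := fun L ↦ ∃ δ > 0, ∃ C : ℝ, ∀ y ∈ L, ∀ t ∈ Ioo (-δ) δ,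
      DifferentiableAt ℝ (fun t ↦ energyDensity h h' Φ t y) t ∧
        ‖deriv (fun t ↦ energyDensity h h' Φ t y) t‖ ≤ C ∧
        ContinuousAt (energyDensity h h' Φ t) y) ?_ ?_ ?_ ?_
  · exact ⟨1, one_pos, 0, fun y hy ↦ hy.elim⟩
  · rintro A B hAB ⟨δ, hδ, C, hC⟩
    exact ⟨δ, hδ, C, fun y hy ↦ hC y (hAB hy)⟩
  · rintro A B ⟨δ₁, hδ₁, C₁, hC₁⟩ ⟨δ₂, hδ₂, C₂, hC₂⟩
    refine ⟨min δ₁ δ₂, lt_min hδ₁ hδ₂, max C₁ C₂, fun y hy t ht ↦ ?_⟩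
    have ht₁ : t ∈ Ioo (-δ₁) δ₁ :=
      ⟨by linarith [ht.1, min_le_left δ₁ δ₂], ht.2.trans_le (min_le_left _ _)⟩
    have ht₂ : t ∈ Ioo (-δ₂) δ₂ :=
      ⟨by linarith [ht.1, min_le_right δ₁ δ₂], ht.2.trans_le (min_le_right _ _)⟩
    rcases hy with hy | hy
    · obtain ⟨a, b, c⟩ := hC₁ y hy t ht₁
      exact ⟨a, b.trans (le_max_left _ _), c⟩
    · obtain ⟨a, b, c⟩ := hC₂ y hy t ht₂
      exact ⟨a, b.trans (le_max_right _ _), c⟩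
  · intro x _
    obtain ⟨W, hW, hb⟩ := hΦ.exists_local_bound h h' x
    exact ⟨W, mem_nhdsWithin_of_mem_nhds hW, by
      obtain ⟨δ, hδ, C, hC⟩ := hb
      exact ⟨δ, hδ, C, hC⟩⟩

theorem deriv_energyDensity (hΦ : IsVariation n ε K Φ) (h h' : RMetric n N) {p x : N}
    (hx : x ∈ (extChartAt (𝓡 n) p).source) :
    deriv (fun t ↦ energyDensity h h' Φ t x) 0 =
      2 * idFirstVariation (gram h p) (gram h' p) (velocity p Φ) (extChartAt (𝓡 n) p x) :=
  (hΦ.hasDerivAt_energyDensity h h' hx).deriv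

/-- Closedness of `K` turns pointwise vanishing off `K` into vanishing near the point, so the
derivatives of the velocity vanish there too. -/
theorem velocity_eventually_eq_zero (hΦ : IsVariation n ε K Φ) (hK : IsClosed K) {p x : N}
    (hx : x ∈ (extChartAt (𝓡 n) p).source) (hxK : x ∉ K) (k : Fin n) :
    velocity p Φ k =ᶠ[𝓝 (extChartAt (𝓡 n) p x)] fun _ ↦ 0 := by
  have hu := (extChartAt (𝓡 n) p).map_source hx
  have hc := (contMDiffAt_extChartAt_symm hu).continuousAt
  have hmem : Kᶜ ∈ 𝓝 ((extChartAt (𝓡 n) p).symm (extChartAt (𝓡 n) p x)) := by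
    rw [(extChartAt (𝓡 n) p).left_inv hx]
    exact hK.isOpen_compl.mem_nhds hxK
  filter_upwards [hc hmem, (isOpen_extChartAt_target p).mem_nhds hu] with w hw hwt
  exact hΦ.velocity_eq_zero hwt hw k

theorem deriv_energyDensity_eq_zero (hΦ : IsVariation n ε K Φ) (hK : IsClosed K)
    (h h' : RMetric n N) {x : N} (hx : x ∉ K) :
    deriv (fun t ↦ energyDensity h h' Φ t x) 0 = 0 := by
  rw [hΦ.deriv_energyDensity h h' (mem_extChartAt_source x), idFirstVariation,
    firstVariation_congr (hΦ.velocity_eventually_eq_zero hK (mem_extChartAt_source x) hx),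
    firstVariation_zero, mul_zero]

variable [T2Space N] [MeasurableSpace N] [BorelSpace N]

/-- Differentiation of the bienergy under the integral sign. -/
theorem hasDerivAt_bienergy (hΦ : IsVariation n ε K Φ) (h h' : RMetric n N) (hL : IsCompact L) :
    HasDerivAt (fun t ↦ bienergy h h' L (Φ t))
      (1 / 2 * ∫ x in L, deriv (fun t ↦ energyDensity h h' Φ t x) 0 ∂(riemannianVolume h)) 0 := by
  obtain ⟨δ, hδ, C, hC⟩ := hΦ.exists_uniform_bound h h' hL
  have hfin : IsFiniteMeasure ((riemannianVolume h).restrict L) :=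
    ⟨by rw [Measure.restrict_apply_univ]; exact riemannianVolume_lt_top h hL⟩
  have hLm := hL.measurableSet
  have h0 : (0 : ℝ) ∈ Ioo (-δ) δ := ⟨by linarith, hδ⟩
  have hmeas (t : ℝ) (ht : t ∈ Ioo (-δ) δ) : ContinuousOn (energyDensity h h' Φ t) L :=
    fun y hy ↦ (hC y hy t ht).2.2.continuousWithinAt
  -- The constant `C` is an integrable bound because a compact set has finite Riemannian volume.
  refine HasDerivAt.const_mul _ (hasDerivAt_integral_of_dominated_loc_of_deriv_le
    (F := fun t x ↦ energyDensity h h' Φ t x)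
    (F' := fun t x ↦ deriv (fun t ↦ energyDensity h h' Φ t x) t) (bound := fun _ ↦ C)
    (isOpen_Ioo.mem_nhds h0) ?_ ?_ ?_ ?_ ?_ ?_).2
  · filter_upwards [isOpen_Ioo.mem_nhds h0] with t ht
    exact (hmeas t ht).aestronglyMeasurable hLm
  · have hb := (hmeas 0 h0).norm
    obtain ⟨B, hB⟩ := hL.bddAbove_image hb
    refine Integrable.mono' (integrable_const B) ((hmeas 0 h0).aestronglyMeasurable hLm) ?_
    filter_upwards [ae_restrict_mem hLm] with x hx
    exact hB (mem_image_of_mem _ hx)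
  · exact (hΦ.continuous_deriv_energyDensity h h').aestronglyMeasurable
  · filter_upwards [ae_restrict_mem hLm] with x hx t ht
    exact (hC x hx t ht).2.1
  · exact integrable_const C
  · filter_upwards [ae_restrict_mem hLm] with x hx t ht
    exact (hC x hx t ht).1.hasDerivAt

/-- The first variation of the bienergy along a variation supported in a chart domain. -/
theorem setIntegral_deriv_energyDensity (hΦ : IsVariation n ε K Φ) (h h' : RMetric n N)
    (hK : IsCompact K) {p : N} (hKp : K ⊆ (extChartAt (𝓡 n) p).source) (hL : MeasurableSet L)
    (hKL : K ⊆ L) :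
    ∫ x in L, deriv (fun t ↦ energyDensity h h' Φ t x) 0 ∂(riemannianVolume h) =
      2 * ∫ u in (extChartAt (𝓡 n) p).target,
        (∑ c, idEulerLagrange (gram h p) (gram h' p) c u * velocity p Φ c u) *
          Real.sqrt (gram h p u).det := by
  have hG := isMetric_gram h p
  have hG' := isMetric_gram h' p
  rw [setIntegral_riemannianVolume h hL
    (hΦ.continuous_deriv_energyDensity h h').continuousOn fun x hx ↦
      hΦ.deriv_energyDensity_eq_zero hK.isClosed h h' fun hxK ↦ hx ⟨hKL hxK, hKp hxK⟩]
  -- The velocity vanishes off the image of `K` in the chart, a compact subset of the target, so the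
  -- integration by parts has no boundary contribution.
  have h1 := hG.setIntegral_firstVariation (C := extChartAt (𝓡 n) p '' K)
    (g' := fun i j w ↦ gram h' p w i j) (Γ' := chr (gram h' p))
    (τ := idTension (gram h p) (gram h' p)) (η := idTensionForm (gram h p) (gram h' p))
    (V := velocity p Φ)
    (hK.image_of_continuousOn ((continuousOn_extChartAt p).mono hKp))
    (image_subset_iff.2 fun x hx ↦ (extChartAt (𝓡 n) p).map_source (hKp hx))
    hG'.smooth (fun u hu ↦ hG'.smooth_chr hu) (fun u hu ↦ hG.smooth_idTension hG' hu)
    (fun u hu ↦ hG.smooth_idTensionForm hG' hu) (fun u hu k ↦ hΦ.contDiffAt_velocity hu k)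
    (fun u hu huC k ↦ hΦ.velocity_eq_zero hu (fun hk ↦ huC ⟨_, hk,
      (extChartAt (𝓡 n) p).right_inv hu⟩) k)
  change _ = 2 * ∫ u in (extChartAt (𝓡 n) p).target, (∑ c, eulerLagrange _ _ _ _ _ _ c u * _) * _
  rw [← h1, ← integral_const_mul]
  refine setIntegral_congr_fun (isOpen_extChartAt_target p).measurableSet fun u hu ↦ ?_
  rw [hΦ.deriv_energyDensity h h' ((extChartAt (𝓡 n) p).map_target hu),
    (extChartAt (𝓡 n) p).right_inv hu, idFirstVariation, mul_assoc]

end IsVariation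

end Bienergy

/-! ### Variations supported in a chart -/

section BumpVariation

variable {n : ℕ} {N : Type*} [TopologicalSpace N] [ChartedSpace (Eu n) N]

/-- The variation `u ↦ u + t χ(u) e` in the chart around `p`, extended by the identity. -/
def bumpVariation (p : N) (χ : Eu n → ℝ) (e : Eu n) (t : ℝ) (y : N) : N :=
  open Classical in
  if y ∈ (extChartAt (𝓡 n) p).source then
    (extChartAt (𝓡 n) p).symm
      (extChartAt (𝓡 n) p y + (t * χ (extChartAt (𝓡 n) p y)) • e)
  else y

theorem bumpVariation_of_mem {p y : N} (hy : y ∈ (extChartAt (𝓡 n) p).source) (χ : Eu n → ℝ)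
    (e : Eu n) (t : ℝ) :
    bumpVariation p χ e t y = (extChartAt (𝓡 n) p).symm
      (extChartAt (𝓡 n) p y + (t * χ (extChartAt (𝓡 n) p y)) • e) := if_pos hy

theorem bumpVariation_of_eq_zero {p y : N} {χ : Eu n → ℝ} (e : Eu n) (t : ℝ)
    (hy : y ∈ (extChartAt (𝓡 n) p).source → χ (extChartAt (𝓡 n) p y) = 0) :
    bumpVariation p χ e t y = y := by
  by_cases h : y ∈ (extChartAt (𝓡 n) p).source
  · rw [bumpVariation_of_mem h, hy h, mul_zero, zero_smul, add_zero,
      (extChartAt (𝓡 n) p).left_inv h]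
  · exact if_neg h

/-- Points off the support of `χ` do not move, and on the compact support a single bound on `t`
works for all points. -/
theorem exists_forall_add_smul_mem {χ : Eu n → ℝ} {U : Set (Eu n)} (hU : IsOpen U)
    (hχ : Continuous χ) (hc : HasCompactSupport χ) (hs : tsupport χ ⊆ U) (e : Eu n) :
    ∃ ε > 0, ∀ t ∈ Ioo (-ε) ε, ∀ u ∈ U, u + (t * χ u) • e ∈ U := by
  have hcont : Continuous fun q : ℝ × Eu n ↦ q.2 + (q.1 * χ q.2) • e := by fun_prop
  have hev : ∀ᶠ t in 𝓝 (0 : ℝ), ∀ u ∈ tsupport χ, u + (t * χ u) • e ∈ U := by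
    refine IsCompact.eventually_forall_of_forall_eventually (K := tsupport χ) hc fun u hu ↦ ?_
    refine hcont.continuousAt.eventually_mem (hU.mem_nhds ?_)
    simpa using hs hu
  obtain ⟨ε, hε, h⟩ := Metric.eventually_nhds_iff.1 hev
  refine ⟨ε, hε, fun t ht u hu ↦ ?_⟩
  by_cases hus : u ∈ tsupport χ
  · exact h (by rw [Real.dist_eq, sub_zero, abs_lt]; exact ht) u hus
  · rw [image_eq_zero_of_notMem_tsupport hus, mul_zero, zero_smul, add_zero]
    exact hu

variable [IsManifold (𝓡 n) ∞ N] [T2Space N]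

theorem exists_isVariation_bump {p : N} {χ : Eu n → ℝ} (hχ : ContDiff ℝ ∞ χ)
    (hc : HasCompactSupport χ) (hs : tsupport χ ⊆ (extChartAt (𝓡 n) p).target) (e : Eu n) :
    ∃ ε, IsVariation n ε ((extChartAt (𝓡 n) p).symm '' tsupport χ) (bumpVariation p χ e) ∧
      ∀ u ∈ (extChartAt (𝓡 n) p).target, ∀ k,
        velocity p (bumpVariation p χ e) k u = χ u * e k := by
  have hU := isOpen_extChartAt_target (I := 𝓡 n) p
  obtain ⟨ε, hε, hmem⟩ := exists_forall_add_smul_mem hU hχ.continuous hc hs e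
  have hK : IsCompact ((extChartAt (𝓡 n) p).symm '' tsupport χ) :=
    IsCompact.image_of_continuousOn hc ((continuousOn_extChartAt_symm p).mono hs)
  have hoff (t : ℝ) (y : N) (hy : y ∉ (extChartAt (𝓡 n) p).symm '' tsupport χ) :
      bumpVariation p χ e t y = y :=
    bumpVariation_of_eq_zero e t fun hys ↦ image_eq_zero_of_notMem_tsupport fun hus ↦
      hy ⟨_, hus, (extChartAt (𝓡 n) p).left_inv hys⟩
  have hvar : IsVariation n ε ((extChartAt (𝓡 n) p).symm '' tsupport χ)
      (bumpVariation p χ e) :=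
    { pos := hε
      map_zero := fun y ↦ by
        by_cases hy : y ∈ (extChartAt (𝓡 n) p).source
        · rw [bumpVariation_of_mem hy, zero_mul, zero_smul, add_zero,
            (extChartAt (𝓡 n) p).left_inv hy]
        · exact if_neg hy
      eq_off := fun t _ y hy ↦ hoff t y hy
      smooth := by
        rintro ⟨t, y⟩ ⟨ht, -⟩
        refine ContMDiffAt.contMDiffWithinAt ?_
        by_cases hy : y ∈ (extChartAt (𝓡 n) p).source
        · have h1 : ContMDiffAt (𝓘(ℝ, ℝ).prod (𝓡 n)) 𝓘(ℝ, ℝ) ∞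
              (fun q : ℝ × N ↦ q.1) (t, y) := contMDiffAt_fst
          have h2 : ContMDiffAt (𝓘(ℝ, ℝ).prod (𝓡 n)) 𝓘(ℝ, Eu n) ∞
              (fun q : ℝ × N ↦ extChartAt (𝓡 n) p q.2) (t, y) :=
            ContMDiffAt.comp (t, y) (contMDiffAt_extChartAt_of_mem hy) contMDiffAt_snd
          have h3 : ContMDiffAt (𝓘(ℝ, ℝ).prod (𝓡 n)) 𝓘(ℝ, ℝ × Eu n) ∞
              (fun q : ℝ × N ↦ (q.1, extChartAt (𝓡 n) p q.2)) (t, y) := h1.prodMk_space h2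
          have h4 : ContMDiffAt 𝓘(ℝ, ℝ × Eu n) 𝓘(ℝ, Eu n) ∞
              (fun q : ℝ × Eu n ↦ q.2 + (q.1 * χ q.2) • e) (t, extChartAt (𝓡 n) p y) :=
            ContDiff.contMDiff (by fun_prop) |>.contMDiffAt
          have h5 := (contMDiffAt_extChartAt_symm (hmem t ht _
            ((extChartAt (𝓡 n) p).map_source hy))).comp (t, y) (h4.comp (t, y) h3)
          refine h5.congr_of_eventuallyEq ?_
          filter_upwards [continuousAt_snd.eventually_mem
            ((isOpen_extChartAt_source (I := 𝓡 n) p).mem_nhds hy)] with q hq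
          exact bumpVariation_of_mem hq χ e q.1
        -- In a Hausdorff manifold the compact image of the support is closed. A point outside the
        -- chart domain therefore has a neighbourhood on which the variation is constantly the
        -- identity.
        · have hyK : y ∉ (extChartAt (𝓡 n) p).symm '' tsupport χ := by
            rintro ⟨u, hu, rfl⟩
            exact hy ((extChartAt (𝓡 n) p).map_target (hs hu))
          refine contMDiffAt_snd.congr_of_eventuallyEq ?_
          filter_upwards [continuousAt_snd.eventually_mem
            (hK.isClosed.isOpen_compl.mem_nhds hyK)] with q hq
          exact hoff q.1 q.2 hq }
  refine ⟨ε, hvar, fun u hu k ↦ ?_⟩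
  have h1 : HasDerivAt (fun t : ℝ ↦ u k + t * χ u * e k) (χ u * e k) 0 := by
    have := (((hasDerivAt_id (0 : ℝ)).mul_const (χ u)).mul_const (e k)).const_add (u k)
    simpa using this
  refine (hvar.hasDerivAt_chartMap hu k).unique (h1.congr_of_eventuallyEq ?_)
  filter_upwards [isOpen_Ioo.mem_nhds hvar.zero_mem] with t ht
  simp only [chartMap]
  rw [bumpVariation_of_mem ((extChartAt (𝓡 n) p).map_target hu),
    (extChartAt (𝓡 n) p).right_inv hu, (extChartAt (𝓡 n) p).right_inv (hmem t ht u hu)]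
  simp

end BumpVariation

/-! ### The Euler–Lagrange equation -/

section EulerLagrange

variable {n : ℕ}

/-- The fundamental lemma of the calculus of variations, for continuous functions. -/
theorem eq_zero_of_setIntegral_bump {U : Set (Eu n)} (hU : IsOpen U) {f : Eu n → ℝ}
    (hf : ContinuousOn f U)
    (h : ∀ χ : Eu n → ℝ, ContDiff ℝ ∞ χ → HasCompactSupport χ → tsupport χ ⊆ U →
      ∫ u in U, χ u * f u = 0) : ∀ u ∈ U, f u = 0 := by
  have hloc : LocallyIntegrableOn f U volume := hf.locallyIntegrableOn hU.measurableSet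
  have hae : ∀ᵐ u ∂(volume : Measure (Eu n)), u ∈ U → f u = 0 :=
    hU.ae_eq_zero_of_integral_contDiff_smul_eq_zero hloc fun χ h1 h2 h3 ↦ by
      rw [← h χ h1 h2 h3]
      simp only [smul_eq_mul]
      refine (setIntegral_eq_integral_of_forall_compl_eq_zero fun u hu ↦ ?_).symm
      rw [image_eq_zero_of_notMem_tsupport fun hus ↦ hu (h3 hus), zero_mul]
  have hae' : f =ᵐ[volume.restrict U] fun _ ↦ 0 := (ae_restrict_iff' hU.measurableSet).2 hae
  exact Measure.eqOn_open_of_ae_eq hae' hU hf continuousOn_const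

variable {N : Type*} [TopologicalSpace N] [ChartedSpace (Eu n) N] [IsManifold (𝓡 n) ∞ N]

theorem continuousOn_sqrt_det (h : RMetric n N) (p : N) :
    ContinuousOn (fun u ↦ Real.sqrt (gram h p u).det) (extChartAt (𝓡 n) p).target := fun _ hu ↦
  ((isMetric_gram h p).smooth_sqrt_det hu).continuousAt.continuousWithinAt

theorem continuousOn_idEulerLagrange (h h' : RMetric n N) (p : N) (c : Fin n) :
    ContinuousOn (idEulerLagrange (gram h p) (gram h' p) c) (extChartAt (𝓡 n) p).target :=
  fun _ hu ↦ ((isMetric_gram h p).smooth_idEulerLagrange (isMetric_gram h' p)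
    hu c).continuousAt.continuousWithinAt

theorem sqrt_det_ne_zero (h : RMetric n N) {p : N} {u : Eu n}
    (hu : u ∈ (extChartAt (𝓡 n) p).target) : Real.sqrt (gram h p u).det ≠ 0 :=
  (Real.sqrt_pos.2 ((isMetric_gram h p).det_pos hu)).ne'

variable [T2Space N] [MeasurableSpace N] [BorelSpace N]

/-- The Euler–Lagrange equation is necessary. -/
theorem IsBiharmonic.idEulerLagrange_eq_zero {h h' : RMetric n N}
    (hb : IsBiharmonic h h' (id : N → N)) (p : N) (c : Fin n) :
    ∀ u ∈ (extChartAt (𝓡 n) p).target, idEulerLagrange (gram h p) (gram h' p) c u = 0 := by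
  have key : ∀ u ∈ (extChartAt (𝓡 n) p).target,
      idEulerLagrange (gram h p) (gram h' p) c u * Real.sqrt (gram h p u).det = 0 := by
    refine eq_zero_of_setIntegral_bump (isOpen_extChartAt_target p)
      ((continuousOn_idEulerLagrange h h' p c).mul (continuousOn_sqrt_det h p))
      fun χ h1 h2 h3 ↦ ?_
    -- Moving in direction `e_c` isolates the component `c` of the Euler–Lagrange covector.
    obtain ⟨ε, hΦ, hv⟩ := exists_isVariation_bump h1 h2 h3 (EuclideanSpace.single c (1 : ℝ))
    set K := (extChartAt (𝓡 n) p).symm '' tsupport χ with hK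
    have hKc : IsCompact K :=
      IsCompact.image_of_continuousOn h2 ((continuousOn_extChartAt_symm p).mono h3)
    have hKp : K ⊆ (extChartAt (𝓡 n) p).source :=
      image_subset_iff.2 fun u hu ↦ (extChartAt (𝓡 n) p).map_target (h3 hu)
    have hd := (hb.2 K hKc ε hΦ.pos _ hΦ.smooth (funext hΦ.map_zero) hΦ.eq_off).unique
      (hΦ.hasDerivAt_bienergy h h' hKc)
    rw [hΦ.setIntegral_deriv_energyDensity h h' hKc hKp hKc.measurableSet subset_rfl] at hd
    have hz : ∫ u in (extChartAt (𝓡 n) p).target,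
        (∑ a, idEulerLagrange (gram h p) (gram h' p) a u *
          velocity p (bumpVariation p χ (EuclideanSpace.single c (1 : ℝ))) a u) *
          Real.sqrt (gram h p u).det = 0 := by linarith
    rw [← hz]
    refine setIntegral_congr_fun (isOpen_extChartAt_target p).measurableSet fun u hu ↦ ?_
    simp only [hv u hu, PiLp.single_apply, mul_ite, mul_one, mul_zero, Finset.sum_ite_eq',
      Finset.mem_univ, if_true]
    ring
  exact fun u hu ↦ (mul_eq_zero.1 (key u hu)).resolve_right (sqrt_det_ne_zero h hu)

/-- The Euler–Lagrange expression is a covector field. -/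
theorem idEulerLagrange_transform (h h' : RMetric n N) (p q : N) (c : Fin n) :
    ∀ u ∈ overlap n p q, idEulerLagrange (gram h p) (gram h' p) c u =
      ∑ a, idEulerLagrange (gram h q) (gram h' q) a (transition n p q u) *
        pd c (fun w ↦ transition n p q w a) u := by
  let R : Eu n → ℝ := fun u ↦ ∑ a, idEulerLagrange (gram h q) (gram h' q) a (transition n p q u) *
    pd c (fun w ↦ transition n p q w a) u
  have hR : ContinuousOn R (overlap n p q) := fun u hu ↦ by
    refine ContinuousAt.continuousWithinAt (ContDiffAt.continuousAt (n := ∞) (𝕜 := ℝ) ?_)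
    exact ContDiffAt.sum fun a _ ↦ (((isMetric_gram h q).smooth_idEulerLagrange
      (isMetric_gram h' q) (transition_mapsTo p q hu).1 a).comp u
      (contDiffAt_transition p q hu)).mul
      (contDiffAt_pd (contDiffAt_apply (contDiffAt_transition p q hu) a) c)
  have hsub : overlap n p q ⊆ (extChartAt (𝓡 n) p).target := fun _ hu ↦ hu.1
  have hmeas := (isOpen_extChartAt_target (I := 𝓡 n) p).measurableSet
  suffices hmain : ∀ u ∈ overlap n p q,
      (idEulerLagrange (gram h p) (gram h' p) c u - R u) * Real.sqrt (gram h p u).det = 0 from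
    fun u hu ↦ sub_eq_zero.1
      ((mul_eq_zero.1 (hmain u hu)).resolve_right (sqrt_det_ne_zero h hu.1))
  -- Covariance is proved weakly, without transforming the expression: for a bump variation
  -- supported in the overlap, both charts compute the integral of the same density derivative, and
  -- the fundamental lemma removes the test function.
  refine eq_zero_of_setIntegral_bump (isOpen_overlap p q)
    ((((continuousOn_idEulerLagrange h h' p c).mono hsub).sub hR).mul
      ((continuousOn_sqrt_det h p).mono hsub)) fun χ h1 h2 h3 ↦ ?_
  have h3' := h3.trans hsub
  obtain ⟨ε, hΦ, hv⟩ := exists_isVariation_bump h1 h2 h3' (EuclideanSpace.single c (1 : ℝ))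
  set Φ := bumpVariation p χ (EuclideanSpace.single c (1 : ℝ)) with hΦdef
  set K := (extChartAt (𝓡 n) p).symm '' tsupport χ with hK
  have hKc : IsCompact K :=
    IsCompact.image_of_continuousOn h2 ((continuousOn_extChartAt_symm p).mono h3')
  have hKp : K ⊆ (extChartAt (𝓡 n) p).source :=
    image_subset_iff.2 fun u hu ↦ (extChartAt (𝓡 n) p).map_target (h3' hu)
  have hKq : K ⊆ (extChartAt (𝓡 n) q).source := image_subset_iff.2 fun u hu ↦ (h3 hu).2
  -- The pairing of the covector with the velocity in the chart around `q`, extended by zero. As a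
  -- function on the manifold it can be integrated in either chart, which transports the integral
  -- from `q` to `p`.
  let D : N → ℝ := (extChartAt (𝓡 n) q).source.indicator fun x ↦
    ∑ a, idEulerLagrange (gram h q) (gram h' q) a (extChartAt (𝓡 n) q x) *
      velocity q Φ a (extChartAt (𝓡 n) q x)
  have hD0 (x : N) (hx : x ∉ K) : D x = 0 := by
    by_cases hxq : x ∈ (extChartAt (𝓡 n) q).source
    · simp only [D, indicator_of_mem hxq]
      refine Finset.sum_eq_zero fun a _ ↦ ?_
      rw [hΦ.velocity_eq_zero ((extChartAt (𝓡 n) q).map_source hxq)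
        (by rwa [(extChartAt (𝓡 n) q).left_inv hxq]), mul_zero]
    · exact indicator_of_notMem hxq _
  have hDc : Continuous D := by
    refine continuous_iff_continuousAt.2 fun x ↦ ?_
    by_cases hxq : x ∈ (extChartAt (𝓡 n) q).source
    · have hu := (extChartAt (𝓡 n) q).map_source hxq
      have hc1 : ContinuousAt (fun v ↦ ∑ a, idEulerLagrange (gram h q) (gram h' q) a v *
          velocity q Φ a v) (extChartAt (𝓡 n) q x) :=
        ContDiffAt.continuousAt (n := ∞) (𝕜 := ℝ) (ContDiffAt.sum fun a _ ↦
          ((isMetric_gram h q).smooth_idEulerLagrange (isMetric_gram h' q) hu a).mul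
            (hΦ.contDiffAt_velocity hu a))
      refine (ContinuousAt.comp (x := x) hc1
        (contMDiffAt_extChartAt_of_mem hxq).continuousAt).congr ?_
      filter_upwards [(isOpen_extChartAt_source (I := 𝓡 n) q).mem_nhds hxq] with z hz
      exact (indicator_of_mem hz _).symm
    · have hxK : x ∉ K := fun hx ↦ hxq (hKq hx)
      refine (continuousAt_const (y := (0 : ℝ))).congr ?_
      filter_upwards [hKc.isClosed.isOpen_compl.mem_nhds hxK] with z hz
      exact (hD0 z hz).symm
  have e1 := hΦ.setIntegral_deriv_energyDensity h h' hKc hKp hKc.measurableSet subset_rfl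
  have e2 := hΦ.setIntegral_deriv_energyDensity h h' hKc hKq hKc.measurableSet subset_rfl
  have e3 := setIntegral_riemannianVolume h (p := q) hKc.measurableSet hDc.continuousOn
    fun x hx ↦ hD0 x fun hxK ↦ hx ⟨hxK, hKq hxK⟩
  have e4 := setIntegral_riemannianVolume h (p := p) hKc.measurableSet hDc.continuousOn
    fun x hx ↦ hD0 x fun hxK ↦ hx ⟨hxK, hKp hxK⟩
  have e5 : ∫ u in (extChartAt (𝓡 n) q).target,
        D ((extChartAt (𝓡 n) q).symm u) * Real.sqrt (gram h q u).det =
      ∫ u in (extChartAt (𝓡 n) q).target,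
        (∑ a, idEulerLagrange (gram h q) (gram h' q) a u * velocity q Φ a u) *
          Real.sqrt (gram h q u).det := by
    refine setIntegral_congr_fun (isOpen_extChartAt_target q).measurableSet fun u hu ↦ ?_
    simp only [D, indicator_of_mem ((extChartAt (𝓡 n) q).map_target hu),
      (extChartAt (𝓡 n) q).right_inv hu]
  have hχ0 (u : Eu n) (hu : u ∉ overlap n p q) : χ u = 0 :=
    image_eq_zero_of_notMem_tsupport fun hus ↦ hu (h3 hus)
  have e6 : ∫ u in (extChartAt (𝓡 n) p).target,
        D ((extChartAt (𝓡 n) p).symm u) * Real.sqrt (gram h p u).det =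
      ∫ u in (extChartAt (𝓡 n) p).target, χ u * (R u * Real.sqrt (gram h p u).det) := by
    refine setIntegral_congr_fun hmeas fun u hu ↦ ?_
    by_cases huo : u ∈ overlap n p q
    · have hm : (extChartAt (𝓡 n) p).symm u ∈ (extChartAt (𝓡 n) q).source := huo.2
      simp only [D, indicator_of_mem hm]
      change (∑ a, idEulerLagrange (gram h q) (gram h' q) a (transition n p q u) *
        velocity q Φ a (transition n p q u)) * _ = _
      simp only [hΦ.velocity_transform huo, hv u hu, PiLp.single_apply, mul_ite, mul_one, mul_zero,
        Finset.sum_ite_eq', Finset.mem_univ, if_true, R]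
      rw [← mul_assoc, Finset.mul_sum]
      congr 1
      exact Finset.sum_congr rfl fun a _ ↦ by ring
    · have : (extChartAt (𝓡 n) p).symm u ∉ (extChartAt (𝓡 n) q).source := fun hq ↦ huo ⟨hu, hq⟩
      simp only [D, indicator_of_notMem this, hχ0 u huo, zero_mul]
  have e7 : ∫ u in (extChartAt (𝓡 n) p).target,
        (∑ a, idEulerLagrange (gram h p) (gram h' p) a u * velocity p Φ a u) *
          Real.sqrt (gram h p u).det =
      ∫ u in (extChartAt (𝓡 n) p).target,
        χ u * (idEulerLagrange (gram h p) (gram h' p) c u * Real.sqrt (gram h p u).det) := by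
    refine setIntegral_congr_fun hmeas fun u hu ↦ ?_
    simp only [hv u hu, PiLp.single_apply, mul_ite, mul_one, mul_zero, Finset.sum_ite_eq',
      Finset.mem_univ, if_true]
    ring
  have hrestrict (f : Eu n → ℝ) : ∫ u in (extChartAt (𝓡 n) p).target, χ u * f u =
      ∫ u in overlap n p q, χ u * f u :=
    setIntegral_eq_of_subset_of_forall_sdiff_eq_zero hmeas hsub fun u hu ↦ by
      rw [hχ0 u hu.2, zero_mul]
  have hint (f : Eu n → ℝ) (hf : ContinuousOn f (overlap n p q)) :
      IntegrableOn (fun u ↦ χ u * f u) (overlap n p q) :=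
    integrableOn_of_eq_zero_off_compact (isOpen_overlap p q) (h1.continuous.continuousOn.mul hf) h2
      h3 fun u _ hu ↦ by rw [image_eq_zero_of_notMem_tsupport hu, zero_mul]
  have e8 : ∫ u in overlap n p q, χ u *
        (idEulerLagrange (gram h p) (gram h' p) c u * Real.sqrt (gram h p u).det) =
      ∫ u in overlap n p q, χ u * (R u * Real.sqrt (gram h p u).det) := by
    rw [← hrestrict, ← hrestrict, ← e6, ← e7, ← e4, e3, e5]
    linarith
  have hsq := (continuousOn_sqrt_det h p).mono hsub
  simp only [sub_mul, mul_sub]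
  rw [integral_sub
    (hint (fun u ↦ idEulerLagrange (gram h p) (gram h' p) c u * Real.sqrt (gram h p u).det)
      (((continuousOn_idEulerLagrange h h' p c).mono hsub).mul hsq))
    (hint (fun u ↦ R u * Real.sqrt (gram h p u).det) (hR.mul hsq)), e8, sub_self]

end EulerLagrange

/-! ### Localization of variations -/

section Localization

variable {n : ℕ} {N : Type*} [TopologicalSpace N] [ChartedSpace (Eu n) N] {ε : ℝ} {K : Set N}
  {Φ : ℝ → N → N}

theorem mul_mem_Ioo_of_mem_Icc {t r : ℝ} (ht : t ∈ Ioo (-ε) ε) (hr : r ∈ Icc (0 : ℝ) 1) :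
    t * r ∈ Ioo (-ε) ε := by
  rw [mem_Ioo, ← abs_lt] at ht ⊢
  rw [abs_mul, abs_of_nonneg hr.1]
  exact (mul_le_of_le_one_right (abs_nonneg t) hr.2).trans_lt ht

/-- Slowing a variation down by a cutoff function localizes its support. -/
theorem IsVariation.localize (hΦ : IsVariation n ε K Φ) {χ : N → ℝ}
    (hχ : ContMDiff (𝓡 n) 𝓘(ℝ, ℝ) ∞ χ) (h01 : ∀ x, χ x ∈ Icc (0 : ℝ) 1) :
    IsVariation n ε (K ∩ tsupport χ) fun t x ↦ Φ (t * χ x) x where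
  pos := hΦ.pos
  smooth := by
    have h1 : ContMDiff (𝓘(ℝ, ℝ).prod (𝓡 n)) 𝓘(ℝ, ℝ) ∞ fun q : ℝ × N ↦ q.1 * χ q.2 :=
      contMDiff_fst.mul (hχ.comp contMDiff_snd)
    exact hΦ.smooth.comp (h1.prodMk contMDiff_snd).contMDiffOn
      fun q hq ↦ ⟨mul_mem_Ioo_of_mem_Icc hq.1 (h01 _), mem_univ _⟩
  map_zero x := by simp only [zero_mul, hΦ.map_zero]
  eq_off t ht x hx := by
    by_cases hxK : x ∈ K
    · have : χ x = 0 := image_eq_zero_of_notMem_tsupport fun hxs ↦ hx ⟨hxK, hxs⟩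
      simp only [this, mul_zero, hΦ.map_zero]
    · exact hΦ.eq_off _ (mul_mem_Ioo_of_mem_Icc ht (h01 x)) x hxK

variable [IsManifold (𝓡 n) ∞ N]

/-- Chain rule in `t` at fixed `x`. Only the velocities, not the variations themselves, are
decomposed by a partition of unity. -/
theorem IsVariation.velocity_localize (hΦ : IsVariation n ε K Φ) {χ : N → ℝ}
    (hχ : ContMDiff (𝓡 n) 𝓘(ℝ, ℝ) ∞ χ) (h01 : ∀ x, χ x ∈ Icc (0 : ℝ) 1) {p : N} {u : Eu n}
    (hu : u ∈ (extChartAt (𝓡 n) p).target) (k : Fin n) :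
    velocity p (fun t x ↦ Φ (t * χ x) x) k u =
      χ ((extChartAt (𝓡 n) p).symm u) * velocity p Φ k u := by
  have h1 := (hΦ.localize hχ h01).hasDerivAt_chartMap hu k
  have h2 : HasDerivAt (fun t : ℝ ↦ t * χ ((extChartAt (𝓡 n) p).symm u))
      (χ ((extChartAt (𝓡 n) p).symm u)) 0 := by
    simpa using (hasDerivAt_id (0 : ℝ)).mul_const (χ ((extChartAt (𝓡 n) p).symm u))
  have h3 : HasDerivAt (fun t ↦ chartMap n p Φ (t, u) k) (velocity p Φ k u)
      (0 * χ ((extChartAt (𝓡 n) p).symm u)) := by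
    rw [zero_mul]; exact hΦ.hasDerivAt_chartMap hu k
  rw [mul_comm]
  have h4 := HasDerivAt.comp (h₂ := fun t ↦ chartMap n p Φ (t, u) k) 0 h3 h2
  exact h1.unique h4

/-- Finitely many cutoff functions supported in chart domains whose sum is `1` on a compact set. -/
theorem exists_finite_cutoffs (n : ℕ) {N : Type*} [TopologicalSpace N] [ChartedSpace (Eu n) N]
    [IsManifold (𝓡 n) ∞ N] [T2Space N] [SecondCountableTopology N] {K : Set N}
    (hK : IsCompact K) :
    ∃ (s : Finset N) (χ : N → N → ℝ), (∀ b, ContMDiff (𝓡 n) 𝓘(ℝ, ℝ) ∞ (χ b)) ∧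
      (∀ b x, χ b x ∈ Icc (0 : ℝ) 1) ∧ (∀ b, tsupport (χ b) ⊆ (extChartAt (𝓡 n) b).source) ∧
      ∀ x ∈ K, ∑ b ∈ s, χ b x = 1 := by
  have : LocallyCompactSpace N := ChartedSpace.locallyCompactSpace (Eu n) N
  obtain ⟨f, hf⟩ := SmoothPartitionOfUnity.exists_isSubordinate_chartAt_source (𝓡 n) N
  -- Local finiteness leaves only finitely many members of the partition of unity that meet the
  -- compact set.
  have hfin := f.locallyFinite.finite_nonempty_inter_compact hK
  refine ⟨hfin.toFinset, fun b x ↦ f b x, fun b ↦ (f b).contMDiff,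
    fun b x ↦ ⟨f.nonneg b x, f.le_one b x⟩, fun b ↦ ?_, fun x hx ↦ ?_⟩
  · rw [extChartAt_source]
    exact hf b
  · rw [← f.sum_eq_one (mem_univ x)]
    refine (finsum_eq_sum_of_support_subset _ fun b hb ↦ ?_).symm
    simp only [Finite.coe_toFinset, mem_ofPred_eq]
    exact ⟨x, hb, hx⟩

variable [T2Space N] [SecondCountableTopology N] [MeasurableSpace N] [BorelSpace N]

/-- The Euler–Lagrange equation is sufficient. -/
theorem isBiharmonic_id_of_idEulerLagrange_eq_zero {h h' : RMetric n N}
    (h0 : ∀ (p : N) (c : Fin n), ∀ u ∈ (extChartAt (𝓡 n) p).target,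
      idEulerLagrange (gram h p) (gram h' p) c u = 0) : IsBiharmonic h h' (id : N → N) := by
  refine ⟨contMDiff_id, fun K hK ε hε Φ hsm hz hoff ↦ ?_⟩
  have hΦ : IsVariation n ε K Φ := ⟨hε, hsm, fun x ↦ congrFun hz x, hoff⟩
  have : IsFiniteMeasureOnCompacts (riemannianVolume h) := ⟨fun _ ↦ riemannianVolume_lt_top h⟩
  obtain ⟨s, χ, hχ, h01, hsupp, hsum⟩ := exists_finite_cutoffs n hK
  have hΨ (b : N) := hΦ.localize (hχ b) (h01 b)
  -- The density derivative depends only on the velocity and does so linearly. The localized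
  -- velocities add up to the original one: the cutoffs sum to `1` on `K`, and off `K` the velocity
  -- is zero.
  have hpt (x : N) : deriv (fun t ↦ energyDensity h h' Φ t x) 0 =
      ∑ b ∈ s, deriv (fun t ↦ energyDensity h h' (fun t x ↦ Φ (t * χ b x) x) t x) 0 := by
    have hx := mem_extChartAt_source (I := 𝓡 n) x
    have hu := (extChartAt (𝓡 n) x).map_source hx
    rw [hΦ.deriv_energyDensity h h' hx]
    simp only [(hΨ _).deriv_energyDensity h h' hx, ← Finset.mul_sum, idFirstVariation]
    rw [← firstVariation_sum s (isOpen_extChartAt_target x) hu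
      fun b w hw k ↦ (hΨ b).contDiffAt_velocity hw k]
    congr 1
    refine firstVariation_congr fun k ↦ ?_
    filter_upwards [(isOpen_extChartAt_target x).mem_nhds hu] with w hw
    simp only [hΦ.velocity_localize (hχ _) (h01 _) hw, ← Finset.sum_mul]
    by_cases hwK : (extChartAt (𝓡 n) x).symm w ∈ K
    · rw [hsum _ hwK, one_mul]
    · rw [hΦ.velocity_eq_zero hw hwK, mul_zero]
  have hint : ∫ x in K, deriv (fun t ↦ energyDensity h h' Φ t x) 0 ∂(riemannianVolume h) = 0 := by
    simp only [hpt]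
    rw [integral_finsetSum s fun b _ ↦
      ((hΨ b).continuous_deriv_energyDensity h h').continuousOn.integrableOn_compact hK]
    refine Finset.sum_eq_zero fun b _ ↦ ?_
    rw [(hΨ b).setIntegral_deriv_energyDensity h h' (hK.inter_right (isClosed_tsupport _))
      (inter_subset_right.trans (hsupp b)) hK.measurableSet inter_subset_left,
      setIntegral_eq_zero_of_forall_eq_zero fun u hu ↦ by simp [h0 b _ u hu], mul_zero]
  have hd := hΦ.hasDerivAt_bienergy h h' hK
  rwa [hint, mul_zero] at hd

/-- The identity map is biharmonic if and only if the Euler–Lagrange expression vanishes at the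
centre of every chart. -/
theorem isBiharmonic_id_iff {h h' : RMetric n N} :
    IsBiharmonic h h' (id : N → N) ↔
      ∀ (x : N) (c : Fin n), idEulerLagrange (gram h x) (gram h' x) c (extChartAt (𝓡 n) x x) = 0 := by
  refine ⟨fun hb x c ↦ hb.idEulerLagrange_eq_zero x c _ (mem_extChartAt_target x), fun h0 ↦
    isBiharmonic_id_of_idEulerLagrange_eq_zero fun p c u hu ↦ ?_⟩
  -- The second chart is the one around the very point with coordinate `u`, so the transition map
  -- sends `u` to the centre of that chart, where the vanishing is assumed.
  have huo : u ∈ overlap n p ((extChartAt (𝓡 n) p).symm u) := ⟨hu, mem_extChartAt_source _⟩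
  rw [idEulerLagrange_transform h h' p ((extChartAt (𝓡 n) p).symm u) c u huo]
  refine Finset.sum_eq_zero fun a _ ↦ ?_
  rw [transition, h0, zero_mul]

end Localization

end BiharmonicConformal

end

/-! ### The criterion on the manifold. -/

theorem mainTheorem1 {n : ℕ} (hn : 2 < n)
    {N : Type*} [TopologicalSpace N] [T2Space N] [SecondCountableTopology N]
    [MeasurableSpace N] [BorelSpace N]
    [ChartedSpace (EuclideanSpace ℝ (Fin n)) N] [IsManifold (𝓡 n) ∞ N]
    (h h' : BiharmonicConformal.RMetric n N)
    (ρ : N → ℝ) (hρ : ContMDiff (𝓡 n) 𝓘(ℝ, ℝ) ∞ ρ)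
    (hh' : ∀ (x : N) (v w : TangentSpace (𝓡 n) x),
      h'.inner x v w = Real.exp (2 * ρ x) * h.inner x v w) :
    BiharmonicConformal.IsBiharmonic h h' (id : N → N) ↔
      ∀ x : N,
        BiharmonicConformal.traceHess h (BiharmonicConformal.grad h ρ) x
          + (2 * BiharmonicConformal.laplacian h ρ x
              + (2 - (n : ℝ)) *
                BiharmonicConformal.normSq h (BiharmonicConformal.grad h ρ) x) •
              BiharmonicConformal.grad h ρ x
          + ((6 - (n : ℝ)) / 2) •
              BiharmonicConformal.grad h
                (BiharmonicConformal.normSq h (BiharmonicConformal.grad h ρ)) x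
          + BiharmonicConformal.ricciOp h (BiharmonicConformal.grad h ρ) x = 0 := by
  rw [BiharmonicConformal.isBiharmonic_id_iff]
  exact forall_congr' fun x ↦
    (BiharmonicConformal.biharmonicExpression_eq_zero_iff (by omega) hρ hh' x).symm
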